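/- **Theorem 2.2 (Local existence of strong solutions).** Setting. Let $H$ be a real Hilbert space with inner product $(\cdot,\cdot)_H$ and norm $\|\cdot\|$, and let $\varphi^1,\varphi^2:H\to(-\infty,\infty]$ be proper, lower semicontinuous and convex. Put $D(\varphi^i)=\{w\in H:\varphi^i(w)<\infty\}$; for $w\in D(\varphi^i)$ let $\partial\varphi^i(w)=\{\xi\in H:\varphi^i(v)-\varphi^i(w)\ge(\xi,v-w)_H\ \text{for all } v\in D(\varphi^i)\}$, let $D(\partial\varphi^i)=\{w\in D(\varphi^i):\partial\varphi^i(w)\ne\emptyset\}$, and for $w\in D(\partial\varphi^i)$ let $\mathring{\partial\varphi^i}(w)$ be the unique element of minimal norm of $\partial\varphi^i(w)$. For a kernel $k$ write $(k*w)(t)=\int_0^t k(t-s)w(s)\,ds$. For $S\in(0,\infty)$, $u_0\in H$ and $f:(0,S)\to H$, a function $u\in L^2(0,S;H)$ is a *strong solution on $[0,S]$* of $$\frac{d}{dt}\big[k*(u-u_0)\big](t)+\partial\varphi^1(u(t))-\partial\varphi^2(u(t))\ni f(t)\tag{1}$$ if $k*(u-u_0)\in W^{1,2}(0,S;H)$,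 $[k*(u-u_0)](0)=0$ (for the continuous representative), $u(t)\in D(\partial\varphi^1)\cap D(\partial\varphi^2)$ for a.e. $t\in(0,S)$, and there are $\xi,\eta\in L^2(0,S;H)$ with $\xi(t)\in\partial\varphi^1(u(t))$, $\eta(t)\in\partial\varphi^2(u(t))$ and $\frac{d}{dt}[k*(u-u_0)](t)+\xi(t)-\eta(t)=f(t)$ for a.e. $t\in(0,S)$. Assumptions. - (K) $k,\ell\in L^1_{\rm loc}([0,\infty))$ are nonnegative and nonincreasing on $(0,\infty)$ and $(k*\ell)(t)=1$ for all $t>0$. - (A1) For each $r\in\mathbb R$ the set $\{w\in H:\varphi^1(w)+\|w\|\le r\}$ is precompact in $H$. - (A2) $D(\partial\varphi^1)\subset D(\partial\varphi^2)$, and there are a constant $\nu_1\in[0,1)$ and a nondecreasing function $M_1:\mathbb R\to[0,\infty)$ such that $$\|\mathring{\partial\varphi^2}(w)\|\le\nu_1\|\mathring{\partial\varphi^1}(w)\|+M_1\big(\varphi^1(w)+\|w\|\big)\quad\text{for all } w\in D(\partial\varphi^1).$$ Claim. Assume (K), (A1), (A2), and let $T\in(0,\infty)$. Then for every $u_0\in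 D(\varphi^1)$ and every $f\in L^2(0,T;H)$ with $\ell*\|f(\cdot)\|^2\in L^\infty(0,T)$ there is $T_0\in(0,T]$ such that (1) has a strong solution $u$ on $[0,T_0]$ satisfying $$u\in C([0,T_0];H),\qquad u(0)=u_0,\qquad \varphi^1(u(\cdot))\in L^\infty(0,T_0).$$ Moreover, one can take $T_0=\min\{R,T\}$, where $R>0$ depends only on $\ell$, $\nu_1$, $M_1$, $\|u_0\|$, $\varphi^1(u_0)$ and $\big\|\ell*\|f(\cdot)\|^2\big\|_{L^\infty(0,T)}$ (and not otherwise on $H$, $\varphi^1$, $\varphi^2$, $k$, $T$, $u_0$, $f$). -/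

import Mathlib

open MeasureTheory Set
open scoped ContDiff

noncomputable section

namespace TimeFractional

/-! ### Convex functionals with values in `(-∞, ∞]` and their subdifferentials -/

section Functionals

variable {H : Type*} [NormedAddCommGroup H] [InnerProductSpace ℝ H]

/-- `φ : H → (-∞, ∞]` is proper, lower semicontinuous and convex. -/
structure IsProperLscConvex (φ : H → EReal) : Prop where
  ne_bot : ∀ w, φ w ≠ ⊥
  proper : ∃ w, φ w < ⊤
  lsc : LowerSemicontinuous φ
  convex : ∀ v w : H, ∀ a b : ℝ, 0 ≤ a → 0 ≤ b → a + b = 1 →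
    φ (a • v + b • w) ≤ (a : EReal) * φ v + (b : EReal) * φ w

/-- The effective domain `D(φ)`. -/
def effDomain (φ : H → EReal) : Set H := {w | φ w < ⊤}

/-- The subdifferential `∂φ(w)`; it is empty for `w ∉ D(φ)`. -/
def subdiff (φ : H → EReal) (w : H) : Set H :=
  {ξ | w ∈ effDomain φ ∧
    ∀ v ∈ effDomain φ, φ w + ((inner ℝ ξ (v - w) : ℝ) : EReal) ≤ φ v}

/-- The domain `D(∂φ)`. -/
def subdiffDomain (φ : H → EReal) : Set H := {w | (subdiff φ w).Nonempty}

/-- `ξ` is an element of minimal norm of `∂φ(w)`. -/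
def IsMinimalElement (φ : H → EReal) (w ξ : H) : Prop :=
  ξ ∈ subdiff φ w ∧ ∀ ζ ∈ subdiff φ w, ‖ξ‖ ≤ ‖ζ‖

/-- The minimal section of `∂φ`: the element of minimal norm of `∂φ(w)`, for `w ∈ D(∂φ)`. -/
def minimalSection (φ : H → EReal) (w : H) : H :=
  Classical.epsilon fun ξ => IsMinimalElement φ w ξ

theorem mem_subdiff_iff {φ : H → EReal} (hφ : ∀ w, φ w ≠ ⊥) {w ξ : H} :
    ξ ∈ subdiff φ w ↔ w ∈ effDomain φ ∧
      ∀ v ∈ effDomain φ, inner ℝ ξ (v - w) ≤ (φ v).toReal - (φ w).toReal := by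
  unfold subdiff
  simp only [mem_ofPred_eq]
  refine and_congr_right fun hw => forall₂_congr fun v hv => ?_
  have h1 : ((φ w).toReal : EReal) = φ w := EReal.coe_toReal (ne_of_lt hw) (hφ w)
  have h2 : ((φ v).toReal : EReal) = φ v := EReal.coe_toReal (ne_of_lt hv) (hφ v)
  rw [← h1, ← h2, ← EReal.coe_add, EReal.coe_le_coe_iff]
  simp only [EReal.toReal_coe]
  constructor <;> intro h <;> linarith

/-- On `D(∂φ)` the element of minimal norm exists and is unique. -/
theorem existsUnique_isMinimalElement [CompleteSpace H] {φ : H → EReal}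
    (hφ : ∀ w, φ w ≠ ⊥) {w : H} (hw : w ∈ subdiffDomain φ) :
    ∃! ξ, IsMinimalElement φ w ξ := by
  obtain ⟨ξ₀, hξ₀⟩ := hw
  have hwD : w ∈ effDomain φ := hξ₀.1
  have heq : subdiff φ w = ⋂ v ∈ effDomain φ,
      {ξ | inner ℝ ξ (v - w) ≤ (φ v).toReal - (φ w).toReal} := by
    ext ξ
    simp [mem_subdiff_iff hφ, hwD]
  have hconv : Convex ℝ (subdiff φ w) := by
    rw [heq]
    refine convex_iInter₂ fun v _ => ?_
    intro x hx y hy a b ha hb hab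
    simp only [mem_ofPred_eq] at hx hy ⊢
    rw [inner_add_left, real_inner_smul_left, real_inner_smul_left]
    have h1 := mul_le_mul_of_nonneg_left hx ha
    have h2 := mul_le_mul_of_nonneg_left hy hb
    calc _ ≤ _ := add_le_add h1 h2
      _ = (a + b) * ((φ v).toReal - (φ w).toReal) := by ring
      _ = _ := by rw [hab, one_mul]
  have hclosed : IsClosed (subdiff φ w) := by
    rw [heq]
    refine isClosed_biInter fun v _ => ?_
    exact isClosed_le (by fun_prop) continuous_const
  obtain ⟨ξ, hξ, hmin⟩ :=
    exists_norm_eq_iInf_of_complete_convex ⟨ξ₀, hξ₀⟩ hclosed.isComplete hconv 0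
  have hle : ∀ ζ ∈ subdiff φ w, ‖ξ‖ ≤ ‖ζ‖ := by
    intro ζ hζ
    have hb : BddBelow (range fun x : subdiff φ w => ‖(0 : H) - x‖) :=
      ⟨0, by rintro _ ⟨x, rfl⟩; exact norm_nonneg _⟩
    have h := ciInf_le hb ⟨ζ, hζ⟩
    rw [← hmin] at h
    simpa using h
  refine ⟨ξ, ⟨hξ, hle⟩, ?_⟩
  rintro ζ ⟨hζ, hζle⟩
  have hn : ‖ζ‖ = ‖ξ‖ := le_antisymm (hζle ξ hξ) (hle ζ hζ)
  have hmid : (1 / 2 : ℝ) • ξ + (1 / 2 : ℝ) • ζ ∈ subdiff φ w :=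
    hconv hξ hζ (by norm_num) (by norm_num) (by norm_num)
  have h1 := hle _ hmid
  rw [← smul_add, norm_smul] at h1
  have h2 : 2 * ‖ξ‖ ≤ ‖ξ + ζ‖ := by
    norm_num at h1
    linarith
  have h3 := parallelogram_law_with_norm ℝ ξ ζ
  have h4 : ‖ξ - ζ‖ * ‖ξ - ζ‖ ≤ 0 := by
    rw [hn] at h3
    nlinarith [norm_nonneg ξ, norm_nonneg (ξ + ζ)]
  have h5 : ‖ξ - ζ‖ = 0 := by nlinarith [norm_nonneg (ξ - ζ)]
  exact (sub_eq_zero.mp (norm_eq_zero.mp h5)).symm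

theorem minimalSection_spec [CompleteSpace H] {φ : H → EReal}
    (hφ : ∀ w, φ w ≠ ⊥) {w : H} (hw : w ∈ subdiffDomain φ) :
    IsMinimalElement φ w (minimalSection φ w) :=
  Classical.epsilon_spec (existsUnique_isMinimalElement hφ hw).exists

/-- The compactness condition on `φ¹`: the set `{w : φ¹(w) + ‖w‖ ≤ r}` is precompact
for each real `r`. -/
def CompactSublevels (φ₁ : H → EReal) : Prop :=
  ∀ r : ℝ, IsCompact (closure {w : H | φ₁ w + ((‖w‖ : ℝ) : EReal) ≤ (r : EReal)})

/-- The growth condition on `∂φ²` relative to `∂φ¹`. -/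
def GrowthCondition (φ₁ φ₂ : H → EReal) (ν : ℝ) (M : ℝ → ℝ) : Prop :=
  subdiffDomain φ₁ ⊆ subdiffDomain φ₂ ∧
    ∀ w ∈ subdiffDomain φ₁,
      ‖minimalSection φ₂ w‖ ≤ ν * ‖minimalSection φ₁ w‖ + M ((φ₁ w).toReal + ‖w‖)

end Functionals

/-! ### Convolutions and kernels -/

section Kernels

variable {X : Type*} [NormedAddCommGroup X] [NormedSpace ℝ X]

/-- `(k * w)(t) = ∫₀ᵗ k(t - s) w(s) ds`. -/
def volterraConv (k : ℝ → ℝ) (w : ℝ → X) (t : ℝ) : X := ∫ s in (0 : ℝ)..t, k (t - s) • w s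

/-- A nonnegative nonincreasing kernel in `L¹_loc([0, ∞))`. Only its values on `(0, ∞)` matter:
it may be singular at the origin. -/
structure IsKernel (k : ℝ → ℝ) : Prop where
  locInt : LocallyIntegrableOn k (Ici 0)
  nonneg : ∀ t, 0 < t → 0 ≤ k t
  antitone : AntitoneOn k (Ioi 0)

/-- `k` and `ℓ` are conjugate kernels: `k * ℓ = 1`. -/
structure IsConjugatePair (k ℓ : ℝ → ℝ) : Prop where
  left : IsKernel k
  right : IsKernel ℓ
  conv_eq_one : ∀ t, 0 < t → volterraConv k ℓ t = 1

/-! ### The space `W^{1,2}(0, S; X)` -/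

/-- Lebesgue measure on `(0, S)`. -/
abbrev volOn (S : ℝ) : Measure ℝ := volume.restrict (Ioo 0 S)

/-- `v'` is the weak (distributional) derivative of `v` on `(0, S)`. -/
def IsWeakDeriv (S : ℝ) (v v' : ℝ → X) : Prop :=
  ∀ θ : ℝ → ℝ, ContDiff ℝ ∞ θ → HasCompactSupport θ → tsupport θ ⊆ Ioo 0 S →
    ∫ t in Ioo 0 S, deriv θ t • v t = -∫ t in Ioo 0 S, θ t • v' t

/-- `v ∈ W^{1,2}(0, S; X)` with derivative `dv/dt = v'`. -/
def HasW12Deriv (S : ℝ) (v v' : ℝ → X) : Prop :=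
  MemLp v 2 (volOn S) ∧ MemLp v' 2 (volOn S) ∧ IsWeakDeriv S v v'

/-- The continuous representative of `v` on `[0, S]` exists and takes the value `x` at `0`. -/
def HasInitialValue (S : ℝ) (v : ℝ → X) (x : X) : Prop :=
  ∃ v₀ : ℝ → X, ContinuousOn v₀ (Icc 0 S) ∧ v =ᵐ[volOn S] v₀ ∧ v₀ 0 = x

end Kernels

/-! ### Strong solutions -/

section Solutions

variable {H : Type*} [NormedAddCommGroup H] [InnerProductSpace ℝ H]

/-- `u` is a strong solution on `[0, S]` of
`d/dt [k * (u - u₀)] + ∂φ¹(u) - ∂φ²(u) ∋ f`. -/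
def IsStrongSolution (k : ℝ → ℝ) (φ₁ φ₂ : H → EReal) (u₀ : H) (f : ℝ → H) (S : ℝ)
    (u : ℝ → H) : Prop :=
  MemLp u 2 (volOn S) ∧
  HasInitialValue S (volterraConv k fun t => u t - u₀) 0 ∧
  (∀ᵐ t ∂volOn S, u t ∈ subdiffDomain φ₁ ∩ subdiffDomain φ₂) ∧
  ∃ ζ ξ η : ℝ → H,
    HasW12Deriv S (volterraConv k fun t => u t - u₀) ζ ∧
    MemLp ξ 2 (volOn S) ∧ MemLp η 2 (volOn S) ∧
    ∀ᵐ t ∂volOn S, ξ t ∈ subdiff φ₁ (u t) ∧ η t ∈ subdiff φ₂ (u t) ∧ ζ t + ξ t - η t = f t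

/-- `φ(u(·)) ∈ L^∞(0, S)`. -/
def EnergyBounded (φ : H → EReal) (S : ℝ) (u : ℝ → H) : Prop :=
  (∀ᵐ t ∂volOn S, u t ∈ effDomain φ) ∧ MemLp (fun t => (φ (u t)).toReal) ⊤ (volOn S)

end Solutions

end TimeFractional

end

open TimeFractional

namespace TimeFractional

open Filter Topology

/-! ### Resolvents and Moreau envelopes -/

section Resolvent

variable {H : Type*} [NormedAddCommGroup H] [InnerProductSpace ℝ H] {φ : H → EReal}

/-! Write `L` for the primitive of `ℓ`. Since `k * ℓ = 1`, the equation is equivalent to the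
Volterra equation `u = u₀ + ℓ * (f - ξ + η)` with `ξ ∈ ∂φ¹(u)`, `η ∈ ∂φ²(u)`. It is solved by
regularization, uniform bounds and compactness.

For `lam > 0`, `∂φ¹` is replaced by its Yosida approximation `A`, `∂φ²(u)` by the Yosida
approximation of `∂φ²` at `J u`, clipped to norm `ν‖A u‖ + M r`, and `f` by continuous backward
averages. The nonlinearity is then Lipschitz, and `IsKernel.exists_volterra_solution` solves the
problem by contraction.

The key estimate is `IsConjugatePair.chain_inequality`: for the Moreau envelope `e` and `u = u₀ + ℓ
* g` one has `e(u(t)) - e(u₀) ≤ ℓ * (g, A u)`. It replaces the chain rule and uses only the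
monotonicity of the kernels and the convexity and quadratic upper bound of `e`. Because of the
clipping the right side is dissipative up to data, which bounds the energy and `ℓ * ‖A u‖²`
(`energy_estimate`). Where `L(S)` is small, this yields `φ¹(J u) + ‖J u‖ ≤ r` with `r` computed from
the data alone; the growth condition then shows that the clipping was never active
(`exists_approximate_solutions`). Hence `R` depends only on `ℓ`, `ν`, `M` and the norms of the data.

For the limit, a bound on `ℓ * ‖g‖²` makes `ℓ * g` equicontinuous with modulus of order `√L`, and `J
u` stays in a compact set, so the solutions converge uniformly (`exists_uniform_limit`). As `ℓ(S) >
0`, the selections are bounded in `L²` and converge weakly; subdifferentials are closed under such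
limits (`mem_subdiff_of_weak_limit`). Convolving with `k` turns the approximate equations into `k *
(u - u₀) = ∫ (f - ξ + η)`, an identity that survives weak limits and exhibits the weak derivative.
-/

theorem IsProperLscConvex.coe_toReal (hφ : IsProperLscConvex φ) {v : H} (hv : v ∈ effDomain φ) :
    ((φ v).toReal : EReal) = φ v :=
  EReal.coe_toReal (ne_of_lt hv) (hφ.ne_bot v)

theorem IsProperLscConvex.convex_toReal (hφ : IsProperLscConvex φ) {v w : H}
    (hv : v ∈ effDomain φ) (hw : w ∈ effDomain φ) {a b : ℝ} (ha : 0 ≤ a) (hb : 0 ≤ b)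
    (hab : a + b = 1) :
    a • v + b • w ∈ effDomain φ ∧
      (φ (a • v + b • w)).toReal ≤ a * (φ v).toReal + b * (φ w).toReal := by
  have h := hφ.convex v w a b ha hb hab
  rw [← hφ.coe_toReal hv, ← hφ.coe_toReal hw, ← EReal.coe_mul, ← EReal.coe_mul,
    ← EReal.coe_add] at h
  have hD : a • v + b • w ∈ effDomain φ := lt_of_le_of_lt h (EReal.coe_lt_top _)
  refine ⟨hD, ?_⟩
  rw [← hφ.coe_toReal hD] at h
  exact_mod_cast h

theorem IsProperLscConvex.le_of_tendsto (hφ : IsProperLscConvex φ) {ι : Type*} {F : Filter ι}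
    [F.NeBot] {v : ι → H} {x : H} {c : ι → ℝ} {c₀ : ℝ} (hv : Tendsto v F (𝓝 x))
    (hc : Tendsto c F (𝓝 c₀)) (hle : ∀ᶠ i in F, φ (v i) ≤ (c i : EReal)) :
    φ x ≤ (c₀ : EReal) := by
  by_contra hlt
  rw [not_le] at hlt
  obtain ⟨y, hy1, hy2⟩ := EReal.lt_iff_exists_real_btwn.1 hlt
  have h1 := hv.eventually (hφ.lsc x y hy2)
  have h2 := hc.eventually (gt_mem_nhds (EReal.coe_lt_coe_iff.1 hy1))
  obtain ⟨i, h1, h2, h3⟩ := (h1.and (h2.and hle)).exists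
  exact absurd (h1.trans_le h3) (not_lt.2 (EReal.coe_le_coe_iff.2 h2.le))

/-- Semicontinuity gives `φ > φ(x₀) - 1` on a ball about a point `x₀` of the domain. Convexity along
segments from `x₀` propagates this outside the ball with at most linear loss, so no separation
theorem is needed. -/
theorem IsProperLscConvex.exists_affine_minorant (hφ : IsProperLscConvex φ) :
    ∃ α β : ℝ, 0 ≤ α ∧ 0 ≤ β ∧ ∀ v ∈ effDomain φ, -α * ‖v‖ - β ≤ (φ v).toReal := by
  obtain ⟨x₀, hx₀⟩ := hφ.proper
  have hx₀' : x₀ ∈ effDomain φ := hx₀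
  set p := (φ x₀).toReal with hp
  have hlt : ((p - 1 : ℝ) : EReal) < φ x₀ := by
    rw [← hφ.coe_toReal hx₀']
    exact_mod_cast sub_one_lt p
  obtain ⟨d, hd, hball⟩ := Metric.eventually_nhds_iff.1 (hφ.lsc x₀ _ hlt)
  have key : ∀ v ∈ effDomain φ, p - 1 - (2 / d) * ‖v - x₀‖ ≤ (φ v).toReal := by
    intro v hv
    rcases lt_or_ge ‖v - x₀‖ d with h | h
    · have : ((p - 1 : ℝ) : EReal) < φ v := hball (y := v) (by rwa [dist_eq_norm])
      rw [← hφ.coe_toReal hv, EReal.coe_lt_coe_iff] at this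
      have : 0 ≤ (2 / d) * ‖v - x₀‖ := by positivity
      linarith
    · have hpos : 0 < ‖v - x₀‖ := hd.trans_le h
      -- This puts the convex combination at distance `d / 2` from `x₀`, inside the ball.
      set t := d / (2 * ‖v - x₀‖) with ht
      have ht0 : 0 < t := by positivity
      have ht1 : t ≤ 1 := by
        rw [ht, div_le_one (by positivity)]
        linarith
      obtain ⟨hD, hc⟩ := hφ.convex_toReal hx₀' hv (sub_nonneg.2 ht1) ht0.le (by ring)
      have hdist : dist ((1 - t) • x₀ + t • v) x₀ < d := by
        have : (1 - t) • x₀ + t • v - x₀ = t • (v - x₀) := by module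
        rw [dist_eq_norm, this, norm_smul, Real.norm_of_nonneg ht0.le, ht]
        field_simp
        norm_num
      have h1 : ((p - 1 : ℝ) : EReal) < φ ((1 - t) • x₀ + t • v) := hball hdist
      rw [← hφ.coe_toReal hD, EReal.coe_lt_coe_iff] at h1
      have h2 : p - 1 / t ≤ (φ v).toReal := by
        have : t * (p - 1 / t) ≤ t * (φ v).toReal := by
          have : t * (p - 1 / t) = t * p - 1 := by field_simp
          linarith
        exact le_of_mul_le_mul_left this ht0
      have h3 : 1 / t = (2 / d) * ‖v - x₀‖ := by
        rw [ht]; field_simp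
      linarith
  refine ⟨2 / d, |p - 1| + 2 / d * ‖x₀‖, by positivity, by positivity, fun v hv => ?_⟩
  have h1 := key v hv
  have h2 : (2 / d) * ‖v - x₀‖ ≤ (2 / d) * (‖v‖ + ‖x₀‖) :=
    mul_le_mul_of_nonneg_left (norm_sub_le _ _) (by positivity)
  have h3 := neg_abs_le (p - 1)
  linarith

/-- `J` is the resolvent `(1 + lam ∂φ)⁻¹`. -/
def IsResolvent (φ : H → EReal) (lam : ℝ) (J : H → H) : Prop :=
  ∀ x, lam⁻¹ • (x - J x) ∈ subdiff φ (J x)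

/-- The Yosida approximation attached to a resolvent. -/
noncomputable def yosida (lam : ℝ) (J : H → H) (x : H) : H := lam⁻¹ • (x - J x)

/-- The Moreau envelope attached to a resolvent. -/
noncomputable def moreau (φ : H → EReal) (lam : ℝ) (J : H → H) (x : H) : ℝ :=
  (φ (J x)).toReal + lam / 2 * ‖yosida lam J x‖ ^ 2

/-- The quadratic term makes the functional strongly convex: by the parallelogram law every
minimizing sequence is Cauchy. The affine minorant makes the infimum finite and semicontinuity
identifies the limit as a minimizer. -/
theorem exists_proximal_point [CompleteSpace H] (hφ : IsProperLscConvex φ) {lam : ℝ}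
    (hlam : 0 < lam) (x : H) :
    ∃ w ∈ effDomain φ, ∀ v ∈ effDomain φ,
      (φ w).toReal + ‖w - x‖ ^ 2 / (2 * lam) ≤ (φ v).toReal + ‖v - x‖ ^ 2 / (2 * lam) := by
  obtain ⟨α, β, hα, hβ, hmin⟩ := hφ.exists_affine_minorant
  set F : H → ℝ := fun v => (φ v).toReal + ‖v - x‖ ^ 2 / (2 * lam) with hF
  have hbdd : BddBelow (F '' effDomain φ) := by
    refine ⟨-α * ‖x‖ - β - lam * α ^ 2 / 2, ?_⟩
    rintro _ ⟨v, hv, rfl⟩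
    have h1 := hmin v hv
    have h2 : ‖v‖ ≤ ‖v - x‖ + ‖x‖ := by simpa using norm_add_le (v - x) x
    have h3 : α * ‖v - x‖ ≤ ‖v - x‖ ^ 2 / (2 * lam) + lam * α ^ 2 / 2 := by
      have : ‖v - x‖ ^ 2 / (2 * lam) + lam * α ^ 2 / 2 - α * ‖v - x‖
          = (‖v - x‖ - lam * α) ^ 2 / (2 * lam) := by field_simp; ring
      have : 0 ≤ (‖v - x‖ - lam * α) ^ 2 / (2 * lam) := by positivity
      linarith
    have h4 := mul_le_mul_of_nonneg_left h2 hα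
    simp only [hF]
    linarith
  obtain ⟨x₀, hx₀⟩ := hφ.proper
  have hne : (F '' effDomain φ).Nonempty := ⟨_, x₀, hx₀, rfl⟩
  set I := sInf (F '' effDomain φ) with hI
  have hIle : ∀ v ∈ effDomain φ, I ≤ F v := fun v hv => csInf_le hbdd ⟨v, hv, rfl⟩
  have hseq : ∀ n : ℕ, ∃ v ∈ effDomain φ, F v < I + 1 / ((n : ℝ) + 1) := by
    intro n
    obtain ⟨_, ⟨v, hv, rfl⟩, hlt⟩ :=
      exists_lt_of_csInf_lt hne (show I < I + 1 / ((n : ℝ) + 1) from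
        lt_add_of_pos_right _ (by positivity))
    exact ⟨v, hv, hlt⟩
  choose v hvD hvF using hseq
  have hmid : ∀ n m, ‖v n - v m‖ ^ 2 ≤ 4 * lam * (F (v n) + F (v m) - 2 * I) := by
    intro n m
    obtain ⟨hD, hc⟩ := hφ.convex_toReal (hvD n) (hvD m) (a := 1 / 2) (b := 1 / 2)
      (by norm_num) (by norm_num) (by norm_num)
    have h1 := hIle _ hD
    have hpar := parallelogram_law_with_norm ℝ (v n - x) (v m - x)
    have e1 : v n - x + (v m - x) = (2 : ℝ) • ((1 / 2 : ℝ) • v n + (1 / 2 : ℝ) • v m - x) := by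
      module
    have e2 : v n - x - (v m - x) = v n - v m := by abel
    rw [e1, e2, norm_smul, Real.norm_two] at hpar
    simp only [hF] at h1 ⊢
    have h2 : ‖(1 / 2 : ℝ) • v n + (1 / 2 : ℝ) • v m - x‖ ^ 2 / (2 * lam)
        = (‖v n - x‖ ^ 2 / (2 * lam) + ‖v m - x‖ ^ 2 / (2 * lam)) / 2
          - ‖v n - v m‖ ^ 2 / (8 * lam) := by
      field_simp
      nlinarith
    have h3 : ‖v n - v m‖ ^ 2 / (8 * lam) ≤
        ((φ (v n)).toReal + ‖v n - x‖ ^ 2 / (2 * lam)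
          + ((φ (v m)).toReal + ‖v m - x‖ ^ 2 / (2 * lam)) - 2 * I) / 2 := by linarith
    rw [div_le_iff₀ (by positivity)] at h3
    linarith
  have hCauchy : CauchySeq v := by
    refine cauchySeq_of_le_tendsto_0 (fun N : ℕ => √(8 * lam * (1 / ((N : ℝ) + 1)))) ?_ ?_
    · intro n m N hn hm
      rw [dist_eq_norm]
      refine Real.le_sqrt_of_sq_le ((hmid n m).trans ?_)
      have hn' : 1 / ((n : ℝ) + 1) ≤ 1 / ((N : ℝ) + 1) := by gcongr
      have hm' : 1 / ((m : ℝ) + 1) ≤ 1 / ((N : ℝ) + 1) := by gcongr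
      have : F (v n) + F (v m) - 2 * I ≤ 2 * (1 / ((N : ℝ) + 1)) := by
        linarith [hvF n, hvF m]
      nlinarith
    · have h := (tendsto_one_div_add_atTop_nhds_zero_nat (𝕜 := ℝ)).const_mul (8 * lam)
      simpa using h.sqrt
  obtain ⟨w, hw⟩ := cauchySeq_tendsto_of_complete hCauchy
  have hc : Tendsto (fun n : ℕ => I + 1 / ((n : ℝ) + 1) - ‖v n - x‖ ^ 2 / (2 * lam)) atTop
      (𝓝 (I + 0 - ‖w - x‖ ^ 2 / (2 * lam))) :=
    (tendsto_one_div_add_atTop_nhds_zero_nat.const_add I).sub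
      ((((hw.sub_const x).norm).pow 2).div_const _)
  have hle := hφ.le_of_tendsto hw hc (Eventually.of_forall fun n => by
    rw [← hφ.coe_toReal (hvD n), EReal.coe_le_coe_iff]
    have := hvF n
    simp only [hF] at this
    linarith)
  have hwD : w ∈ effDomain φ := lt_of_le_of_lt hle (EReal.coe_lt_top _)
  rw [← hφ.coe_toReal hwD, EReal.coe_le_coe_iff] at hle
  refine ⟨w, hwD, fun y hy => ?_⟩
  have := hIle y hy
  simp only [hF] at this
  linarith

/-- The subgradient inequality is the first-order condition at the proximal point: compare it with a
point moved by a fraction `t` towards `v`, divide by `t` and let `t → 0`. -/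
theorem exists_isResolvent [CompleteSpace H] (hφ : IsProperLscConvex φ) {lam : ℝ}
    (hlam : 0 < lam) : ∃ J : H → H, IsResolvent φ lam J := by
  choose J hJD hJ using exists_proximal_point hφ hlam
  refine ⟨J, fun x => (mem_subdiff_iff hφ.ne_bot).2 ⟨hJD x, fun v hv => ?_⟩⟩
  set w := J x with hw
  have key : ∀ t : ℝ, 0 < t → t ≤ 1 →
      inner ℝ (lam⁻¹ • (x - w)) (v - w) - t * (‖v - w‖ ^ 2 / (2 * lam)) ≤
        (φ v).toReal - (φ w).toReal := by
    intro t ht ht1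
    obtain ⟨hD, hc⟩ := hφ.convex_toReal (hJD x) hv (sub_nonneg.2 ht1) ht.le (by ring)
    have h1 := hJ x _ hD
    have e : (1 - t) • w + t • v - x = (w - x) + t • (v - w) := by module
    have h2 : ‖(w - x) + t • (v - w)‖ ^ 2
        = ‖w - x‖ ^ 2 - 2 * t * inner ℝ (x - w) (v - w) + t ^ 2 * ‖v - w‖ ^ 2 := by
      rw [norm_add_sq_real, inner_smul_right, norm_smul, ← neg_sub x w, inner_neg_left, norm_neg,
        Real.norm_of_nonneg ht.le]
      ring
    rw [← hw] at h1 hc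
    rw [e, h2] at h1
    rw [real_inner_smul_left]
    have h3 : (‖w - x‖ ^ 2 - 2 * t * inner ℝ (x - w) (v - w) + t ^ 2 * ‖v - w‖ ^ 2) / (2 * lam)
        = ‖w - x‖ ^ 2 / (2 * lam)
          - t * (lam⁻¹ * inner ℝ (x - w) (v - w) - t * (‖v - w‖ ^ 2 / (2 * lam))) := by
      field_simp
      ring
    rw [h3] at h1
    refine le_of_mul_le_mul_left ?_ ht
    linarith
  have hlim : Tendsto (fun t : ℝ => inner ℝ (lam⁻¹ • (x - w)) (v - w)
      - t * (‖v - w‖ ^ 2 / (2 * lam))) (𝓝[>] 0)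
      (𝓝 (inner ℝ (lam⁻¹ • (x - w)) (v - w) - 0 * (‖v - w‖ ^ 2 / (2 * lam)))) := by
    refine Tendsto.mono_left ?_ nhdsWithin_le_nhds
    exact (Continuous.tendsto (by fun_prop) 0)
  have := le_of_tendsto hlim (b := (φ v).toReal - (φ w).toReal) (by
    filter_upwards [Ioc_mem_nhdsGT (zero_lt_one' ℝ)] with t ht using key t ht.1 ht.2)
  simpa using this

theorem subdiff_monotone (hφ : ∀ w, φ w ≠ ⊥) {x y ξ η : H} (hξ : ξ ∈ subdiff φ x)
    (hη : η ∈ subdiff φ y) : 0 ≤ inner ℝ (ξ - η) (x - y) := by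
  rw [mem_subdiff_iff hφ] at hξ hη
  have h1 := hξ.2 y hη.1
  have h2 := hη.2 x hξ.1
  rw [← neg_sub x y, inner_neg_right] at h1
  rw [inner_sub_left]
  linarith

variable {lam : ℝ} {J : H → H}

theorem smul_yosida (hlam : 0 < lam) (x : H) : lam • yosida lam J x = x - J x := by
  rw [yosida, smul_smul, mul_inv_cancel₀ hlam.ne', one_smul]

theorem IsResolvent.nonexpansive (hJ : IsResolvent φ lam J) (hφ : ∀ w, φ w ≠ ⊥) (hlam : 0 < lam)
    (x y : H) : ‖J x - J y‖ ≤ ‖x - y‖ := by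
  have h := subdiff_monotone hφ (hJ x) (hJ y)
  rw [← smul_sub, real_inner_smul_left] at h
  have h' := nonneg_of_mul_nonneg_right h (inv_pos.2 hlam)
  have e : x - J x - (y - J y) = (x - y) - (J x - J y) := by abel
  rw [e, inner_sub_left, real_inner_self_eq_norm_sq] at h'
  have h2 := real_inner_le_norm (x - y) (J x - J y)
  by_contra! hlt
  nlinarith [norm_nonneg (x - y), norm_nonneg (J x - J y)]

/-- The triangle inequality and nonexpansiveness of `J` suffice; any Lipschitz constant would serve,
so the sharp one is not pursued. -/
theorem IsResolvent.yosida_norm_sub_le (hJ : IsResolvent φ lam J) (hφ : ∀ w, φ w ≠ ⊥)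
    (hlam : 0 < lam) (x y : H) :
    ‖yosida lam J x - yosida lam J y‖ ≤ 2 / lam * ‖x - y‖ := by
  have e : yosida lam J x - yosida lam J y = lam⁻¹ • ((x - y) - (J x - J y)) := by
    simp only [yosida]; module
  rw [e, norm_smul, Real.norm_of_nonneg (inv_nonneg.2 hlam.le), div_mul_eq_mul_div,
    div_eq_inv_mul]
  gcongr
  linarith [norm_sub_le (x - y) (J x - J y), hJ.nonexpansive hφ hlam x y]

theorem IsResolvent.mem_effDomain (hJ : IsResolvent φ lam J) (x : H) : J x ∈ effDomain φ :=
  (hJ x).1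

theorem IsResolvent.moreau_add_inner_le (hJ : IsResolvent φ lam J) (hφ : ∀ w, φ w ≠ ⊥)
    (hlam : 0 < lam) (x y : H) :
    moreau φ lam J x + inner ℝ (yosida lam J x) (y - x) ≤ moreau φ lam J y := by
  have h := ((mem_subdiff_iff hφ).1 (hJ x)).2 _ (hJ.mem_effDomain y)
  change inner ℝ (yosida lam J x) (J y - J x) ≤ _ at h
  have e : J y - J x = (y - x) - lam • (yosida lam J y - yosida lam J x) := by
    rw [smul_sub, smul_yosida hlam, smul_yosida hlam]; abel
  rw [e, inner_sub_right, inner_smul_right, inner_sub_right (yosida lam J x) (yosida lam J y),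
    real_inner_self_eq_norm_sq] at h
  have h2 := norm_sub_sq_real (yosida lam J x) (yosida lam J y)
  have h3 := mul_nonneg hlam.le (sq_nonneg ‖yosida lam J x - yosida lam J y‖)
  rw [h2] at h3
  simp only [moreau]
  linarith

/-- The subgradient inequality with `x` and `y` exchanged bounds the left side by `(A y - A x, y -
x)`, and `A` is Lipschitz. Together with `IsResolvent.moreau_add_inner_le` this is what the
chain-rule inequality needs from the envelope. -/
theorem IsResolvent.moreau_sub_le (hJ : IsResolvent φ lam J) (hφ : ∀ w, φ w ≠ ⊥)
    (hlam : 0 < lam) (x y : H) :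
    moreau φ lam J y - moreau φ lam J x - inner ℝ (yosida lam J x) (y - x)
      ≤ 2 / lam * ‖y - x‖ ^ 2 := by
  have h := hJ.moreau_add_inner_le hφ hlam y x
  have h2 := real_inner_le_norm (yosida lam J y - yosida lam J x) (y - x)
  have h3 := mul_le_mul_of_nonneg_right (hJ.yosida_norm_sub_le hφ hlam y x) (norm_nonneg (y - x))
  rw [inner_sub_left] at h2
  rw [← neg_sub y x, inner_neg_right] at h
  nlinarith

theorem IsResolvent.moreau_le (hJ : IsResolvent φ lam J) (hφ : ∀ w, φ w ≠ ⊥)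
    (hlam : 0 < lam) {x : H} (hx : x ∈ effDomain φ) : moreau φ lam J x ≤ (φ x).toReal := by
  have h := ((mem_subdiff_iff hφ).1 (hJ x)).2 _ hx
  change inner ℝ (yosida lam J x) (x - J x) ≤ _ at h
  rw [← smul_yosida hlam, inner_smul_right, real_inner_self_eq_norm_sq] at h
  have := mul_nonneg hlam.le (sq_nonneg ‖yosida lam J x‖)
  simp only [moreau]
  linarith

theorem IsResolvent.norm_yosida_le (hJ : IsResolvent φ lam J) (hφ : ∀ w, φ w ≠ ⊥)
    (hlam : 0 < lam) {x ξ : H} (hξ : ξ ∈ subdiff φ x) : ‖yosida lam J x‖ ≤ ‖ξ‖ := by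
  have h := subdiff_monotone hφ hξ (hJ x)
  change 0 ≤ inner ℝ (ξ - yosida lam J x) (x - J x) at h
  rw [← smul_yosida hlam, inner_smul_right] at h
  have h' := nonneg_of_mul_nonneg_right h hlam
  rw [inner_sub_left, real_inner_self_eq_norm_sq] at h'
  have h2 := real_inner_le_norm ξ (yosida lam J x)
  by_contra! hlt
  nlinarith [norm_nonneg ξ, norm_nonneg (yosida lam J x)]

theorem IsResolvent.continuous (hJ : IsResolvent φ lam J) (hφ : ∀ w, φ w ≠ ⊥)
    (hlam : 0 < lam) : Continuous J :=
  (LipschitzWith.of_dist_le_mul (K := 1) fun x y => by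
    simpa [dist_eq_norm] using hJ.nonexpansive hφ hlam x y).continuous

theorem IsResolvent.continuous_yosida (hJ : IsResolvent φ lam J) (hφ : ∀ w, φ w ≠ ⊥)
    (hlam : 0 < lam) : Continuous (yosida lam J) := by
  have := hJ.continuous hφ hlam
  unfold yosida
  fun_prop

theorem IsResolvent.continuous_moreau (hJ : IsResolvent φ lam J) (hφ : ∀ w, φ w ≠ ⊥)
    (hlam : 0 < lam) : Continuous (moreau φ lam J) := by
  refine continuous_iff_continuousAt.2 fun x => ?_
  have hl : Tendsto (fun y => moreau φ lam J x + inner ℝ (yosida lam J x) (y - x)) (𝓝 x)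
      (𝓝 (moreau φ lam J x)) := by
    have : Continuous fun y => moreau φ lam J x + inner ℝ (yosida lam J x) (y - x) := by fun_prop
    simpa using this.tendsto x
  have hu : Tendsto (fun y => moreau φ lam J x + inner ℝ (yosida lam J x) (y - x)
      + 2 / lam * ‖y - x‖ ^ 2) (𝓝 x) (𝓝 (moreau φ lam J x)) := by
    have : Continuous fun y => moreau φ lam J x + inner ℝ (yosida lam J x) (y - x)
      + 2 / lam * ‖y - x‖ ^ 2 := by fun_prop
    simpa using this.tendsto x
  refine tendsto_of_tendsto_of_tendsto_of_le_of_le hl hu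
    (fun y => hJ.moreau_add_inner_le hφ hlam x y) fun y => ?_
  linarith [hJ.moreau_sub_le hφ hlam x y]

/-- Clipping a vector to the ball of radius `ρ`. -/
noncomputable def clip (ρ : ℝ) (x : H) : H := (min ρ ‖x‖ / ‖x‖) • x

theorem norm_clip_le {ρ : ℝ} (hρ : 0 ≤ ρ) (x : H) : ‖clip ρ x‖ ≤ ρ := by
  rcases eq_or_ne x 0 with rfl | hx
  · simpa [clip] using hρ
  · have hx' : 0 < ‖x‖ := norm_pos_iff.2 hx
    rw [clip, norm_smul, Real.norm_of_nonneg (by positivity), div_mul_cancel₀ _ hx'.ne']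
    exact min_le_left _ _

theorem clip_of_norm_le {ρ : ℝ} {x : H} (h : ‖x‖ ≤ ρ) : clip ρ x = x := by
  rcases eq_or_ne x 0 with rfl | hx
  · simp [clip]
  · rw [clip, min_eq_right h, div_self (norm_ne_zero_iff.2 hx), one_smul]

/-- The radii differ because clipping is later applied at the state-dependent level `ν‖A x‖ + m`;
joint Lipschitz dependence keeps the regularized nonlinearity Lipschitz. -/
theorem norm_clip_sub_clip_le {ρ σ : ℝ} (hρ : 0 ≤ ρ) (hσ : 0 ≤ σ) (x y : H) :
    ‖clip ρ x - clip σ y‖ ≤ |ρ - σ| + 3 * ‖x - y‖ := by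
  rcases eq_or_ne x 0 with rfl | hx
  · have h0 : clip ρ (0 : H) = 0 := by simp [clip]
    have : ‖clip σ y‖ ≤ ‖y‖ := by
      rw [clip, norm_smul, norm_div, norm_norm, Real.norm_of_nonneg (by positivity)]
      rcases eq_or_ne y 0 with rfl | hy
      · simp
      · rw [div_mul_cancel₀ _ (norm_ne_zero_iff.2 hy)]
        exact min_le_right _ _
    rw [h0, zero_sub, zero_sub, norm_neg, norm_neg]
    linarith [abs_nonneg (ρ - σ), norm_nonneg y]
  rcases eq_or_ne y 0 with rfl | hy
  · have h0 : clip σ (0 : H) = 0 := by simp [clip]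
    have : ‖clip ρ x‖ ≤ ‖x‖ := by
      rw [clip, norm_smul, norm_div, norm_norm, Real.norm_of_nonneg (by positivity),
        div_mul_cancel₀ _ (norm_ne_zero_iff.2 hx)]
      exact min_le_right _ _
    rw [h0, sub_zero, sub_zero]
    linarith [abs_nonneg (ρ - σ), norm_nonneg x]
  have hx' : 0 < ‖x‖ := norm_pos_iff.2 hx
  have hy' : 0 < ‖y‖ := norm_pos_iff.2 hy
  set α := min ρ ‖x‖ with hα
  set β := min σ ‖y‖ with hβ
  have hα0 : 0 ≤ α := by positivity
  have hαβ : |α - β| ≤ |ρ - σ| + ‖x - y‖ := by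
    refine (abs_min_sub_min_le_max _ _ _ _).trans (max_le_add_of_nonneg (abs_nonneg _)
      (abs_nonneg _) |>.trans ?_)
    gcongr
    exact abs_norm_sub_norm_le x y
  have e : clip ρ x - clip σ y = (α / ‖x‖) • (x - y) + (α * (‖y‖ - ‖x‖) / (‖x‖ * ‖y‖)) • y
      + ((α - β) / ‖y‖) • y := by
    have : (β / ‖y‖) = (α / ‖x‖) - α * (‖y‖ - ‖x‖) / (‖x‖ * ‖y‖) - (α - β) / ‖y‖ := by
      field_simp; ring
    rw [clip, clip, ← hα, ← hβ, this]
    module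
  have hq : α / ‖x‖ ≤ 1 := (div_le_one hx').2 (min_le_right _ _)
  have hq0 : 0 ≤ α / ‖x‖ := by positivity
  have n1 : ‖(α / ‖x‖) • (x - y)‖ ≤ ‖x - y‖ := by
    rw [norm_smul, Real.norm_of_nonneg hq0]
    exact mul_le_of_le_one_left (norm_nonneg _) hq
  have n2 : ‖(α * (‖y‖ - ‖x‖) / (‖x‖ * ‖y‖)) • y‖ ≤ ‖x - y‖ := by
    have : α * (‖y‖ - ‖x‖) / (‖x‖ * ‖y‖) = (α / ‖x‖) * ((‖y‖ - ‖x‖) / ‖y‖) := by field_simp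
    rw [this, norm_smul, norm_mul, Real.norm_of_nonneg hq0, norm_div, norm_norm, mul_assoc,
      div_mul_cancel₀ _ hy'.ne', norm_sub_rev x y]
    exact (mul_le_of_le_one_left (norm_nonneg _) hq).trans (abs_norm_sub_norm_le y x)
  have n3 : ‖((α - β) / ‖y‖) • y‖ ≤ |ρ - σ| + ‖x - y‖ := by
    rw [norm_smul, norm_div, norm_norm, div_mul_cancel₀ _ hy'.ne']
    exact hαβ
  rw [e]
  linarith [norm_add₃_le (a := (α / ‖x‖) • (x - y))
    (b := (α * (‖y‖ - ‖x‖) / (‖x‖ * ‖y‖)) • y) (c := ((α - β) / ‖y‖) • y)]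

end Resolvent

/-! ### Kernels extended by zero -/

section ZeroExt

/-- The extension of a kernel by zero to `(-∞, 0]`. -/
noncomputable def zeroExt (κ : ℝ → ℝ) : ℝ → ℝ := (Ioi 0).indicator κ

/-- The primitive of a kernel. -/
noncomputable def primitive (κ : ℝ → ℝ) (t : ℝ) : ℝ := ∫ s in (0 : ℝ)..t, zeroExt κ s

variable {κ : ℝ → ℝ}

theorem zeroExt_of_pos {t : ℝ} (ht : 0 < t) : zeroExt κ t = κ t := indicator_of_mem ht κ

theorem zeroExt_of_nonpos {t : ℝ} (ht : t ≤ 0) : zeroExt κ t = 0 :=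
  indicator_of_notMem (notMem_Ioi.2 ht) κ

theorem IsKernel.zeroExt_nonneg (hκ : IsKernel κ) (t : ℝ) : 0 ≤ zeroExt κ t :=
  indicator_nonneg (fun x hx => hκ.nonneg x hx) t

theorem IsKernel.zeroExt_anti (hκ : IsKernel κ) {s t : ℝ} (hs : 0 < s) (hst : s ≤ t) :
    zeroExt κ t ≤ zeroExt κ s := by
  rw [zeroExt_of_pos hs, zeroExt_of_pos (hs.trans_le hst)]
  exact hκ.antitone hs (hs.trans_le hst) hst

/-- Superlevel sets at levels `a ≥ 0` lie in the positive half-line and are order-connected there by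
monotonicity; at negative levels they are everything. -/
theorem IsKernel.measurable_zeroExt (hκ : IsKernel κ) : Measurable (zeroExt κ) := by
  refine measurable_of_Ioi fun a => ?_
  rcases lt_or_ge a 0 with ha | ha
  · have : zeroExt κ ⁻¹' Ioi a = univ :=
      eq_univ_of_forall fun x => ha.trans_le (hκ.zeroExt_nonneg x)
    rw [this]
    exact MeasurableSet.univ
  · have hpos : ∀ x ∈ zeroExt κ ⁻¹' Ioi a, 0 < x := fun x hx => by
      by_contra! h
      have hx' : a < zeroExt κ x := hx
      rw [zeroExt_of_nonpos h] at hx'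
      exact absurd hx' (not_lt.2 ha)
    refine OrdConnected.measurableSet ⟨fun x hx y hy z hz => ?_⟩
    exact lt_of_lt_of_le (show a < zeroExt κ y from hy)
      (hκ.zeroExt_anti ((hpos x hx).trans_le hz.1) hz.2)

theorem IsKernel.intervalIntegrable (hκ : IsKernel κ) (a b : ℝ) :
    IntervalIntegrable (zeroExt κ) volume a b := by
  have key : ∀ c, IntegrableOn (zeroExt κ) (Iic c) := by
    intro c
    have h : IntegrableOn κ (Icc 0 c) :=
      hκ.locInt.integrableOn_compact_subset Icc_subset_Ici_self isCompact_Icc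
    have h2 : Integrable ((Ioc 0 c).indicator κ) :=
      (h.mono_set Ioc_subset_Icc_self).integrable_indicator measurableSet_Ioc
    refine h2.integrableOn.congr_fun (s := Iic c) (fun x hx => ?_) measurableSet_Iic
    by_cases h0 : 0 < x
    · rw [zeroExt_of_pos h0, indicator_of_mem (show x ∈ Ioc 0 c from ⟨h0, hx⟩)]
    · rw [zeroExt_of_nonpos (not_lt.1 h0), indicator_of_notMem fun h => h0 h.1]
  exact ⟨(key b).mono_set Ioc_subset_Iic_self, (key a).mono_set Ioc_subset_Iic_self⟩

theorem IsKernel.intervalIntegrable_comp (hκ : IsKernel κ) (t a b : ℝ) :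
    IntervalIntegrable (fun s => zeroExt κ (t - s)) volume a b := by
  have := (hκ.intervalIntegrable (t - a) (t - b)).comp_sub_left t
  simpa using this

theorem IsKernel.primitive_nonneg (hκ : IsKernel κ) {t : ℝ} (ht : 0 ≤ t) : 0 ≤ primitive κ t :=
  intervalIntegral.integral_nonneg ht fun _ _ => hκ.zeroExt_nonneg _

theorem IsKernel.primitive_sub (hκ : IsKernel κ) (s t : ℝ) :
    primitive κ t - primitive κ s = ∫ r in s..t, zeroExt κ r :=
  intervalIntegral.integral_interval_sub_left (hκ.intervalIntegrable _ _)
    (hκ.intervalIntegrable _ _)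

theorem IsKernel.primitive_mono (hκ : IsKernel κ) {s t : ℝ} (hst : s ≤ t) :
    primitive κ s ≤ primitive κ t := by
  rw [← sub_nonneg, hκ.primitive_sub]
  exact intervalIntegral.integral_nonneg hst fun _ _ => hκ.zeroExt_nonneg _

theorem primitive_of_nonpos {t : ℝ} (ht : t ≤ 0) : primitive κ t = 0 := by
  rw [primitive, intervalIntegral.integral_congr (g := fun _ => (0 : ℝ))]
  · simp
  · intro x hx
    rw [uIcc_of_ge ht] at hx
    exact zeroExt_of_nonpos hx.2

theorem IsKernel.continuous_primitive (hκ : IsKernel κ) : Continuous (primitive κ) :=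
  intervalIntegral.continuous_primitive (fun _ _ => hκ.intervalIntegrable _ _) 0

theorem integral_zeroExt_comp (t a b : ℝ) :
    ∫ s in a..b, zeroExt κ (t - s) = ∫ s in t - b..t - a, zeroExt κ s :=
  intervalIntegral.integral_comp_sub_left _ t

theorem IsKernel.integral_zeroExt_comp_eq (hκ : IsKernel κ) (t a b : ℝ) :
    ∫ s in a..b, zeroExt κ (t - s) = primitive κ (t - a) - primitive κ (t - b) := by
  rw [integral_zeroExt_comp, hκ.primitive_sub]

/-- The modulus of continuity of a kernel in `L¹`. -/
theorem IsKernel.integral_abs_sub_le (hκ : IsKernel κ) {s t : ℝ} (hs : 0 ≤ s) (hst : s ≤ t) :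
    ∫ r in (0 : ℝ)..t, |zeroExt κ (t - r) - zeroExt κ (s - r)| ≤ 2 * primitive κ (t - s) := by
  have hi : ∀ a b, IntervalIntegrable (fun r => |zeroExt κ (t - r) - zeroExt κ (s - r)|)
      volume a b := fun a b =>
    ((hκ.intervalIntegrable_comp t a b).sub (hκ.intervalIntegrable_comp s a b)).abs
  rw [← intervalIntegral.integral_add_adjacent_intervals (hi 0 s) (hi s t)]
  -- Monotonicity fixes the sign on `(0, s)`, so this part equals a difference of primitives, at
  -- most `primitive κ (t - s)`; the part on `(s, t)` is exactly that value.
  have h1 : ∫ r in (0 : ℝ)..s, |zeroExt κ (t - r) - zeroExt κ (s - r)|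
      = ∫ r in (0 : ℝ)..s, (zeroExt κ (s - r) - zeroExt κ (t - r)) := by
    rw [intervalIntegral.integral_of_le hs, intervalIntegral.integral_of_le hs,
      integral_Ioc_eq_integral_Ioo, integral_Ioc_eq_integral_Ioo]
    refine setIntegral_congr_fun measurableSet_Ioo fun r hr => ?_
    rw [abs_sub_comm, abs_of_nonneg]
    exact sub_nonneg.2 (hκ.zeroExt_anti (sub_pos.2 hr.2) (by linarith))
  have h2 : ∫ r in s..t, |zeroExt κ (t - r) - zeroExt κ (s - r)|
      = ∫ r in s..t, zeroExt κ (t - r) := by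
    refine intervalIntegral.integral_congr fun r hr => ?_
    rw [uIcc_of_le hst] at hr
    rw [zeroExt_of_nonpos (sub_nonpos.2 hr.1), sub_zero, abs_of_nonneg (hκ.zeroExt_nonneg _)]
  rw [h1, h2, intervalIntegral.integral_sub (hκ.intervalIntegrable_comp _ _ _)
    (hκ.intervalIntegrable_comp _ _ _), hκ.integral_zeroExt_comp_eq, hκ.integral_zeroExt_comp_eq,
    hκ.integral_zeroExt_comp_eq]
  simp only [sub_zero, sub_self]
  rw [primitive_of_nonpos le_rfl]
  linarith [hκ.primitive_mono hst]

end ZeroExt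

/-! ### Volterra convolutions with continuous functions -/

section Volterra

variable {X : Type*} [NormedAddCommGroup X] [NormedSpace ℝ X] {κ : ℝ → ℝ}

/-- The moving endpoint is absorbed into the zero extension of the kernel, so that convolutions at
different times become integrals over one interval. The value of `κ` at `0` only matters on a null
set. -/
theorem volterraConv_eq_integral {g : ℝ → X} {t T : ℝ} (ht : 0 ≤ t) (htT : t ≤ T) :
    volterraConv κ g t = ∫ s in (0 : ℝ)..T, zeroExt κ (t - s) • g s := by
  rw [volterraConv, intervalIntegral.integral_of_le ht, intervalIntegral.integral_of_le
    (ht.trans htT), integral_Ioc_eq_integral_Ioo, ← integral_indicator measurableSet_Ioo,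
    ← integral_indicator measurableSet_Ioc]
  congr 1
  ext s
  by_cases h0 : s ∈ Ioo 0 t
  · rw [indicator_of_mem h0, indicator_of_mem (show s ∈ Ioc 0 T from ⟨h0.1, h0.2.le.trans htT⟩),
      zeroExt_of_pos (sub_pos.2 h0.2)]
  · rw [indicator_of_notMem h0]
    by_cases h1 : s ∈ Ioc 0 T
    · rw [indicator_of_mem h1, zeroExt_of_nonpos, zero_smul]
      by_contra! h
      exact h0 ⟨h1.1, by linarith⟩
    · rw [indicator_of_notMem h1]

theorem volterraConv_zero (g : ℝ → X) : volterraConv κ g 0 = 0 := by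
  simp [volterraConv]

theorem volterraConv_congr {g g' : ℝ → X} {t : ℝ} (ht : 0 ≤ t) (h : ∀ s ∈ Icc 0 t, g s = g' s) :
    volterraConv κ g t = volterraConv κ g' t := by
  refine intervalIntegral.integral_congr fun s hs => ?_
  rw [uIcc_of_le ht] at hs
  simp only [h s hs]

theorem volterraConv_swap (g : ℝ → X) (t : ℝ) :
    volterraConv κ g t = ∫ s in (0 : ℝ)..t, κ s • g (t - s) := by
  have := intervalIntegral.integral_comp_sub_left (fun s => κ s • g (t - s)) t (a := 0) (b := t)
  simpa [volterraConv] using this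

theorem volterraConv_comm (k ℓ : ℝ → ℝ) (t : ℝ) : volterraConv k ℓ t = volterraConv ℓ k t := by
  rw [volterraConv_swap]
  simp only [volterraConv, smul_eq_mul, mul_comm]

theorem IsConjugatePair.symm {k ℓ : ℝ → ℝ} (h : IsConjugatePair k ℓ) : IsConjugatePair ℓ k :=
  ⟨h.right, h.left, fun t ht => by rw [volterraConv_comm, h.conv_eq_one t ht]⟩

theorem IsKernel.intervalIntegrable_smul (hκ : IsKernel κ) {g : ℝ → X} {a b : ℝ}
    (hg : ContinuousOn g (uIcc a b)) (t : ℝ) :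
    IntervalIntegrable (fun s => zeroExt κ (t - s) • g s) volume a b :=
  (hκ.intervalIntegrable_comp t a b).smul_continuousOn hg

theorem IsKernel.volterraConv_const (hκ : IsKernel κ) {t : ℝ} (ht : 0 ≤ t) (c : ℝ) :
    volterraConv κ (fun _ => c) t = primitive κ t * c := by
  rw [volterraConv_eq_integral ht le_rfl]
  simp only [smul_eq_mul]
  rw [intervalIntegral.integral_mul_const, hκ.integral_zeroExt_comp_eq, sub_zero, sub_self,
    primitive_of_nonpos le_rfl, sub_zero]

theorem IsKernel.volterraConv_mono (hκ : IsKernel κ) {g g' : ℝ → ℝ} {t : ℝ} (ht : 0 ≤ t)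
    (hg : ContinuousOn g (Icc 0 t)) (hg' : ContinuousOn g' (Icc 0 t))
    (h : ∀ s ∈ Icc 0 t, g s ≤ g' s) : volterraConv κ g t ≤ volterraConv κ g' t := by
  rw [volterraConv_eq_integral ht le_rfl, volterraConv_eq_integral ht le_rfl]
  rw [← uIcc_of_le ht] at hg hg'
  refine intervalIntegral.integral_mono_on ht (hκ.intervalIntegrable_smul hg t)
    (hκ.intervalIntegrable_smul hg' t) fun s hs => ?_
  exact mul_le_mul_of_nonneg_left (h s hs) (hκ.zeroExt_nonneg _)

theorem IsKernel.volterraConv_add (hκ : IsKernel κ) {g g' : ℝ → X} {t : ℝ} (ht : 0 ≤ t)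
    (hg : ContinuousOn g (Icc 0 t)) (hg' : ContinuousOn g' (Icc 0 t)) :
    volterraConv κ (fun s => g s + g' s) t = volterraConv κ g t + volterraConv κ g' t := by
  rw [volterraConv_eq_integral ht le_rfl, volterraConv_eq_integral ht le_rfl,
    volterraConv_eq_integral ht le_rfl]
  rw [← uIcc_of_le ht] at hg hg'
  simp only [smul_add]
  exact intervalIntegral.integral_add (hκ.intervalIntegrable_smul hg t)
    (hκ.intervalIntegrable_smul hg' t)

theorem volterraConv_const_mul (g : ℝ → ℝ) (c t : ℝ) :
    volterraConv κ (fun s => c * g s) t = c * volterraConv κ g t := by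
  simp only [volterraConv, smul_eq_mul, ← intervalIntegral.integral_const_mul]
  congr 1
  ext s
  ring

theorem IsKernel.norm_volterraConv_le (hκ : IsKernel κ) {g : ℝ → X} {t : ℝ} (ht : 0 ≤ t) :
    ‖volterraConv κ g t‖ ≤ volterraConv κ (fun s => ‖g s‖) t := by
  rw [volterraConv_eq_integral ht le_rfl, volterraConv_eq_integral ht le_rfl]
  refine (intervalIntegral.norm_integral_le_integral_norm ht).trans_eq ?_
  simp only [norm_smul, Real.norm_of_nonneg (hκ.zeroExt_nonneg _), smul_eq_mul]

theorem IsKernel.norm_volterraConv_sub_le (hκ : IsKernel κ) {g : ℝ → X} {s t : ℝ} (hs : 0 ≤ s)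
    (hst : s ≤ t) (hg : ContinuousOn g (Icc 0 t)) :
    ‖volterraConv κ g t - volterraConv κ g s‖ ≤
      ∫ r in (0 : ℝ)..t, |zeroExt κ (t - r) - zeroExt κ (s - r)| * ‖g r‖ := by
  have ht := hs.trans hst
  rw [← uIcc_of_le ht] at hg
  rw [volterraConv_eq_integral ht le_rfl, volterraConv_eq_integral hs hst,
    ← intervalIntegral.integral_sub (hκ.intervalIntegrable_smul hg t)
    (hκ.intervalIntegrable_smul hg s)]
  refine (intervalIntegral.norm_integral_le_integral_norm ht).trans_eq ?_
  simp only [← sub_smul, norm_smul, Real.norm_eq_abs]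

theorem IsKernel.norm_volterraConv_sub_le_of_bound (hκ : IsKernel κ) {g : ℝ → X} {s t B : ℝ}
    (hs : 0 ≤ s) (hst : s ≤ t) (hg : ContinuousOn g (Icc 0 t)) (hB : ∀ r ∈ Icc 0 t, ‖g r‖ ≤ B) :
    ‖volterraConv κ g t - volterraConv κ g s‖ ≤ 2 * primitive κ (t - s) * B := by
  refine (hκ.norm_volterraConv_sub_le hs hst hg).trans ?_
  have ht := hs.trans hst
  have hB0 : 0 ≤ B := (norm_nonneg _).trans (hB 0 ⟨le_rfl, ht⟩)
  refine le_trans ?_ (mul_le_mul_of_nonneg_right (hκ.integral_abs_sub_le hs hst) hB0)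
  rw [← intervalIntegral.integral_mul_const]
  have hi := ((hκ.intervalIntegrable_comp t 0 t).sub (hκ.intervalIntegrable_comp s 0 t)).abs
  refine intervalIntegral.integral_mono_on ht ?_ (hi.mul_const _) fun r hr => ?_
  · exact hi.mul_continuousOn (by rw [uIcc_of_le ht]; exact hg.norm)
  · exact mul_le_mul_of_nonneg_left (hB r hr) (abs_nonneg _)

/-! ### Weighted Cauchy-Schwarz estimates and continuity of convolutions. -/

theorem sq_le_mul_of_forall_quadratic {A B x : ℝ} (h : ∀ θ : ℝ, 0 ≤ θ ^ 2 * A - 2 * θ * x + B) :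
    x ^ 2 ≤ A * B := by
  have := discrim_le_zero (a := A) (b := -2 * x) (c := B) fun θ => by
    have := h θ
    nlinarith
  rw [discrim] at this
  nlinarith

/-- The Cauchy-Schwarz inequality with a nonnegative weight. -/
theorem sq_integral_mul_le {m b : ℝ → ℝ} {t : ℝ} (ht : 0 ≤ t) (hm : ∀ s, 0 ≤ m s)
    (hmi : IntervalIntegrable m volume 0 t) (hb : ContinuousOn b (Icc 0 t)) :
    (∫ s in (0 : ℝ)..t, m s * b s) ^ 2 ≤
      (∫ s in (0 : ℝ)..t, m s) * ∫ s in (0 : ℝ)..t, m s * b s ^ 2 := by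
  rw [← uIcc_of_le ht] at hb
  refine sq_le_mul_of_forall_quadratic fun θ => ?_
  have h1 := hmi.mul_continuousOn hb
  have h2 : IntervalIntegrable (fun s => m s * b s ^ 2) volume 0 t :=
    hmi.mul_continuousOn (hb.pow 2)
  have : ∫ s in (0 : ℝ)..t, m s * (θ - b s) ^ 2 = θ ^ 2 * (∫ s in (0 : ℝ)..t, m s)
      - 2 * θ * (∫ s in (0 : ℝ)..t, m s * b s) + ∫ s in (0 : ℝ)..t, m s * b s ^ 2 := by
    rw [← intervalIntegral.integral_const_mul, ← intervalIntegral.integral_const_mul,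
      ← intervalIntegral.integral_sub (hmi.const_mul _) (h1.const_mul _),
      ← intervalIntegral.integral_add ((hmi.const_mul _).sub (h1.const_mul _)) h2]
    congr 1
    ext s
    ring
  rw [← this]
  exact intervalIntegral.integral_nonneg ht fun s _ => mul_nonneg (hm s) (sq_nonneg _)

theorem IsKernel.norm_volterraConv_sq_le (hκ : IsKernel κ) {g : ℝ → X} {t : ℝ} (ht : 0 ≤ t)
    (hg : ContinuousOn g (Icc 0 t)) :
    ‖volterraConv κ g t‖ ^ 2 ≤ primitive κ t * volterraConv κ (fun s => ‖g s‖ ^ 2) t := by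
  have h := sq_integral_mul_le ht (m := fun s => zeroExt κ (t - s))
    (fun s => hκ.zeroExt_nonneg _) (hκ.intervalIntegrable_comp t 0 t) hg.norm
  rw [hκ.integral_zeroExt_comp_eq, sub_zero, sub_self, primitive_of_nonpos le_rfl, sub_zero] at h
  rw [volterraConv_eq_integral ht le_rfl (g := fun s => ‖g s‖ ^ 2)]
  refine le_trans ?_ h
  gcongr
  refine (hκ.norm_volterraConv_le ht).trans_eq ?_
  rw [volterraConv_eq_integral ht le_rfl]
  rfl

/-- Cauchy-Schwarz with weight `|κ(t - r) - κ(s - r)|`: its mass is at most `2 * primitive κ (t -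
s)`, and it is dominated by the sum of the two kernels, whose integrals against `‖g‖²` are at most
`C` each. No pointwise bound on `g` is used, which makes the modulus uniform along the
approximation. -/
theorem IsKernel.norm_volterraConv_sub_sq_le (hκ : IsKernel κ) {g : ℝ → X} {s t C : ℝ}
    (hs : 0 ≤ s) (hst : s ≤ t) (hg : ContinuousOn g (Icc 0 t))
    (hCs : volterraConv κ (fun r => ‖g r‖ ^ 2) s ≤ C)
    (hCt : volterraConv κ (fun r => ‖g r‖ ^ 2) t ≤ C) :
    ‖volterraConv κ g t - volterraConv κ g s‖ ^ 2 ≤ 4 * C * primitive κ (t - s) := by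
  have ht := hs.trans hst
  have hi := ((hκ.intervalIntegrable_comp t 0 t).sub (hκ.intervalIntegrable_comp s 0 t)).abs
  have h := sq_integral_mul_le ht (m := fun r => |zeroExt κ (t - r) - zeroExt κ (s - r)|)
    (fun s => abs_nonneg _) hi hg.norm
  have hgu : ContinuousOn (fun r => ‖g r‖ ^ 2) (uIcc 0 t) := by
    rw [uIcc_of_le ht]; exact hg.norm.pow 2
  have h2 : ∫ r in (0 : ℝ)..t, |zeroExt κ (t - r) - zeroExt κ (s - r)| * ‖g r‖ ^ 2 ≤ 2 * C := by
    have : ∫ r in (0 : ℝ)..t, |zeroExt κ (t - r) - zeroExt κ (s - r)| * ‖g r‖ ^ 2 ≤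
        ∫ r in (0 : ℝ)..t, (zeroExt κ (t - r) • ‖g r‖ ^ 2 + zeroExt κ (s - r) • ‖g r‖ ^ 2) := by
      refine intervalIntegral.integral_mono_on ht (hi.mul_continuousOn hgu)
        ((hκ.intervalIntegrable_smul hgu t).add (hκ.intervalIntegrable_smul hgu s)) fun r _ => ?_
      rw [← add_smul, smul_eq_mul]
      refine mul_le_mul_of_nonneg_right ?_ (sq_nonneg _)
      have h1 := hκ.zeroExt_nonneg (t - r)
      have h2 := hκ.zeroExt_nonneg (s - r)
      rw [abs_le]
      constructor <;> linarith
    rw [intervalIntegral.integral_add (hκ.intervalIntegrable_smul hgu t)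
      (hκ.intervalIntegrable_smul hgu s), ← volterraConv_eq_integral ht le_rfl,
      ← volterraConv_eq_integral hs hst] at this
    linarith
  have h3 : 0 ≤ ∫ r in (0 : ℝ)..t, |zeroExt κ (t - r) - zeroExt κ (s - r)| * ‖g r‖ ^ 2 :=
    intervalIntegral.integral_nonneg ht fun r _ => by positivity
  have h4 : ‖volterraConv κ g t - volterraConv κ g s‖ ^ 2 ≤
      (∫ r in (0 : ℝ)..t, |zeroExt κ (t - r) - zeroExt κ (s - r)| * ‖g r‖) ^ 2 := by
    gcongr
    exact hκ.norm_volterraConv_sub_le hs hst hg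
  have h5 := mul_le_mul (hκ.integral_abs_sub_le hs hst) h2 h3
    (mul_nonneg zero_le_two (hκ.primitive_nonneg (sub_nonneg.2 hst)))
  linarith

theorem IsKernel.continuousOn_volterraConv (hκ : IsKernel κ) {g : ℝ → X} {T : ℝ}
    (hg : ContinuousOn g (Icc 0 T)) : ContinuousOn (volterraConv κ g) (Icc 0 T) := by
  obtain ⟨B, hB⟩ := isCompact_Icc.exists_bound_of_continuousOn hg
  have key : ∀ s ∈ Icc 0 T, ∀ t ∈ Icc 0 T,
      ‖volterraConv κ g t - volterraConv κ g s‖ ≤ 2 * primitive κ |t - s| * B := by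
    intro s hs t ht
    rcases le_total s t with h | h
    · rw [abs_of_nonneg (sub_nonneg.2 h)]
      exact hκ.norm_volterraConv_sub_le_of_bound hs.1 h (hg.mono (Icc_subset_Icc_right ht.2))
        fun r hr => hB r ⟨hr.1, hr.2.trans ht.2⟩
    · rw [abs_sub_comm, abs_of_nonneg (sub_nonneg.2 h), norm_sub_rev]
      exact hκ.norm_volterraConv_sub_le_of_bound ht.1 h (hg.mono (Icc_subset_Icc_right hs.2))
        fun r hr => hB r ⟨hr.1, hr.2.trans hs.2⟩
  intro s hs
  refine tendsto_iff_norm_sub_tendsto_zero.2 ?_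
  refine squeeze_zero' (Eventually.of_forall fun _ => norm_nonneg _)
    (eventually_nhdsWithin_of_forall fun t ht => key s hs t ht) ?_
  have hc : Continuous fun t => 2 * primitive κ |t - s| * B := by
    have := hκ.continuous_primitive
    fun_prop
  have := (hc.tendsto s).mono_left (nhdsWithin_le_nhds (s := Icc 0 T))
  simpa [primitive_of_nonpos] using this

end Volterra

/-! ### Conjugate pairs -/

section Conjugate

variable {X : Type*} [NormedAddCommGroup X] [NormedSpace ℝ X] {k ℓ : ℝ → ℝ}

/-- In `1 = ∫ k(t - s) ℓ(s) ds` the factor `k(t - s)` is at least `k(t)`. This lets the vanishing of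
`ℓ`-convolution increments compensate the singularity of `k`. -/
theorem IsConjugatePair.mul_primitive_le_one (h : IsConjugatePair k ℓ) {t : ℝ} (ht : 0 < t) :
    k t * primitive ℓ t ≤ 1 := by
  have h1 := h.conv_eq_one t ht
  -- A nonintegrable function has integral `0` by convention, so the value `1` itself yields
  -- integrability.
  have hi : IntervalIntegrable (fun s => k (t - s) • ℓ s) volume 0 t :=
    intervalIntegral.intervalIntegrable_of_integral_ne_zero (by
      rw [volterraConv] at h1; rw [h1]; exact one_ne_zero)
  rw [← h1, volterraConv, primitive, ← intervalIntegral.integral_const_mul]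
  refine intervalIntegral.integral_mono_on_of_le_Ioo ht.le
    ((h.right.intervalIntegrable 0 t).const_mul _) hi fun s hs => ?_
  rw [zeroExt_of_pos hs.1]
  exact mul_le_mul_of_nonneg_right (h.left.antitone (mem_Ioi.2 (sub_pos.2 hs.2))
    (mem_Ioi.2 ht) (by linarith [hs.1])) (h.right.nonneg _ hs.1)

theorem IsConjugatePair.integral_zeroExt_mul (h : IsConjugatePair k ℓ) {r t : ℝ} (hr : 0 ≤ r)
    (hrt : r < t) : ∫ s in (0 : ℝ)..t, zeroExt k (t - s) * zeroExt ℓ (s - r) = 1 := by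
  have h1 := h.conv_eq_one (t - r) (sub_pos.2 hrt)
  have h2 := intervalIntegral.integral_comp_sub_right
    (fun s => zeroExt k (t - r - s) * zeroExt ℓ s) r (a := 0) (b := t)
  have e : ∀ s, t - r - (s - r) = t - s := fun s => by ring
  simp only [e] at h2
  rw [h2, zero_sub, intervalIntegral.integral_of_le (by linarith),
    ← h1, volterraConv, intervalIntegral.integral_of_le (sub_pos.2 hrt).le,
    integral_Ioc_eq_integral_Ioo (x := 0), ← integral_indicator measurableSet_Ioo,
    ← integral_indicator measurableSet_Ioc]
  congr 1
  ext s
  by_cases hs : s ∈ Ioo 0 (t - r)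
  · rw [indicator_of_mem hs, indicator_of_mem (show s ∈ Ioc (-r) (t - r) from ⟨by linarith [hs.1], hs.2.le⟩),
      zeroExt_of_pos hs.1, zeroExt_of_pos (sub_pos.2 hs.2), smul_eq_mul]
  · rw [indicator_of_notMem hs]
    refine indicator_apply_eq_zero.2 fun hs' => ?_
    rcases le_or_gt s 0 with h0 | h0
    · rw [zeroExt_of_nonpos h0, mul_zero]
    · rw [zeroExt_of_nonpos, zero_mul]
      by_contra! hlt
      exact hs ⟨h0, by linarith⟩

/-- Fubini, with both kernels extended by zero so that the triangle becomes a square; the inner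
integral is `k * ℓ = 1`. -/
theorem IsConjugatePair.volterraConv_volterraConv [CompleteSpace X] (h : IsConjugatePair k ℓ)
    {g : ℝ → X} {t : ℝ} (ht : 0 ≤ t) (hg : Continuous g) :
    volterraConv k (volterraConv ℓ g) t = ∫ s in (0 : ℝ)..t, g s := by
  set f : ℝ → ℝ → X := fun s r => (zeroExt k (t - s) * zeroExt ℓ (s - r)) • g r with hf
  have hmeas : Measurable (Function.uncurry fun s r => zeroExt k (t - s) * zeroExt ℓ (s - r)) := by
    have h1 := h.left.measurable_zeroExt
    have h2 := h.right.measurable_zeroExt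
    simp only [Function.uncurry_def]
    fun_prop
  obtain ⟨B, hB⟩ := isCompact_Icc.exists_bound_of_continuousOn (hg.continuousOn (s := Icc 0 t))
  have hB0 : 0 ≤ B := (norm_nonneg _).trans (hB 0 ⟨le_rfl, ht⟩)
  have hker : Integrable (Function.uncurry fun s r => zeroExt k (t - s) * zeroExt ℓ (s - r))
      ((volume.restrict (Ioc 0 t)).prod (volume.restrict (Ioc 0 t))) := by
    refine (integrable_prod_iff hmeas.aestronglyMeasurable).2 ⟨Eventually.of_forall fun s => ?_, ?_⟩
    · have := (h.right.intervalIntegrable_comp s 0 t).const_mul (zeroExt k (t - s))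
      exact (intervalIntegrable_iff_integrableOn_Ioc_of_le ht).1 this
    · have e : ∀ s, ∫ r in Ioc 0 t, ‖zeroExt k (t - s) * zeroExt ℓ (s - r)‖
          = zeroExt k (t - s) * (primitive ℓ s - primitive ℓ (s - t)) := by
        intro s
        rw [← intervalIntegral.integral_of_le ht]
        simp only [norm_mul, Real.norm_of_nonneg (h.left.zeroExt_nonneg _),
          Real.norm_of_nonneg (h.right.zeroExt_nonneg _)]
        rw [intervalIntegral.integral_const_mul, h.right.integral_zeroExt_comp_eq, sub_zero]
      simp only [Function.uncurry, e]
      have hc := h.right.continuous_primitive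
      exact (intervalIntegrable_iff_integrableOn_Ioc_of_le ht).1
        ((h.left.intervalIntegrable_comp t 0 t).mul_continuousOn
          (Continuous.continuousOn (by fun_prop)))
  have hint : Integrable (Function.uncurry f)
      ((volume.restrict (Ioc 0 t)).prod (volume.restrict (Ioc 0 t))) := by
    refine (hker.norm.const_mul B).mono' ?_ ?_
    · have h1 : AEStronglyMeasurable (fun x : ℝ × ℝ => g x.2)
          ((volume.restrict (Ioc 0 t)).prod (volume.restrict (Ioc 0 t))) :=
        (hg.comp continuous_snd).aestronglyMeasurable
      exact hmeas.aestronglyMeasurable.smul h1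
    · rw [Measure.prod_restrict]
      refine (ae_restrict_iff' (measurableSet_Ioc.prod measurableSet_Ioc)).2
        (Eventually.of_forall fun x hx => ?_)
      simp only [Function.uncurry, hf, norm_smul]
      rw [mul_comm B]
      exact mul_le_mul_of_nonneg_left (hB _ ⟨hx.2.1.le, hx.2.2⟩) (norm_nonneg _)
  have h1 : volterraConv k (volterraConv ℓ g) t = ∫ s in Ioc 0 t, ∫ r in Ioc 0 t, f s r := by
    rw [volterraConv_eq_integral ht le_rfl, intervalIntegral.integral_of_le ht]
    refine setIntegral_congr_fun measurableSet_Ioc fun s hs => ?_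
    simp only [hf, mul_smul]
    rw [volterraConv_eq_integral hs.1.le hs.2, intervalIntegral.integral_of_le ht, integral_smul]
  rw [h1, integral_integral_swap hint, intervalIntegral.integral_of_le ht,
    integral_Ioc_eq_integral_Ioo, integral_Ioc_eq_integral_Ioo]
  refine setIntegral_congr_fun measurableSet_Ioo fun r hr => ?_
  simp only [hf]
  rw [integral_smul_const, ← intervalIntegral.integral_of_le ht,
    h.integral_zeroExt_mul hr.1.le hr.2, one_smul]

end Conjugate

/-! ### The chain-rule inequality -/

section Chain

variable {X : Type*} [NormedAddCommGroup X] [NormedSpace ℝ X] {κ k ℓ : ℝ → ℝ}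

theorem integral_zeroExt_shift {g : ℝ → X} {h s : ℝ} (hh : 0 ≤ h) (hs : 0 ≤ s) :
    ∫ r in (0 : ℝ)..s, zeroExt κ (s - h - r) • g r = volterraConv κ g (max (s - h) 0) := by
  rcases le_total 0 (s - h) with h0 | h0
  · rw [max_eq_left h0, volterraConv_eq_integral h0 (by linarith)]
  · rw [max_eq_right h0, volterraConv_zero, intervalIntegral.integral_congr (g := fun _ => (0 : X))]
    · simp
    · intro r hr
      rw [uIcc_of_le hs] at hr
      beta_reduce
      rw [zeroExt_of_nonpos (by linarith [hr.1]), zero_smul]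

/-- Convolution commutes with a delay by `h`. The argument `max (s - h) 0` freezes the delayed
function at `g 0 = 0` before time `h`, so the first piece of the integral vanishes. -/
theorem IsKernel.integral_zeroExt_smul_shift (hκ : IsKernel κ) {g : ℝ → X} {h t : ℝ}
    (hh : 0 ≤ h) (ht : h ≤ t) (hg : ContinuousOn g (Icc 0 t)) (hg0 : g 0 = 0) :
    ∫ s in (0 : ℝ)..t, zeroExt κ (t - s) • g (max (s - h) 0) = volterraConv κ g (t - h) := by
  have ht0 := hh.trans ht
  have hc : ContinuousOn (fun s => g (max (s - h) 0)) (Icc 0 t) :=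
    hg.comp (by fun_prop) fun s hs => ⟨le_max_right _ _, max_le (by linarith [hs.2]) ht0⟩
  have hi : ∀ a b, a ∈ Icc 0 t → b ∈ Icc 0 t →
      IntervalIntegrable (fun s => zeroExt κ (t - s) • g (max (s - h) 0)) volume a b :=
    fun a b ha hb => hκ.intervalIntegrable_smul (hc.mono (uIcc_subset_Icc ha hb)) t
  rw [← intervalIntegral.integral_add_adjacent_intervals (hi 0 h ⟨le_rfl, ht0⟩ ⟨hh, ht⟩)
    (hi h t ⟨hh, ht⟩ ⟨ht0, le_rfl⟩)]
  have h1 : ∫ s in (0 : ℝ)..h, zeroExt κ (t - s) • g (max (s - h) 0) = 0 := by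
    rw [intervalIntegral.integral_congr (g := fun _ => (0 : X))]
    · simp
    · intro s hs
      rw [uIcc_of_le hh] at hs
      beta_reduce
      rw [max_eq_right (sub_nonpos.2 hs.2), hg0, smul_zero]
  have h2 : ∫ s in h..t, zeroExt κ (t - s) • g (max (s - h) 0)
      = ∫ s in h..t, zeroExt κ (t - h - (s - h)) • g (s - h) := by
    refine intervalIntegral.integral_congr fun s hs => ?_
    rw [uIcc_of_le ht] at hs
    rw [max_eq_left (sub_nonneg.2 hs.1), sub_sub_sub_cancel_right]
  rw [h1, zero_add, h2,
    intervalIntegral.integral_comp_sub_right (fun s => zeroExt κ (t - h - s) • g s) h, sub_self,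
    volterraConv_eq_integral (sub_nonneg.2 ht) le_rfl]

variable {H : Type*} [NormedAddCommGroup H] [InnerProductSpace ℝ H]

/-- The increment over `[s - h, s]` of `(k * w, ξ) - k * p` is almost nonnegative. -/
theorem IsConjugatePair.increment_ge [CompleteSpace H] (hk : IsConjugatePair k ℓ) {w : ℝ → H} {p : ℝ → ℝ} {ξ : H}
    {C B h s : ℝ} (hC : 0 ≤ C) (hh : 0 ≤ h) (hs : 0 ≤ s)
    (hw : ContinuousOn w (Icc 0 s)) (hp : ContinuousOn p (Icc 0 s))
    (hβ : p s ≤ inner ℝ (w s) ξ)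
    (hd0 : ∀ r ∈ Icc 0 s, inner ℝ (w r - w s) ξ ≤ p r - p s)
    (hd1 : ∀ r ∈ Icc 0 s, p r - p s - inner ℝ (w r - w s) ξ ≤ C * ‖w r - w s‖ ^ 2)
    (hmod : ∀ r ∈ Icc 0 s, ‖w r - w s‖ ≤ 2 * primitive ℓ (s - r) * B) :
    -(4 * C * B ^ 2 * (h * primitive ℓ h)) ≤
      inner ℝ (volterraConv k w s - volterraConv k w (max (s - h) 0)) ξ
        - (volterraConv k p s - volterraConv k p (max (s - h) 0)) := by
  have hkk := hk.left
  have hw' : ContinuousOn w (uIcc 0 s) := by rwa [uIcc_of_le hs]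
  have hp' : ContinuousOn p (uIcc 0 s) := by rwa [uIcc_of_le hs]
  have i1 := hkk.intervalIntegrable_smul hw' s
  have i2 := hkk.intervalIntegrable_smul hw' (s - h)
  have i3 := hkk.intervalIntegrable_smul hp' s
  have i4 := hkk.intervalIntegrable_smul hp' (s - h)
  have hinner : ∀ {F : ℝ → H}, IntervalIntegrable F volume 0 s →
      inner ℝ (∫ r in (0 : ℝ)..s, F r) ξ = ∫ r in (0 : ℝ)..s, inner ℝ (F r) ξ := by
    intro F hF
    have := (innerSL ℝ ξ).intervalIntegral_comp_comm hF
    simp only [innerSL_apply_apply] at this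
    rw [real_inner_comm, ← this]
    simp only [real_inner_comm]
  have hinnerI : ∀ {F : ℝ → H}, IntervalIntegrable F volume 0 s →
      IntervalIntegrable (fun r => inner ℝ (F r) ξ) volume 0 s := fun hF =>
    ⟨hF.1.inner_const ξ, hF.2.inner_const ξ⟩
  have e1 : inner ℝ (volterraConv k w s - volterraConv k w (max (s - h) 0)) ξ
        - (volterraConv k p s - volterraConv k p (max (s - h) 0))
      = ∫ r in (0 : ℝ)..s, (zeroExt k (s - r) - zeroExt k (s - h - r))
          * (inner ℝ (w r) ξ - p r) := by
    rw [volterraConv_eq_integral hs le_rfl, ← integral_zeroExt_shift hh hs,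
      volterraConv_eq_integral hs le_rfl, ← integral_zeroExt_shift hh hs,
      ← intervalIntegral.integral_sub i1 i2, ← intervalIntegral.integral_sub i3 i4,
      hinner (i1.sub i2), ← intervalIntegral.integral_sub (hinnerI (i1.sub i2)) (i3.sub i4)]
    congr 1
    ext r
    rw [← sub_smul, real_inner_smul_left, smul_eq_mul, smul_eq_mul]
    ring
  rw [e1]
  -- The integrand's second factor is split as `β - d r`. The constant `β ≥ 0` meets a kernel
  -- difference with nonnegative integral; the convexity defect `d r ≥ 0` has to be controlled by
  -- the two cases below.
  set β := inner ℝ (w s) ξ - p s with hβdef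
  have hL := hk.right.primitive_nonneg hh
  set Q := 4 * C * B ^ 2 * primitive ℓ h with hQ
  have hQ0 : 0 ≤ Q := by positivity
  have ji : IntervalIntegrable (fun r => zeroExt k (s - r) - zeroExt k (s - h - r)) volume 0 s :=
    (hkk.intervalIntegrable_comp s 0 s).sub (hkk.intervalIntegrable_comp (s - h) 0 s)
  have qi : IntervalIntegrable ((Icc (s - h) s).indicator fun _ => Q) volume 0 s :=
    ((integrable_indicator_iff measurableSet_Icc).2
      (integrableOn_const (by simp))).intervalIntegrable
  have hle : ∫ r in (0 : ℝ)..s, ((zeroExt k (s - r) - zeroExt k (s - h - r)) * β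
        - (Icc (s - h) s).indicator (fun _ => Q) r) ≤
      ∫ r in (0 : ℝ)..s, (zeroExt k (s - r) - zeroExt k (s - h - r))
          * (inner ℝ (w r) ξ - p r) := by
    refine intervalIntegral.integral_mono_on_of_le_Ioo hs ((ji.mul_const β).sub qi)
      (ji.mul_continuousOn (by fun_prop)) fun r hr => ?_
    have hrI : r ∈ Icc 0 s := ⟨hr.1.le, hr.2.le⟩
    have hd0r := hd0 r hrI
    have hd1r := hd1 r hrI
    set d := p r - p s - inner ℝ (w r - w s) ξ with hd
    have hd_nonneg : 0 ≤ d := by linarith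
    have e2 : inner ℝ (w r) ξ - p r = β - d := by
      rw [hd, hβdef, inner_sub_left]; ring
    rw [e2, mul_sub _ β d]
    refine sub_le_sub_left ?_ _
    -- Before `s - h` the kernel difference is nonpositive, so the defect helps. Within the last
    -- stretch of length `h` the defect is quadratic in `primitive ℓ (s - r)`; one factor cancels `k
    -- (s - r)` and the other tends to `0` with `h`.
    by_cases hmem : r ∈ Icc (s - h) s
    · rw [indicator_of_mem hmem, zeroExt_of_nonpos (t := s - h - r) (by linarith [hmem.1]),
        sub_zero, zeroExt_of_pos (sub_pos.2 hr.2)]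
      have hkp := hk.mul_primitive_le_one (sub_pos.2 hr.2)
      have hkn := hkk.nonneg _ (sub_pos.2 hr.2)
      have hpn := hk.right.primitive_nonneg (sub_pos.2 hr.2).le
      have hpm := hk.right.primitive_mono (show s - r ≤ h by linarith [hmem.1])
      have hm := hmod r hrI
      have hsq : ‖w r - w s‖ ^ 2 ≤ (2 * primitive ℓ (s - r) * B) ^ 2 := by gcongr
      calc k (s - r) * d ≤ k (s - r) * (C * (2 * primitive ℓ (s - r) * B) ^ 2) := by
            refine mul_le_mul_of_nonneg_left (hd1r.trans ?_) hkn
            gcongr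
        _ = (4 * C * B ^ 2) * (k (s - r) * primitive ℓ (s - r)) * primitive ℓ (s - r) := by ring
        _ ≤ (4 * C * B ^ 2) * 1 * primitive ℓ h := by gcongr
        _ = Q := by rw [hQ]; ring
    · rw [indicator_of_notMem hmem]
      have hlt : r < s - h := by
        by_contra! h'
        exact hmem ⟨h', hr.2.le⟩
      refine mul_nonpos_of_nonpos_of_nonneg (sub_nonpos.2 ?_) hd_nonneg
      exact hkk.zeroExt_anti (by linarith) (by linarith)
  refine le_trans ?_ hle
  rw [intervalIntegral.integral_sub (ji.mul_const β) qi, intervalIntegral.integral_mul_const,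
    intervalIntegral.integral_sub (hkk.intervalIntegrable_comp s 0 s)
      (hkk.intervalIntegrable_comp (s - h) 0 s), hkk.integral_zeroExt_comp_eq,
    hkk.integral_zeroExt_comp_eq, sub_self, primitive_of_nonpos (κ := k) le_rfl,
    primitive_of_nonpos (κ := k) (show s - h - s ≤ 0 by linarith)]
  have hpos : 0 ≤ (primitive k (s - 0) - 0 - (primitive k (s - h - 0) - 0)) * β := by
    refine mul_nonneg ?_ (by linarith)
    have := hkk.primitive_mono (show s - h - 0 ≤ s - 0 by linarith)
    linarith
  have hq : ∫ r in (0 : ℝ)..s, (Icc (s - h) s).indicator (fun _ => Q) r ≤ Q * h := by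
    rw [intervalIntegral.integral_of_le hs]
    have hle : ∫ r in Ioc 0 s, (Icc (s - h) s).indicator (fun _ => Q) r ≤
        ∫ r, (Icc (s - h) s).indicator (fun _ => Q) r := by
      refine setIntegral_le_integral ((integrable_indicator_iff measurableSet_Icc).2
        (integrableOn_const (by simp))) (Eventually.of_forall fun r => ?_)
      exact indicator_nonneg (fun _ _ => hQ0) r
    refine hle.trans_eq ?_
    rw [integral_indicator measurableSet_Icc, setIntegral_const, Real.volume_real_Icc_of_le
      (by linarith), smul_eq_mul]
    ring
  have : Q * h = 4 * C * B ^ 2 * (h * primitive ℓ h) := by rw [hQ]; ring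
  linarith

/-- The chain-rule inequality for the nonlocal derivative, integrated against `ℓ`. -/
theorem IsConjugatePair.chain_inequality [CompleteSpace H] (hk : IsConjugatePair k ℓ)
    {e : H → ℝ} {A : H → H} {C : ℝ} (hC : 0 ≤ C) (he : Continuous e) (hA : Continuous A)
    (hsub : ∀ x y, e x + inner ℝ (A x) (y - x) ≤ e y)
    (hquad : ∀ x y, e y - e x - inner ℝ (A x) (y - x) ≤ C * ‖y - x‖ ^ 2)
    {g u : ℝ → H} (hg : Continuous g) (hu : Continuous u) {u₀ : H} {t : ℝ} (ht : 0 ≤ t)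
    (hug : ∀ s ∈ Icc 0 t, u s = u₀ + volterraConv ℓ g s) :
    e (u t) - e u₀ ≤ volterraConv ℓ (fun s => inner ℝ (g s) (A (u s))) t := by
  rcases ht.eq_or_lt with rfl | htpos
  · rw [hug 0 ⟨le_rfl, le_rfl⟩, volterraConv_zero, volterraConv_zero]
    simp
  have hℓ := hk.right
  set w : ℝ → H := fun s => u s - u₀ with hw
  set p : ℝ → ℝ := fun s => e (u s) - e u₀ with hp
  set ξ : ℝ → H := fun s => A (u s) with hξ
  have hwc : Continuous w := hu.sub continuous_const
  have hpc : Continuous p := (he.comp hu).sub continuous_const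
  have hξc : Continuous ξ := hA.comp hu
  have hwg : ∀ s ∈ Icc 0 t, w s = volterraConv ℓ g s := fun s hs => by
    simp only [hw]; rw [hug s hs]; abel
  obtain ⟨B, hB⟩ := isCompact_Icc.exists_bound_of_continuousOn (hg.continuousOn (s := Icc 0 t))
  obtain ⟨D, hD⟩ := isCompact_Icc.exists_bound_of_continuousOn (hξc.continuousOn (s := Icc 0 t))
  have hB0 : 0 ≤ B := (norm_nonneg _).trans (hB 0 ⟨le_rfl, ht⟩)
  have hD0 : 0 ≤ D := (norm_nonneg _).trans (hD 0 ⟨le_rfl, ht⟩)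
  set G : ℝ → H := fun s => ∫ r in (0 : ℝ)..s, g r with hG
  have hGc : Continuous G := intervalIntegral.continuous_primitive
    (fun _ _ => hg.intervalIntegrable _ _) 0
  -- Convolution with `k` undoes `ℓ`, so `k * w` is continuously differentiable with derivative `g`,
  -- whereas `Φ = k * p` is only known to be continuous.
  have hkw : ∀ s ∈ Icc 0 t, volterraConv k w s = G s := fun s hs => by
    rw [volterraConv_congr hs.1 fun r hr => hwg r ⟨hr.1, hr.2.trans hs.2⟩,
      hk.volterraConv_volterraConv hs.1 hg]
  set Φ := volterraConv k p with hΦ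
  have hΦc : ContinuousOn Φ (Icc 0 t) := hk.left.continuousOn_volterraConv hpc.continuousOn
  have hΦ0 : Φ 0 = 0 := volterraConv_zero _
  have hℓΦ : ∀ s, 0 ≤ s → volterraConv ℓ Φ s = ∫ r in (0 : ℝ)..s, p r := fun s hs =>
    hk.symm.volterraConv_volterraConv hs hpc
  have hmax : ∀ h, 0 ≤ h → ∀ s ∈ Icc 0 t, max (s - h) 0 ∈ Icc 0 t := fun h hh s hs =>
    ⟨le_max_right _ _, max_le (by linarith [hs.2]) ht⟩
  have hinc : ∀ h, 0 < h → ∀ s ∈ Icc 0 t,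
      -(4 * C * B ^ 2 * (h * primitive ℓ h)) ≤
        inner ℝ (G s - G (max (s - h) 0)) (ξ s) - (Φ s - Φ (max (s - h) 0)) := by
    intro h hh s hs
    have := hk.increment_ge (w := w) (p := p) (ξ := ξ s) (B := B) hC hh.le hs.1
      hwc.continuousOn hpc.continuousOn ?_ ?_ ?_ ?_
    · rwa [hkw s hs, hkw _ (hmax h hh.le s hs)] at this
    · have := hsub (u s) u₀
      rw [← neg_sub (u s) u₀, inner_neg_right, real_inner_comm] at this
      simp only [hp, hw, hξ]
      linarith
    · intro r hr
      have := hsub (u s) (u r)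
      rw [real_inner_comm] at this
      simp only [hp, hw, hξ, sub_sub_sub_cancel_right]
      linarith
    · intro r hr
      have := hquad (u s) (u r)
      rw [real_inner_comm] at this
      simp only [hp, hw, hξ, sub_sub_sub_cancel_right]
      exact this
    · intro r hr
      rw [hwg r ⟨hr.1, hr.2.trans hs.2⟩, hwg s hs, norm_sub_rev]
      exact hℓ.norm_volterraConv_sub_le_of_bound hr.1 hr.2 hg.continuousOn
        fun x hx => hB x ⟨hx.1, hx.2.trans hs.2⟩
  -- Convolving the increment inequality with `ℓ` before dividing by `h` avoids differentiating `Φ`: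
  -- since `ℓ * Φ = ∫ p`, its increment is `∫ p` over `[t - h, t]`, whose average tends to `p t`.
  have hmain : ∀ h ∈ Ioc 0 t,
      h⁻¹ * (∫ r in (t - h)..t, p r) - 4 * C * B ^ 2 * primitive ℓ h * primitive ℓ t ≤
        ∫ s in (0 : ℝ)..t, zeroExt ℓ (t - s) * inner ℝ (h⁻¹ • (G s - G (max (s - h) 0))) (ξ s) := by
    intro h hh
    have hGh : Continuous fun s => inner ℝ (G s - G (max (s - h) 0)) (ξ s) := by fun_prop
    have hΦh : ContinuousOn (fun s => Φ (max (s - h) 0)) (Icc 0 t) :=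
      hΦc.comp (by fun_prop) (hmax h hh.1.le)
    have hu0 : uIcc 0 t = Icc 0 t := uIcc_of_le ht
    have j1 := hℓ.intervalIntegrable_smul (a := 0) (b := t) hGh.continuousOn t
    have j2 := hℓ.intervalIntegrable_smul (g := Φ) (a := 0) (b := t) (by rwa [hu0]) t
    have j3 := hℓ.intervalIntegrable_smul (a := 0) (b := t) (by rwa [hu0]) t (g := fun s =>
      Φ (max (s - h) 0))
    have j4 := hℓ.intervalIntegrable_smul (a := 0) (b := t) continuousOn_const t (g := fun _ =>
      -(4 * C * B ^ 2 * (h * primitive ℓ h)))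
    have h1 : ∫ s in (0 : ℝ)..t, zeroExt ℓ (t - s) • -(4 * C * B ^ 2 * (h * primitive ℓ h)) ≤
        ∫ s in (0 : ℝ)..t, (zeroExt ℓ (t - s) • inner ℝ (G s - G (max (s - h) 0)) (ξ s)
          - (zeroExt ℓ (t - s) • Φ s - zeroExt ℓ (t - s) • Φ (max (s - h) 0))) := by
      refine intervalIntegral.integral_mono_on ht j4 (j1.sub (j2.sub j3)) fun s hs => ?_
      have := mul_le_mul_of_nonneg_left (hinc h hh.1 s hs) (hℓ.zeroExt_nonneg (t - s))
      simp only [smul_eq_mul]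
      linarith
    rw [intervalIntegral.integral_sub j1 (j2.sub j3), intervalIntegral.integral_sub j2 j3,
      hℓ.integral_zeroExt_smul_shift hh.1.le hh.2 hΦc hΦ0, ← volterraConv_eq_integral ht le_rfl,
      ← volterraConv_eq_integral (g := Φ) ht le_rfl, hℓ.volterraConv_const ht, hℓΦ t ht,
      hℓΦ (t - h) (sub_nonneg.2 hh.2),
      intervalIntegral.integral_interval_sub_left (hpc.intervalIntegrable _ _)
        (hpc.intervalIntegrable _ _)] at h1
    have h2 := mul_le_mul_of_nonneg_left h1 (inv_nonneg.2 hh.1.le)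
    rw [mul_sub, ← intervalIntegral.integral_const_mul] at h2
    have h3 : h⁻¹ * (primitive ℓ t * -(4 * C * B ^ 2 * (h * primitive ℓ h)))
        = -(4 * C * B ^ 2 * primitive ℓ h * primitive ℓ t) := by
      have := hh.1.ne'
      field_simp
    rw [h3] at h2
    have h4 : ∀ s, h⁻¹ * (zeroExt ℓ (t - s) • inner ℝ (G s - G (max (s - h) 0)) (ξ s))
        = zeroExt ℓ (t - s) * inner ℝ (h⁻¹ • (G s - G (max (s - h) 0))) (ξ s) := fun s => by
      rw [real_inner_smul_left, smul_eq_mul]; ring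
    simp only [h4] at h2
    linarith
  have hlim1 : Tendsto (fun h => h⁻¹ * (∫ r in (t - h)..t, p r)
      - 4 * C * B ^ 2 * primitive ℓ h * primitive ℓ t) (𝓝[>] 0) (𝓝 (p t - 0)) := by
    refine Tendsto.sub ?_ ?_
    · have hder : HasDerivAt (fun x => ∫ r in (0 : ℝ)..x, p r) (p t) t :=
        intervalIntegral.integral_hasDerivAt_right (hpc.intervalIntegrable _ _)
          (hpc.stronglyMeasurableAtFilter _ _) hpc.continuousAt
      have hslope := (hasDerivAt_iff_tendsto_slope.1 hder)
      have hmap : Tendsto (fun h : ℝ => t - h) (𝓝[>] 0) (𝓝[≠] t) := by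
        refine tendsto_nhdsWithin_iff.2 ⟨?_, ?_⟩
        · refine Tendsto.mono_left ?_ nhdsWithin_le_nhds
          simpa using (Continuous.tendsto (by fun_prop : Continuous fun h : ℝ => t - h) 0)
        · filter_upwards [self_mem_nhdsWithin] with h hh
          have : (0 : ℝ) < h := hh
          simp [this.ne']
      refine (hslope.comp hmap).congr fun h => ?_
      simp only [Function.comp_apply, slope, vsub_eq_sub, smul_eq_mul]
      rw [← intervalIntegral.integral_interval_sub_left (hpc.intervalIntegrable 0 t)
        (hpc.intervalIntegrable 0 (t - h))]
      have : t - h - t = -h := by ring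
      rw [this, inv_neg]
      ring
    · have hc := hℓ.continuous_primitive
      have : Continuous fun h => 4 * C * B ^ 2 * primitive ℓ h * primitive ℓ t := by fun_prop
      have h0 := (this.tendsto 0).mono_left (nhdsWithin_le_nhds (s := Ioi 0))
      simpa [primitive_of_nonpos] using h0
  have hlim2 : Tendsto (fun h => ∫ s in (0 : ℝ)..t,
      zeroExt ℓ (t - s) * inner ℝ (h⁻¹ • (G s - G (max (s - h) 0))) (ξ s)) (𝓝[>] 0)
      (𝓝 (∫ s in (0 : ℝ)..t, zeroExt ℓ (t - s) * inner ℝ (g s) (ξ s))) := by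
    refine intervalIntegral.tendsto_integral_filter_of_dominated_convergence
      (fun s => zeroExt ℓ (t - s) * (B * D)) ?_ ?_ ((hℓ.intervalIntegrable_comp t 0 t).mul_const _)
      ?_
    · refine Eventually.of_forall fun h => ?_
      have h1 : Measurable fun s => zeroExt ℓ (t - s) := by
        have := hℓ.measurable_zeroExt
        fun_prop
      have h2 : Continuous fun s => inner ℝ (h⁻¹ • (G s - G (max (s - h) 0))) (ξ s) := by
        fun_prop
      exact (h1.mul h2.measurable).aestronglyMeasurable
    · filter_upwards [self_mem_nhdsWithin] with h hh
      have hh' : (0 : ℝ) < h := hh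
      refine Eventually.of_forall fun s hs => ?_
      rw [uIoc_of_le ht] at hs
      have hsI : s ∈ Icc 0 t := ⟨hs.1.le, hs.2⟩
      have hm := hmax h hh'.le s hsI
      have hsub' : s - max (s - h) 0 ≤ h := by linarith [le_max_left (s - h) 0]
      have hge : max (s - h) 0 ≤ s := max_le (by linarith) hs.1.le
      have h1 : ‖G s - G (max (s - h) 0)‖ ≤ B * h := by
        simp only [hG]
        rw [intervalIntegral.integral_interval_sub_left (hg.intervalIntegrable _ _)
          (hg.intervalIntegrable _ _)]
        refine (intervalIntegral.norm_integral_le_of_norm_le_const (C := B) fun r hr => ?_).trans ?_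
        · rw [uIoc_of_le hge] at hr
          exact hB r ⟨hm.1.trans hr.1.le, hr.2.trans hs.2⟩
        · rw [abs_of_nonneg (sub_nonneg.2 hge)]
          gcongr
      have h2 : ‖h⁻¹ • (G s - G (max (s - h) 0))‖ ≤ B := by
        rw [norm_smul, Real.norm_of_nonneg (inv_nonneg.2 hh'.le), inv_mul_le_iff₀ hh']
        linarith
      rw [norm_mul, Real.norm_of_nonneg (hℓ.zeroExt_nonneg _)]
      refine mul_le_mul_of_nonneg_left ?_ (hℓ.zeroExt_nonneg _)
      refine (norm_inner_le_norm _ _).trans ?_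
      exact mul_le_mul h2 (hD s hsI) (norm_nonneg _) hB0
    · refine Eventually.of_forall fun s hs => ?_
      rw [uIoc_of_le ht] at hs
      refine Tendsto.const_mul _ (Tendsto.inner ?_ tendsto_const_nhds)
      have hder : HasDerivAt G (g s) s :=
        intervalIntegral.integral_hasDerivAt_right (hg.intervalIntegrable _ _)
          (hg.stronglyMeasurableAtFilter _ _) hg.continuousAt
      have hslope := (hasDerivAt_iff_tendsto_slope.1 hder)
      have hmap : Tendsto (fun h : ℝ => s - h) (𝓝[>] 0) (𝓝[≠] s) := by
        refine tendsto_nhdsWithin_iff.2 ⟨?_, ?_⟩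
        · refine Tendsto.mono_left ?_ nhdsWithin_le_nhds
          simpa using (Continuous.tendsto (by fun_prop : Continuous fun h : ℝ => s - h) 0)
        · filter_upwards [self_mem_nhdsWithin] with h hh
          have : (0 : ℝ) < h := hh
          simp [this.ne']
      refine (hslope.comp hmap).congr' ?_
      filter_upwards [Ioc_mem_nhdsGT hs.1] with h hh
      simp only [Function.comp_apply, slope, vsub_eq_sub]
      rw [max_eq_left (sub_nonneg.2 hh.2)]
      have : s - h - s = -h := by ring
      rw [this, inv_neg, neg_smul, ← smul_neg, neg_sub]
  rw [volterraConv_eq_integral ht le_rfl]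
  simp only [smul_eq_mul]
  have := le_of_tendsto_of_tendsto hlim1 hlim2 (by
    filter_upwards [Ioc_mem_nhdsGT htpos] with h hh using hmain h hh)
  rw [sub_zero] at this
  exact this

end Chain

/-! ### Volterra equations with Lipschitz nonlinearity -/

section Picard

open ENNReal NNReal

variable {X : Type*} [NormedAddCommGroup X] [NormedSpace ℝ X] {κ : ℝ → ℝ}

theorem IsKernel.tendsto_integral_mul_exp (hκ : IsKernel κ) {S : ℝ} (hS : 0 ≤ S) :
    Tendsto (fun γ : ℝ => ∫ s in (0 : ℝ)..S, zeroExt κ s * Real.exp (-γ * s)) atTop (𝓝 0) := by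
  suffices h : Tendsto (fun γ : ℝ => ∫ s in (0 : ℝ)..S, zeroExt κ s * Real.exp (-γ * s)) atTop
      (𝓝 (∫ _ in (0 : ℝ)..S, (0 : ℝ))) by simpa using h
  refine intervalIntegral.tendsto_integral_filter_of_dominated_convergence (zeroExt κ) ?_ ?_
    (hκ.intervalIntegrable 0 S) ?_
  · refine Eventually.of_forall fun γ => ?_
    have := hκ.measurable_zeroExt
    exact Measurable.aestronglyMeasurable (by fun_prop)
  · filter_upwards [eventually_ge_atTop 0] with γ hγ
    refine Eventually.of_forall fun s hs => ?_
    rw [uIoc_of_le hS] at hs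
    rw [norm_mul, Real.norm_of_nonneg (hκ.zeroExt_nonneg s), Real.norm_of_nonneg (Real.exp_pos _).le]
    refine mul_le_of_le_one_right (hκ.zeroExt_nonneg s) (Real.exp_le_one_iff.2 ?_)
    have := mul_nonneg hγ hs.1.le
    linarith
  · refine Eventually.of_forall fun s hs => ?_
    rw [uIoc_of_le hS] at hs
    have h1 : Tendsto (fun γ : ℝ => -γ * s) atTop atBot := by
      simp only [neg_mul]
      exact tendsto_neg_atTop_atBot.comp (tendsto_id.atTop_mul_const hs.1)
    simpa using (Real.tendsto_exp_atBot.comp h1).const_mul (zeroExt κ s)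

/-- Banach's fixed point theorem for the weighted unknown `exp(-γ t) u(t)`. The contraction constant
is `C ∫ κ(s) exp(-γ s) ds`, small for large `γ`, so a single step covers all of `[0, S]`. -/
theorem IsKernel.exists_volterra_solution [CompleteSpace X] (hκ : IsKernel κ) {S : ℝ}
    (hS : 0 ≤ S) {f : ℝ → X} (hf : Continuous f) {N : X → X} {C : ℝ} (hC : 0 ≤ C)
    (hN : ∀ x y, ‖N x - N y‖ ≤ C * ‖x - y‖) (u₀ : X) :
    ∃ u : ℝ → X, Continuous u ∧
      ∀ t ∈ Icc 0 S, u t = u₀ + volterraConv κ (fun s => f s + N (u s)) t := by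
  have hNc : Continuous N := (LipschitzWith.of_dist_le_mul (K := C.toNNReal) fun x y => by
    simpa only [dist_eq_norm, Real.coe_toNNReal C hC] using hN x y).continuous
  obtain ⟨γ, hγ⟩ : ∃ γ : ℝ, C * (∫ s in (0 : ℝ)..S, zeroExt κ s * Real.exp (-γ * s)) < 1 / 2 := by
    have h := (hκ.tendsto_integral_mul_exp hS).const_mul C
    rw [mul_zero] at h
    exact (h.eventually (gt_mem_nhds (by norm_num : (0 : ℝ) < 1 / 2))).exists
  set ext : C(Icc 0 S, X) → ℝ → X := fun w => IccExtend hS w with hext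
  have hextc : ∀ w, Continuous (ext w) := fun w => w.continuous.Icc_extend'
  set Ψ : C(Icc 0 S, X) → ℝ → X := fun w s => f s + N (Real.exp (γ * s) • ext w s) with hΨ
  have hΨc : ∀ w, Continuous (Ψ w) := fun w => by
    have := hextc w
    fun_prop
  set F : C(Icc 0 S, X) → C(Icc 0 S, X) := fun w =>
    ⟨(Icc 0 S).domRestrict fun t => Real.exp (-γ * t) • (u₀ + volterraConv κ (Ψ w) t), by
      refine continuousOn_iff_continuous_domRestrict.1 ?_
      exact ContinuousOn.smul (by fun_prop) (continuousOn_const.add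
        (hκ.continuousOn_volterraConv (hΨc w).continuousOn))⟩ with hF
  have hFval : ∀ w, ∀ t : Icc 0 S,
      F w t = Real.exp (-γ * t) • (u₀ + volterraConv κ (Ψ w) t) := fun w t => rfl
  have hcontr : ContractingWith (1 / 2) F := by
    refine ⟨by rw [← NNReal.coe_lt_coe]; norm_num, LipschitzWith.of_dist_le_mul fun w w' => ?_⟩
    refine (ContinuousMap.dist_le (by positivity)).2 fun t => ?_
    set d := dist w w' with hd
    have ht := t.2
    rw [hFval, hFval, dist_eq_norm, ← smul_sub, add_sub_add_left_eq_sub, norm_smul,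
      Real.norm_of_nonneg (Real.exp_pos _).le,
      volterraConv_eq_integral ht.1 le_rfl, volterraConv_eq_integral ht.1 le_rfl,
      ← intervalIntegral.integral_sub (hκ.intervalIntegrable_smul (hΨc w).continuousOn _)
        (hκ.intervalIntegrable_smul (hΨc w').continuousOn _)]
    have h1 : ‖∫ s in (0 : ℝ)..t, (zeroExt κ (t - s) • Ψ w s - zeroExt κ (t - s) • Ψ w' s)‖ ≤
        ∫ s in (0 : ℝ)..t, zeroExt κ (t - s) * (C * (Real.exp (γ * s) * d)) := by
      refine intervalIntegral.norm_integral_le_of_norm_le ht.1 (Eventually.of_forall fun s hs => ?_)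
        ((hκ.intervalIntegrable_comp _ _ _).mul_continuousOn (Continuous.continuousOn
          (by fun_prop)))
      rw [← smul_sub, norm_smul, Real.norm_of_nonneg (hκ.zeroExt_nonneg _)]
      refine mul_le_mul_of_nonneg_left ?_ (hκ.zeroExt_nonneg _)
      simp only [hΨ, add_sub_add_left_eq_sub]
      refine (hN _ _).trans (mul_le_mul_of_nonneg_left ?_ hC)
      rw [← smul_sub, norm_smul, Real.norm_of_nonneg (Real.exp_pos _).le]
      refine mul_le_mul_of_nonneg_left ?_ (Real.exp_pos _).le
      rw [← dist_eq_norm]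
      exact ContinuousMap.dist_apply_le_dist _
    have h2 : Real.exp (-γ * t) * (∫ s in (0 : ℝ)..t, zeroExt κ (t - s) *
          (C * (Real.exp (γ * s) * d)))
        = C * d * ∫ s in (0 : ℝ)..t, zeroExt κ s * Real.exp (-γ * s) := by
      have := intervalIntegral.integral_comp_sub_left
        (fun s => zeroExt κ s * Real.exp (-γ * s)) (t : ℝ) (a := 0) (b := t)
      rw [sub_self, sub_zero] at this
      rw [← this, ← intervalIntegral.integral_const_mul, ← intervalIntegral.integral_const_mul]
      congr 1
      ext s
      have e : Real.exp (-γ * (t - s)) = Real.exp (-γ * t) * Real.exp (γ * s) := by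
        rw [← Real.exp_add]; ring_nf
      rw [e]; ring
    have hint : ∀ a b, IntervalIntegrable (fun s => zeroExt κ s * Real.exp (-γ * s)) volume a b :=
      fun a b => (hκ.intervalIntegrable a b).mul_continuousOn
        (Continuous.continuousOn (by fun_prop))
    have h3 : ∫ s in (0 : ℝ)..t, zeroExt κ s * Real.exp (-γ * s) ≤
        ∫ s in (0 : ℝ)..S, zeroExt κ s * Real.exp (-γ * s) := by
      rw [← intervalIntegral.integral_add_adjacent_intervals (hint 0 t) (hint t S)]
      refine le_add_of_nonneg_right (intervalIntegral.integral_nonneg ht.2 fun s _ => ?_)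
      exact mul_nonneg (hκ.zeroExt_nonneg _) (Real.exp_pos _).le
    have hd0 : 0 ≤ d := dist_nonneg
    calc _ ≤ _ := mul_le_mul_of_nonneg_left h1 (Real.exp_pos _).le
      _ = _ := h2
      _ ≤ C * d * ∫ s in (0 : ℝ)..S, zeroExt κ s * Real.exp (-γ * s) := by gcongr
      _ = d * (C * ∫ s in (0 : ℝ)..S, zeroExt κ s * Real.exp (-γ * s)) := by ring
      _ ≤ d * (1 / 2) := by gcongr
      _ = ((1 / 2 : ℝ≥0) : ℝ) * d := by rw [mul_comm]; norm_num
  set w := hcontr.fixedPoint with hw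
  have hfix : F w = w := hcontr.fixedPoint_isFixedPt
  refine ⟨fun t => Real.exp (γ * t) • ext w t, ?_, fun t ht => ?_⟩
  · have := hextc w
    fun_prop
  · have h1 : ext w t = F w ⟨t, ht⟩ := by
      rw [hfix]
      exact IccExtend_of_mem hS w ht
    beta_reduce
    rw [h1, hFval, smul_smul, ← Real.exp_add]
    have : γ * t + -γ * t = 0 := by ring
    simp only [this, Real.exp_zero, one_smul, hΨ]

end Picard

/-! ### Backward averages -/

section Average

open ENNReal NNReal

variable {X : Type*} [NormedAddCommGroup X] [NormedSpace ℝ X] {κ : ℝ → ℝ}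

/-- The average of `F` over `[t - h, t]`. -/
noncomputable def backwardAverage (h : ℝ) (F : ℝ → X) (t : ℝ) : X := h⁻¹ • ∫ r in (t - h)..t, F r

theorem continuous_backwardAverage {F : ℝ → X} (hF : Integrable F) (h : ℝ) :
    Continuous (backwardAverage h F) := by
  have hc := intervalIntegral.continuous_primitive (fun a b => hF.intervalIntegrable) 0
  have e : backwardAverage h F = fun t =>
      h⁻¹ • ((∫ r in (0 : ℝ)..t, F r) - ∫ r in (0 : ℝ)..(t - h), F r) := by
    ext t
    rw [intervalIntegral.integral_interval_sub_left hF.intervalIntegrable hF.intervalIntegrable]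
    rfl
  rw [e]
  fun_prop

theorem sq_lintegral_le {α : Type*} [MeasurableSpace α] (μ : Measure α) {g : α → ℝ≥0∞}
    (hg : AEMeasurable g μ) : (∫⁻ a, g a ∂μ) ^ 2 ≤ μ univ * ∫⁻ a, g a ^ 2 ∂μ := by
  have h := ENNReal.lintegral_mul_le_Lp_mul_Lq μ Real.HolderConjugate.two_two hg
    (aemeasurable_const (b := (1 : ℝ≥0∞)))
  simp only [Pi.mul_apply, mul_one, ENNReal.one_rpow, lintegral_const, one_mul] at h
  calc (∫⁻ a, g a ∂μ) ^ 2 ≤ _ := pow_le_pow_left₀ zero_le h 2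
    _ = _ := by
      rw [mul_pow, ← ENNReal.rpow_natCast, ← ENNReal.rpow_natCast, ← ENNReal.rpow_mul,
        ← ENNReal.rpow_mul]
      norm_num
      rw [mul_comm]

theorem enorm_backwardAverage_sq_le {F : ℝ → X} (hF : Integrable F) {h : ℝ} (hh : 0 < h) (t : ℝ) :
    ‖backwardAverage h F t‖ₑ ^ 2 ≤
      ENNReal.ofReal h⁻¹ * ∫⁻ x in Ioc 0 h, ‖F (t - x)‖ₑ ^ 2 := by
  have e : backwardAverage h F t = h⁻¹ • ∫ x in Ioc 0 h, F (t - x) := by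
    rw [← intervalIntegral.integral_of_le hh.le, intervalIntegral.integral_comp_sub_left F t,
      sub_zero]
    rfl
  have h1 : ‖∫ x in Ioc 0 h, F (t - x)‖ₑ ^ 2 ≤
      ENNReal.ofReal h * ∫⁻ x in Ioc 0 h, ‖F (t - x)‖ₑ ^ 2 := by
    refine (pow_le_pow_left₀ zero_le (enorm_integral_le_lintegral_enorm _) 2).trans ?_
    have := sq_lintegral_le (volume.restrict (Ioc 0 h)) (g := fun x => ‖F (t - x)‖ₑ)
      ((hF.comp_sub_left t).aestronglyMeasurable.enorm.restrict)
    simpa using this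
  rw [e, enorm_smul, mul_pow]
  refine (mul_le_mul_right h1 _).trans_eq ?_
  rw [← mul_assoc]
  congr 1
  rw [Real.enorm_of_nonneg (inv_nonneg.2 hh.le), sq, mul_assoc, ← ENNReal.ofReal_mul
    (inv_nonneg.2 hh.le), inv_mul_cancel₀ hh.ne', ENNReal.ofReal_one, mul_one]

/-- By Jensen and Tonelli the left side is at most the average over `x ∈ (0, h)` of `κ * ‖F‖²` at `t
- x`. Averaging backward keeps these times below `T`, so the same constant `c` survives, and for
every `t` although the hypothesis is only almost everywhere. -/
theorem IsKernel.volterraConv_backwardAverage_le (hκ : IsKernel κ) {F : ℝ → X}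
    (hF : Integrable F) {c T h t : ℝ} (hc : 0 ≤ c) (hh : 0 < h) (ht : t ∈ Icc 0 T)
    (hFc : ∀ᵐ y, y < T →
      ∫⁻ s, ENNReal.ofReal (zeroExt κ (y - s)) * ‖F s‖ₑ ^ 2 ≤ ENNReal.ofReal c) :
    volterraConv κ (fun s => ‖backwardAverage h F s‖ ^ 2) t ≤ c := by
  set z : ℝ → ℝ≥0∞ := fun x => ENNReal.ofReal (zeroExt κ x) with hz
  have hzm : Measurable z := hκ.measurable_zeroExt.ennreal_ofReal
  set q : ℝ → ℝ≥0∞ := fun s => ‖F s‖ₑ ^ 2 with hq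
  have hqm : AEMeasurable q := hF.aestronglyMeasurable.enorm.pow_const 2
  have key : ∫⁻ s, z (t - s) * ‖backwardAverage h F s‖ₑ ^ 2 ≤ ENNReal.ofReal c := by
    calc ∫⁻ s, z (t - s) * ‖backwardAverage h F s‖ₑ ^ 2
        ≤ ∫⁻ s, ENNReal.ofReal h⁻¹ * ∫⁻ x in Ioc 0 h, z (t - s) * q (s - x) := by
          refine lintegral_mono fun s => ?_
          have h1 := enorm_backwardAverage_sq_le hF hh s
          have h2 : AEMeasurable (fun x => q (s - x)) (volume.restrict (Ioc 0 h)) :=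
            ((hF.comp_sub_left s).aestronglyMeasurable.enorm.pow_const 2).restrict
          rw [lintegral_const_mul'' _ h2, mul_left_comm]
          exact mul_le_mul_right h1 _
      _ = ENNReal.ofReal h⁻¹ * ∫⁻ x in Ioc 0 h, ∫⁻ s, z (t - s) * q (s - x) := by
          rw [lintegral_const_mul' _ _ ENNReal.ofReal_ne_top, lintegral_lintegral_swap]
          have h1 : AEMeasurable (fun p : ℝ × ℝ => q (p.1 - p.2))
              (volume.prod (volume.restrict (Ioc 0 h))) :=
            hqm.comp_quasiMeasurePreserving
              (quasiMeasurePreserving_sub_of_right_invariant volume (volume.restrict (Ioc 0 h)))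
          have h2 : Measurable fun p : ℝ × ℝ => z (t - p.1) := by fun_prop
          exact h2.aemeasurable.mul h1
      _ = ENNReal.ofReal h⁻¹ * ∫⁻ x in Ioc 0 h, ∫⁻ s, z (t - x - s) * q s := by
          congr 1
          refine lintegral_congr fun x => ?_
          rw [← lintegral_sub_right_eq_self (fun s => z (t - x - s) * q s) x]
          refine lintegral_congr fun s => ?_
          rw [sub_sub_sub_cancel_right]
      _ ≤ ENNReal.ofReal h⁻¹ * ∫⁻ x in Ioc 0 h, ENNReal.ofReal c := by
          refine mul_le_mul_right (lintegral_mono_ae ?_) _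
          refine (ae_restrict_iff' measurableSet_Ioc).2 ?_
          have := (quasiMeasurePreserving_sub_left_of_right_invariant volume t).ae hFc
          filter_upwards [this] with x hx hx'
          exact hx (by linarith [hx'.1, ht.2])
      _ = ENNReal.ofReal c := by
          rw [setLIntegral_const, Real.volume_Ioc, sub_zero, mul_comm (ENNReal.ofReal c),
            ← mul_assoc, ← ENNReal.ofReal_mul (inv_nonneg.2 hh.le), inv_mul_cancel₀ hh.ne',
            ENNReal.ofReal_one, one_mul]
  have hcont := continuous_backwardAverage hF h
  rw [← ENNReal.ofReal_le_ofReal_iff hc]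
  refine le_trans ?_ key
  have hg : Continuous fun s => ‖backwardAverage h F s‖ ^ 2 := by fun_prop
  rw [volterraConv_eq_integral ht.1 le_rfl, intervalIntegral.integral_of_le ht.1,
    ofReal_integral_eq_lintegral_ofReal]
  · refine (setLIntegral_le_lintegral _ _).trans_eq (lintegral_congr fun s => ?_)
    rw [smul_eq_mul, ENNReal.ofReal_mul (hκ.zeroExt_nonneg _), ENNReal.ofReal_pow (norm_nonneg _),
      ofReal_norm]
  · exact (hκ.intervalIntegrable_smul hg.continuousOn t).1
  · exact Eventually.of_forall fun s => mul_nonneg (hκ.zeroExt_nonneg _) (by positivity)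

/-- With `P` the primitive of `F`, the integral of the averages is the mean of `P` over `[t - h,
t]`: the boundary term at `0` drops out because `F`, hence `P`, vanishes on the negative axis. -/
theorem tendsto_integral_backwardAverage [CompleteSpace X] {F : ℝ → X} (hF : Integrable F)
    (hF0 : ∀ s ≤ 0, F s = 0) (t : ℝ) :
    Tendsto (fun h => ∫ s in (0 : ℝ)..t, backwardAverage h F s) (𝓝[>] 0)
      (𝓝 (∫ s in (0 : ℝ)..t, F s)) := by
  set P : ℝ → X := fun s => ∫ r in (0 : ℝ)..s, F r with hP
  have hPc : Continuous P :=
    intervalIntegral.continuous_primitive (fun a b => hF.intervalIntegrable) 0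
  have hP0 : ∀ s ≤ 0, P s = 0 := fun s hs => by
    simp only [hP]
    rw [intervalIntegral.integral_congr (g := fun _ => (0 : X))]
    · simp
    · intro x hx
      rw [uIcc_of_ge hs] at hx
      exact hF0 x hx.2
  have hder : HasDerivAt (fun x => ∫ r in (0 : ℝ)..x, P r) (P t) t :=
    intervalIntegral.integral_hasDerivAt_right (hPc.intervalIntegrable _ _)
      (hPc.stronglyMeasurableAtFilter _ _) hPc.continuousAt
  have hslope := (hasDerivAt_iff_tendsto_slope.1 hder)
  have hmap : Tendsto (fun h : ℝ => t - h) (𝓝[>] 0) (𝓝[≠] t) := by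
    refine tendsto_nhdsWithin_iff.2 ⟨?_, ?_⟩
    · refine Tendsto.mono_left ?_ nhdsWithin_le_nhds
      simpa using (Continuous.tendsto (by fun_prop : Continuous fun h : ℝ => t - h) 0)
    · filter_upwards [self_mem_nhdsWithin] with h hh
      have : (0 : ℝ) < h := hh
      simp [this.ne']
  refine (hslope.comp hmap).congr' ?_
  filter_upwards [self_mem_nhdsWithin] with h hh
  have hh' : (0 : ℝ) < h := hh
  simp only [Function.comp_apply, slope, vsub_eq_sub]
  have e1 : t - h - t = -h := by ring
  have e2 : ∀ s, backwardAverage h F s = h⁻¹ • (P s - P (s - h)) := fun s => by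
    simp only [hP]
    rw [intervalIntegral.integral_interval_sub_left hF.intervalIntegrable hF.intervalIntegrable]
    rfl
  have e3 : ∫ s in (0 : ℝ)..t, P (s - h) = ∫ s in (0 : ℝ)..(t - h), P s := by
    rw [intervalIntegral.integral_comp_sub_right P h, zero_sub,
      ← intervalIntegral.integral_add_adjacent_intervals (hPc.intervalIntegrable (-h) 0)
        (hPc.intervalIntegrable 0 (t - h)), intervalIntegral.integral_congr (a := -h)
        (g := fun _ => (0 : X))]
    · simp
    · intro x hx
      rw [uIcc_of_le (by linarith)] at hx
      exact hP0 x hx.2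
  have hPh : Continuous fun s => P (s - h) := by fun_prop
  simp only [e2]
  rw [intervalIntegral.integral_smul, intervalIntegral.integral_sub (hPc.intervalIntegrable _ _)
    (hPh.intervalIntegrable _ _), e3, e1, inv_neg, neg_smul, ← smul_neg, neg_sub]

/-- An almost everywhere bound for `κ * ‖f‖²` as a bound for a lower integral. -/
theorem IsKernel.lintegral_le_of_volterraConv_le {X : Type*} [NormedAddCommGroup X] (hκ : IsKernel κ) {f : ℝ → X} {c T : ℝ}
    (hf : MemLp f 2 (volOn T))
    (hfc : ∀ᵐ y ∂volOn T, volterraConv κ (fun s => ‖f s‖ ^ 2) y ≤ c) :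
    ∀ᵐ y, y < T → ∫⁻ s, ENNReal.ofReal (zeroExt κ (y - s)) * ‖(Ioo 0 T).indicator f s‖ₑ ^ 2 ≤
      ENNReal.ofReal c := by
  rcases le_or_gt T 0 with hT | hT
  · have : Ioo 0 T = ∅ := Ioo_eq_empty (not_lt.2 hT)
    simp [this]
  set q : ℝ → ℝ≥0∞ := fun s => ‖(Ioo 0 T).indicator f s‖ₑ ^ 2 with hq
  have hind : ∀ s, q s = (Ioo 0 T).indicator (fun s => ‖f s‖ₑ ^ 2) s := fun s => by
    simp only [hq]
    by_cases hs : s ∈ Ioo 0 T <;> simp [hs]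
  have hqm : AEMeasurable q :=
    ((aestronglyMeasurable_indicator_iff measurableSet_Ioo).2 hf.aestronglyMeasurable).enorm.pow_const 2
  have hqi : ∫⁻ s, q s < ⊤ := by
    have := hf.eLpNorm_lt_top
    rw [eLpNorm_lt_top_iff_lintegral_rpow_enorm_lt_top (by norm_num) (by norm_num)] at this
    simp only [hind]
    rw [lintegral_indicator measurableSet_Ioo]
    simpa using this
  set z : ℝ → ℝ≥0∞ := fun x => ENNReal.ofReal (zeroExt κ x) with hz
  have hzm : Measurable z := hκ.measurable_zeroExt.ennreal_ofReal
  -- A bound on the Bochner integral is empty where the integrand is not integrable. Tonelli, with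
  -- `z` integrable on bounded sets and `q` integrable, excludes this for almost every `y`.
  have hfin : ∀ᵐ y ∂volOn T, ∫⁻ s, z (y - s) * q s < ⊤ := by
    have hjoint : AEMeasurable (fun p : ℝ × ℝ => z (p.1 - p.2) * q p.2)
        ((volOn T).prod volume) := by
      have h1 : Measurable fun p : ℝ × ℝ => z (p.1 - p.2) := by fun_prop
      exact h1.aemeasurable.mul (hqm.comp_quasiMeasurePreserving Measure.quasiMeasurePreserving_snd)
    refine ae_lt_top' hjoint.lintegral_prod_right' (ne_of_lt ?_)
    rw [lintegral_lintegral_swap hjoint]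
    have hb : ∀ s, ∫⁻ y in Ioo 0 T, z (y - s) * q s ≤ (∫⁻ x in Iic T, z x) * q s := by
      intro s
      rw [lintegral_mul_const _ (by fun_prop)]
      by_cases hs : s ∈ Ioo 0 T
      · refine mul_le_mul_left ?_ _
        have e : ∫⁻ y in Ioo 0 T, z (y - s) = ∫⁻ y, (Ioo 0 T).indicator (fun y => z (y - s)) y :=
          (lintegral_indicator measurableSet_Ioo _).symm
        rw [e, ← lintegral_indicator measurableSet_Iic,
          ← lintegral_sub_right_eq_self ((Iic T).indicator z) s]
        refine lintegral_mono fun y => ?_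
        by_cases hy : y ∈ Ioo 0 T
        · rw [indicator_of_mem hy, indicator_of_mem (show y - s ∈ Iic T from
            mem_Iic.2 (by linarith [hy.2, hs.1]))]
        · rw [indicator_of_notMem hy]
          exact zero_le
      · rw [hind, indicator_of_notMem hs, mul_zero, mul_zero]
    refine (lintegral_mono hb).trans_lt ?_
    rw [lintegral_const_mul'' _ hqm]
    refine ENNReal.mul_lt_top ?_ hqi
    have hsplit : ∫⁻ x in Iic T, z x ≤ ∫⁻ x in Ioc 0 T, z x := by
      rw [← lintegral_indicator measurableSet_Iic, ← lintegral_indicator measurableSet_Ioc]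
      refine lintegral_mono fun x => ?_
      by_cases hx : x ∈ Ioc 0 T
      · rw [indicator_of_mem hx, indicator_of_mem (show x ∈ Iic T from hx.2)]
      · rw [indicator_of_notMem hx]
        refine (indicator_apply_eq_zero.2 fun hx' => ?_).le
        have : x ≤ 0 := by
          by_contra! h
          exact hx ⟨h, hx'⟩
        simp [hz, zeroExt_of_nonpos this]
    refine hsplit.trans_lt ?_
    exact ((intervalIntegrable_iff_integrableOn_Ioc_of_le hT.le).1
      (hκ.intervalIntegrable 0 T)).lintegral_lt_top
  have hgood := (ae_restrict_iff' measurableSet_Ioo).1 (hfin.and hfc)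
  filter_upwards [hgood] with y hy hyT
  rcases le_or_gt y 0 with hy0 | hy0
  · refine (lintegral_eq_zero_of_ae_eq_zero (Eventually.of_forall fun s => ?_)).le.trans zero_le
    change z (y - s) * q s = 0
    rcases le_or_gt s 0 with hs | hs
    · rw [hind, indicator_of_notMem (fun h => not_lt.2 hs h.1), mul_zero]
    · simp [hz, zeroExt_of_nonpos (show y - s ≤ 0 by linarith)]
  · obtain ⟨hlt, hle⟩ := hy ⟨hy0, hyT⟩
    have e : ∫⁻ s in Ioc 0 y, ENNReal.ofReal (zeroExt κ (y - s) • ‖f s‖ ^ 2)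
        = ∫⁻ s, z (y - s) * q s := by
      rw [← lintegral_indicator measurableSet_Ioc]
      refine lintegral_congr fun s => ?_
      by_cases hs : s ∈ Ioc 0 y
      · rw [indicator_of_mem hs, hind, indicator_of_mem (show s ∈ Ioo 0 T from
          ⟨hs.1, hs.2.trans_lt hyT⟩), smul_eq_mul, ENNReal.ofReal_mul (hκ.zeroExt_nonneg _),
          ENNReal.ofReal_pow (norm_nonneg _), ofReal_norm]
      · rw [indicator_of_notMem hs]
        rcases le_or_gt s 0 with hs0 | hs0
        · rw [hind, indicator_of_notMem (fun h => not_lt.2 hs0 h.1), mul_zero]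
        · have : y < s := by
            by_contra! h
            exact hs ⟨hs0, h⟩
          simp [hz, zeroExt_of_nonpos (show y - s ≤ 0 by linarith)]
    change ∫⁻ s, z (y - s) * q s ≤ _
    rw [volterraConv_eq_integral hy0.le le_rfl, intervalIntegral.integral_of_le hy0.le,
      integral_eq_lintegral_of_nonneg_ae, e] at hle
    · exact (ENNReal.le_ofReal_iff_toReal_le hlt.ne ((ENNReal.toReal_nonneg).trans hle)).2 hle
    · exact Eventually.of_forall fun s => mul_nonneg (hκ.zeroExt_nonneg _) (by positivity)
    · have h1 : Measurable fun s => zeroExt κ (y - s) := by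
        have := hκ.measurable_zeroExt
        fun_prop
      have h2 : AEStronglyMeasurable f (volume.restrict (Ioc 0 y)) :=
        hf.aestronglyMeasurable.mono_measure (Measure.restrict_mono
          (show Ioc 0 y ⊆ Ioo 0 T from fun s hs => ⟨hs.1, hs.2.trans_lt hyT⟩) le_rfl)
      exact h1.aestronglyMeasurable.smul (h2.norm.pow 2)

end Average

/-! ### Regularized problems and a priori estimates -/

section Approximation

variable {H : Type*} [NormedAddCommGroup H] [InnerProductSpace ℝ H] {k ℓ : ℝ → ℝ}

/-- The growth bound leaves `-δ‖ξ‖²`; half of it pays for the cross terms with `f` and `m`, by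
completing two squares. -/
theorem inner_le_of_growth {f ξ η : H} {δ m : ℝ} (hδ : 0 < δ)
    (hη : ‖η‖ ≤ (1 - δ) * ‖ξ‖ + m) :
    inner ℝ (f - ξ + η) ξ ≤ -(δ / 2) * ‖ξ‖ ^ 2 + δ⁻¹ * ‖f‖ ^ 2 + δ⁻¹ * m ^ 2 := by
  have h1 := real_inner_le_norm f ξ
  have h2 := (real_inner_le_norm η ξ).trans (mul_le_mul_of_nonneg_right hη (norm_nonneg ξ))
  rw [inner_add_left, inner_sub_left, real_inner_self_eq_norm_sq]
  set x := ‖ξ‖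
  set y := ‖f‖
  have e : -(δ / 2) * x ^ 2 + δ⁻¹ * y ^ 2 + δ⁻¹ * m ^ 2
      - (y * x - x ^ 2 + ((1 - δ) * x + m) * x)
      = δ⁻¹ * ((y - δ * x / 2) ^ 2 + (m - δ * x / 2) ^ 2) := by
    field_simp
    ring
  have : 0 ≤ δ⁻¹ * ((y - δ * x / 2) ^ 2 + (m - δ * x / 2) ^ 2) := by positivity
  linarith

theorem norm_sq_le_of_growth {X : Type*} [NormedAddCommGroup X] {f ξ η : X} {ν m : ℝ} (hν : ν ≤ 1)
    (hη : ‖η‖ ≤ ν * ‖ξ‖ + m) :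
    ‖f - ξ + η‖ ^ 2 ≤ 3 * ‖f‖ ^ 2 + 12 * ‖ξ‖ ^ 2 + 3 * m ^ 2 := by
  have h1 : ‖f - ξ + η‖ ≤ ‖f‖ + 2 * ‖ξ‖ + m := by
    have h2 := norm_add_le (f - ξ) η
    have h3 := norm_sub_le f ξ
    have h4 := mul_le_mul_of_nonneg_right hν (norm_nonneg ξ)
    linarith
  have h5 : ‖f - ξ + η‖ ^ 2 ≤ (‖f‖ + 2 * ‖ξ‖ + m) ^ 2 := pow_le_pow_left₀ (norm_nonneg _) h1 2
  nlinarith [sq_nonneg (‖f‖ - 2 * ‖ξ‖), sq_nonneg (‖f‖ - m), sq_nonneg (2 * ‖ξ‖ - m)]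

variable {φ₁ φ₂ : H → EReal} {lam : ℝ} {J : H → H} {u₀ : H} {f u η : ℝ → H} {S c m ν δ : ℝ}

theorem IsKernel.volterraConv_combination (hℓ : IsKernel ℓ) {p q : ℝ → ℝ} (hp : Continuous p)
    (hq : Continuous q) (α β γ : ℝ) {t : ℝ} (ht : 0 ≤ t) :
    volterraConv ℓ (fun s => α * p s + β * q s + γ) t
      = α * volterraConv ℓ p t + β * volterraConv ℓ q t + primitive ℓ t * γ := by
  rw [hℓ.volterraConv_add ht (by fun_prop) (by fun_prop),
    hℓ.volterraConv_add ht (by fun_prop) (by fun_prop), volterraConv_const_mul,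
    volterraConv_const_mul, hℓ.volterraConv_const ht]

/-- The chain-rule inequality for the Moreau envelope, with the pairing `(g, A u)` bounded by
`inner_le_of_growth`. Only the clipping bound on `η` is used, so no continuation argument in time is
needed. -/
theorem energy_estimate [CompleteSpace H] (hk : IsConjugatePair k ℓ)
    (hφ : IsProperLscConvex φ₁) (hlam : 0 < lam) (hJ : IsResolvent φ₁ lam J)
    (hu₀ : u₀ ∈ effDomain φ₁) (hδ : 0 < δ)
    (hf : Continuous f) (hu : Continuous u) (hη : Continuous η)
    (hηm : ∀ t, ‖η t‖ ≤ (1 - δ) * ‖yosida lam J (u t)‖ + m)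
    (hfc : ∀ t ∈ Icc 0 S, volterraConv ℓ (fun s => ‖f s‖ ^ 2) t ≤ c)
    (hsol : ∀ t ∈ Icc 0 S,
      u t = u₀ + volterraConv ℓ (fun s => f s - yosida lam J (u s) + η s) t)
    {t : ℝ} (ht : t ∈ Icc 0 S) :
    moreau φ₁ lam J (u t) + δ / 2 * volterraConv ℓ (fun s => ‖yosida lam J (u s)‖ ^ 2) t ≤
      (φ₁ u₀).toReal + δ⁻¹ * (c + m ^ 2 * primitive ℓ S) := by
  have hℓ := hk.right
  have hA := hJ.continuous_yosida hφ.ne_bot hlam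
  have h1 := hk.chain_inequality (e := moreau φ₁ lam J) (A := yosida lam J)
    (div_nonneg zero_le_two hlam.le) (hJ.continuous_moreau hφ.ne_bot hlam) hA
    (hJ.moreau_add_inner_le hφ.ne_bot hlam) (hJ.moreau_sub_le hφ.ne_bot hlam)
    (g := fun s => f s - yosida lam J (u s) + η s) (by fun_prop) hu (u₀ := u₀) ht.1
    fun s hs => hsol s ⟨hs.1, hs.2.trans ht.2⟩
  have h2 := hℓ.volterraConv_mono (t := t)
    (g := fun s => inner ℝ (f s - yosida lam J (u s) + η s) (yosida lam J (u s)))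
    (g' := fun s => -(δ / 2) * ‖yosida lam J (u s)‖ ^ 2 + δ⁻¹ * ‖f s‖ ^ 2 + δ⁻¹ * m ^ 2)
    ht.1 (by fun_prop) (by fun_prop) fun s _ => inner_le_of_growth hδ (hηm s)
  rw [hℓ.volterraConv_combination (by fun_prop) (by fun_prop) _ _ _ ht.1] at h2
  have h3 := hJ.moreau_le hφ.ne_bot hlam hu₀
  have hδ' : 0 ≤ δ⁻¹ := (inv_pos.2 hδ).le
  have h4 := mul_le_mul_of_nonneg_left (hfc t ht) hδ'
  have h5 : primitive ℓ t * (δ⁻¹ * m ^ 2) ≤ primitive ℓ S * (δ⁻¹ * m ^ 2) :=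
    mul_le_mul_of_nonneg_right (hℓ.primitive_mono ht.2) (by positivity)
  rw [mul_add]
  linarith

theorem volterraConv_rhs_sq_le {X : Type*} [NormedAddCommGroup X] (hℓ : IsKernel ℓ)
    {f ξ η : ℝ → X} (hν : ν ≤ 1)
    (hf : Continuous f) (hξ : Continuous ξ) (hη : Continuous η)
    (hηm : ∀ t, ‖η t‖ ≤ ν * ‖ξ t‖ + m)
    (hfc : ∀ t ∈ Icc 0 S, volterraConv ℓ (fun s => ‖f s‖ ^ 2) t ≤ c)
    {t : ℝ} (ht : t ∈ Icc 0 S) :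
    volterraConv ℓ (fun s => ‖f s - ξ s + η s‖ ^ 2) t ≤
      3 * (c + m ^ 2 * primitive ℓ S) + 12 * volterraConv ℓ (fun s => ‖ξ s‖ ^ 2) t := by
  have h2 := hℓ.volterraConv_mono (t := t) (g := fun s => ‖f s - ξ s + η s‖ ^ 2)
    (g' := fun s => 3 * ‖f s‖ ^ 2 + 12 * ‖ξ s‖ ^ 2 + 3 * m ^ 2)
    ht.1 (by fun_prop) (by fun_prop) fun s _ => norm_sq_le_of_growth hν (hηm s)
  rw [hℓ.volterraConv_combination (by fun_prop) (by fun_prop) _ _ _ ht.1] at h2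
  have h5 : primitive ℓ t * (3 * m ^ 2) ≤ primitive ℓ S * (3 * m ^ 2) :=
    mul_le_mul_of_nonneg_right (hℓ.primitive_mono ht.2) (by positivity)
  linarith [hfc t ht]

theorem IsKernel.volterraConv_nonneg (hℓ : IsKernel ℓ) {q : ℝ → ℝ} (hq : ∀ s, 0 ≤ q s) {t : ℝ}
    (ht : 0 ≤ t) : 0 ≤ volterraConv ℓ q t := by
  rw [volterraConv_eq_integral ht le_rfl]
  exact intervalIntegral.integral_nonneg ht fun s _ =>
    mul_nonneg (hℓ.zeroExt_nonneg _) (hq s)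

/-- The numerical core of the a priori bound on `φ(u) + ‖u‖`. -/
theorem add_le_of_energy {E X N U L a b : ℝ} (hδ : 0 < δ) (hδ1 : δ ≤ 1) (hX : 0 ≤ X) (hc : 0 ≤ c)
    (hL : 0 ≤ L) (hL1 : 24 * L ≤ δ) (hL2 : m ^ 2 * L ≤ δ)
    (hE : E + δ / 2 * X ≤ b + δ⁻¹ * (c + m ^ 2 * L))
    (hN : N ^ 2 ≤ L * (3 * (c + m ^ 2 * L) + 12 * X)) (hU : U ≤ a + N) :
    N ^ 2 ≤ c + 1 + δ / 2 * X ∧ E + δ / 2 * X ≤ b + δ⁻¹ * c + 1 ∧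
      E + U ≤ a + b + c + δ⁻¹ * c + 3 := by
  have h1 : δ⁻¹ * (m ^ 2 * L) ≤ 1 := by
    rw [inv_mul_le_iff₀ hδ]; linarith
  have h2 : N ^ 2 ≤ c + 1 + δ / 2 * X := by
    have h3 : L * (m ^ 2 * L) ≤ 1 / 24 * 1 :=
      mul_le_mul (by linarith) (by linarith) (by positivity) (by norm_num)
    have h4 : L * c ≤ 1 / 24 * c := mul_le_mul_of_nonneg_right (by linarith) hc
    have h5 : 24 * L * X ≤ δ * X := mul_le_mul_of_nonneg_right hL1 hX
    nlinarith
  refine ⟨h2, by linarith, ?_⟩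
  -- The part of `N ^ 2` growing with `X` is absorbed by the dissipation in `hE`. The resulting
  -- upper bound for `E + U` needs no lower bound for the energy.
  have h6 : N ≤ 1 + N ^ 2 / 4 := by nlinarith [sq_nonneg (N / 2 - 1)]
  have h7 : 0 ≤ δ / 2 * X := by positivity
  linarith

theorem moreau_resolvent_add_norm_le (hlam : 0 < lam) (hlam1 : lam ≤ 1) (x : H) :
    (φ₁ (J x)).toReal + ‖J x‖ ≤ moreau φ₁ lam J x + ‖x‖ + 1 / 2 := by
  have e : J x = x - lam • yosida lam J x := by rw [smul_yosida hlam]; abel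
  have h1 : ‖J x‖ ≤ ‖x‖ + lam * ‖yosida lam J x‖ := by
    conv_lhs => rw [e]
    refine (norm_sub_le _ _).trans_eq ?_
    rw [norm_smul, Real.norm_of_nonneg hlam.le]
  have h2 : lam * ‖yosida lam J x‖ ≤ lam / 2 * ‖yosida lam J x‖ ^ 2 + 1 / 2 := by
    nlinarith [mul_nonneg hlam.le (sq_nonneg (‖yosida lam J x‖ - 1))]
  rw [moreau]
  linarith

/-- The energy bound turned into uniform bounds by means of an affine minorant. -/
theorem bounds_of_energy {α β E X N U V F y Q a : ℝ} (hα : 0 ≤ α) (hδ : 0 < δ)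
    (hlam : 0 < lam) (hlam1 : lam ≤ 1) (hX : 0 ≤ X)
    (hc : 0 ≤ c)
    (hN : N ^ 2 ≤ c + 1 + δ / 2 * X) (hE : E + δ / 2 * X ≤ Q) (hU : U ≤ a + N)
    (hEF : E = F + lam / 2 * y ^ 2) (hF : -α * V - β ≤ F) (hV : V ≤ U + lam * y) :
    δ / 2 * X ≤ 2 * (|Q| + α * |a| + c + 1 + (α + 1) ^ 2 + |β|) ∧
    U ≤ |a| + 1 + (c + 1 + 2 * (|Q| + α * |a| + c + 1 + (α + 1) ^ 2 + |β|)) ∧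
    lam * y ^ 2 ≤ 4 * (|Q| + |β| + α ^ 2 + α * U) := by
  have hQ := le_abs_self Q
  have hβ := le_abs_self β
  have ha := le_abs_self a
  have hδX : 0 ≤ δ / 2 * X := by positivity
  have h1 : α * N ≤ N ^ 2 / 2 + α ^ 2 / 2 := by nlinarith [sq_nonneg (N - α)]
  have hαV : α * V ≤ α * (U + lam * y) := mul_le_mul_of_nonneg_left hV hα
  have hαU : α * U ≤ α * (a + N) := mul_le_mul_of_nonneg_left hU hα
  have hαa : α * a ≤ α * |a| := mul_le_mul_of_nonneg_left ha hα
  have hαα : lam * α ^ 2 ≤ α ^ 2 := mul_le_of_le_one_left (sq_nonneg _) hlam1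
  have h2 : α * (lam * y) ≤ lam / 2 * y ^ 2 + lam * α ^ 2 / 2 := by
    nlinarith [mul_nonneg hlam.le (sq_nonneg (y - α))]
  have h4 : α * (lam * y) ≤ lam / 4 * y ^ 2 + lam * α ^ 2 := by
    nlinarith [mul_nonneg hlam.le (sq_nonneg (y / 2 - α))]
  have h3 : δ / 2 * X ≤ 2 * (|Q| + α * |a| + c + 1 + (α + 1) ^ 2 + |β|) := by
    have e : (α + 1) ^ 2 = α ^ 2 + 2 * α + 1 := by ring
    linarith
  have h6 : N ≤ 1 + N ^ 2 / 4 := by nlinarith [sq_nonneg (N / 2 - 1)]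
  refine ⟨h3, ?_, ?_⟩
  · nlinarith [sq_nonneg N]
  · nlinarith

/-- Solutions of the regularized problems, with bounds uniform in the parameters. -/
theorem exists_approximate_solutions [CompleteSpace H] (hk : IsConjugatePair k ℓ)
    (hφ₁ : IsProperLscConvex φ₁) (hφ₂ : IsProperLscConvex φ₂) (hν0 : 0 ≤ ν) (hν1 : ν < 1)
    {M : ℝ → ℝ} (hM0 : ∀ r, 0 ≤ M r) (hM : Monotone M) (hgrowth : GrowthCondition φ₁ φ₂ ν M)
    (hu₀ : u₀ ∈ effDomain φ₁) (hc : 0 ≤ c) (hS : 0 ≤ S) {r : ℝ}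
    (hr : r = ‖u₀‖ + (φ₁ u₀).toReal + c + (1 - ν)⁻¹ * c + 4)
    (hS1 : 24 * primitive ℓ S ≤ 1 - ν) (hS2 : M r ^ 2 * primitive ℓ S ≤ 1 - ν) :
    ∃ K : ℝ, 0 ≤ K ∧ ∀ (f : ℝ → H) (lam : ℝ), Continuous f → 0 < lam → lam ≤ 1 →
      (∀ t ∈ Icc 0 S, volterraConv ℓ (fun s => ‖f s‖ ^ 2) t ≤ c) →
      ∃ u v ξ η : ℝ → H, Continuous u ∧ Continuous v ∧ Continuous ξ ∧ Continuous η ∧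
        (∀ t ∈ Icc 0 S, u t = u₀ + volterraConv ℓ (fun s => f s - ξ s + η s) t) ∧
        (∀ t, v t = u t - lam • ξ t) ∧
        (∀ t, ξ t ∈ subdiff φ₁ (v t)) ∧
        (∀ t ∈ Icc 0 S, η t ∈ subdiff φ₂ (v t - lam • η t)) ∧
        ∀ t ∈ Icc 0 S, (φ₁ (v t)).toReal + ‖v t‖ ≤ r ∧ (φ₁ (v t)).toReal ≤ K ∧
          ‖u t‖ ≤ K ∧ lam * ‖ξ t‖ ^ 2 ≤ K ∧
          volterraConv ℓ (fun s => ‖ξ s‖ ^ 2) t ≤ K ∧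
          volterraConv ℓ (fun s => ‖f s - ξ s + η s‖ ^ 2) t ≤ K ∧
          ‖η t‖ ≤ ‖ξ t‖ + K := by
  have hℓ := hk.right
  set δ := 1 - ν with hδdef
  have hδ : 0 < δ := by linarith
  have hδ1 : δ ≤ 1 := by linarith
  set m := M r with hm
  have hm0 : 0 ≤ m := hM0 r
  -- The minorant enters only the constant `K`. The threshold `r` and the conditions on `S` are free
  -- of it, which keeps the existence time independent of the finer structure of `φ₁`.
  obtain ⟨α, β, hα, hβ, hmin⟩ := hφ₁.exists_affine_minorant
  set b := (φ₁ u₀).toReal with hb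
  set Q := b + δ⁻¹ * c + 1 with hQ
  set W := 2 * (|Q| + α * |‖u₀‖| + c + 1 + (α + 1) ^ 2 + |β|) with hW
  set Umax := |‖u₀‖| + 1 + (c + 1 + W) with hUmax
  set K₁ := 4 * (|Q| + |β| + α ^ 2 + α * Umax) with hK₁
  set Xmax := 2 / δ * W with hXmax
  set K₂ := 3 * (c + m ^ 2 * primitive ℓ S) + 12 * Xmax with hK₂
  have hL0 := hℓ.primitive_nonneg hS
  have hW0 : 0 ≤ W := by positivity
  have hUmax0 : 0 ≤ Umax := by positivity
  have hK₁0 : 0 ≤ K₁ := by positivity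
  have hXmax0 : 0 ≤ Xmax := by positivity
  have hK₂0 : 0 ≤ K₂ := by positivity
  refine ⟨|Q| + Umax + K₁ + Xmax + K₂ + m, by positivity, ?_⟩
  intro f lam hf hlam hlam1 hfc
  obtain ⟨J, hJ⟩ := exists_isResolvent hφ₁ hlam
  obtain ⟨J₂, hJ₂⟩ := exists_isResolvent hφ₂ hlam
  set A := yosida lam J with hA
  -- The clipping level is what the growth condition would give if `φ₁ (J x) + ‖J x‖ ≤ r` were
  -- known. This breaks the circularity: the bound is derived from the clip and then shows the clip
  -- to be inactive.
  set η₀ : H → H := fun x => clip (ν * ‖A x‖ + m) (yosida lam J₂ (J x)) with hη₀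
  have hAL := hJ.yosida_norm_sub_le hφ₁.ne_bot hlam
  have hρ0 : ∀ x, 0 ≤ ν * ‖A x‖ + m := fun x => by positivity
  have hηL : ∀ x y, ‖η₀ x - η₀ y‖ ≤ 4 * (2 / lam) * ‖x - y‖ := by
    intro x y
    have h1 := norm_clip_sub_clip_le (hρ0 x) (hρ0 y) (yosida lam J₂ (J x)) (yosida lam J₂ (J y))
    have h2 : |ν * ‖A x‖ + m - (ν * ‖A y‖ + m)| ≤ 2 / lam * ‖x - y‖ := by
      rw [add_sub_add_right_eq_sub, ← mul_sub, abs_mul, abs_of_nonneg hν0]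
      exact (mul_le_of_le_one_left (abs_nonneg _) hν1.le).trans
        ((abs_norm_sub_norm_le _ _).trans (hAL x y))
    have h3 := (hJ₂.yosida_norm_sub_le hφ₂.ne_bot hlam (J x) (J y)).trans
      (mul_le_mul_of_nonneg_left (hJ.nonexpansive hφ₁.ne_bot hlam x y) (by positivity))
    simp only [hη₀]
    linarith
  have hNL : ∀ x y, ‖(-A x + η₀ x) - (-A y + η₀ y)‖ ≤ 5 * (2 / lam) * ‖x - y‖ := by
    intro x y
    have e : (-A x + η₀ x) - (-A y + η₀ y) = (η₀ x - η₀ y) - (A x - A y) := by abel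
    rw [e]
    refine (norm_sub_le _ _).trans ?_
    linarith [hηL x y, hAL x y]
  obtain ⟨u, hu, hsol⟩ := hℓ.exists_volterra_solution hS hf (by positivity) hNL u₀
  have hAc : Continuous A := hJ.continuous_yosida hφ₁.ne_bot hlam
  have hηc : Continuous η₀ := (LipschitzWith.of_dist_le_mul (K := (4 * (2 / lam)).toNNReal)
    fun x y => by
      rw [dist_eq_norm, dist_eq_norm, Real.coe_toNNReal _ (by positivity)]
      exact hηL x y).continuous
  have hJc : Continuous J := hJ.continuous hφ₁.ne_bot hlam
  have hsol' : ∀ t ∈ Icc 0 S, u t = u₀ + volterraConv ℓ (fun s => f s - A (u s) + η₀ (u s)) t := by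
    intro t ht
    rw [hsol t ht]
    congr 2
    ext s
    abel
  have hηm : ∀ t, ‖η₀ (u t)‖ ≤ ν * ‖A (u t)‖ + m := fun t => norm_clip_le (hρ0 _) _
  have hen := fun t ht => energy_estimate (t := t) hk hφ₁ hlam hJ hu₀ hδ hf hu (hηc.comp hu)
    (by rw [hδdef, sub_sub_cancel]; exact hηm) hfc hsol' ht
  have hrhs := fun t ht => volterraConv_rhs_sq_le (t := t) hℓ (ξ := fun s => A (u s))
    (η := fun s => η₀ (u s)) hν1.le hf (by fun_prop) (by fun_prop) hηm hfc ht
  have hX : ∀ t ∈ Icc 0 S, 0 ≤ volterraConv ℓ (fun s => ‖A (u s)‖ ^ 2) t := fun t ht =>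
    hℓ.volterraConv_nonneg (fun s => sq_nonneg _) ht.1
  have hN : ∀ t ∈ Icc 0 S, ‖u t - u₀‖ ^ 2 ≤ primitive ℓ S *
      (3 * (c + m ^ 2 * primitive ℓ S) + 12 * volterraConv ℓ (fun s => ‖A (u s)‖ ^ 2) t) := by
    intro t ht
    have h1 := hℓ.norm_volterraConv_sq_le (g := fun s => f s - A (u s) + η₀ (u s)) ht.1
      (Continuous.continuousOn (by fun_prop))
    have e : volterraConv ℓ (fun s => f s - A (u s) + η₀ (u s)) t = u t - u₀ := by
      rw [hsol' t ht]; abel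
    rw [e] at h1
    exact h1.trans (mul_le_mul (hℓ.primitive_mono ht.2) (hrhs t ht)
      (hℓ.volterraConv_nonneg (fun s => sq_nonneg _) ht.1) hL0)
  have hUN : ∀ t, ‖u t‖ ≤ ‖u₀‖ + ‖u t - u₀‖ := fun t => by
    simpa using norm_add_le u₀ (u t - u₀)
  have hcore := fun t (ht : t ∈ Icc 0 S) => add_le_of_energy hδ hδ1 (hX t ht) hc hL0 hS1 hS2
    (hen t ht) (hN t ht) (hUN t)
  have hvr : ∀ t ∈ Icc 0 S, (φ₁ (J (u t))).toReal + ‖J (u t)‖ ≤ r := by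
    intro t ht
    have h1 := moreau_resolvent_add_norm_le (φ₁ := φ₁) (J := J) hlam hlam1 (u t)
    linarith [(hcore t ht).2.2]
  -- The Yosida approximation is dominated by the minimal section of `∂φ₂` at `J (u t)`. The minimal
  -- section of `∂φ₁` there is dominated by `A (u t)`, itself an element of `∂φ₁ (J (u t))`.
  have hclip : ∀ t ∈ Icc 0 S, η₀ (u t) = yosida lam J₂ (J (u t)) := by
    intro t ht
    have hD1 : J (u t) ∈ subdiffDomain φ₁ := ⟨_, hJ (u t)⟩
    have hD2 := hgrowth.1 hD1
    have h1 := hJ₂.norm_yosida_le hφ₂.ne_bot hlam (minimalSection_spec hφ₂.ne_bot hD2).1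
    have h2 := hgrowth.2 _ hD1
    have h3 := (minimalSection_spec hφ₁.ne_bot hD1).2 _ (hJ (u t))
    have h4 := hM (hvr t ht)
    refine clip_of_norm_le (h1.trans (h2.trans ?_))
    exact add_le_add (mul_le_mul_of_nonneg_left h3 hν0) h4
  refine ⟨u, fun t => J (u t), fun t => A (u t), fun t => η₀ (u t), hu, by fun_prop, by fun_prop,
    by fun_prop, hsol', fun t => ?_, fun t => hJ (u t), fun t ht => ?_, fun t ht => ?_⟩
  · rw [hA, smul_yosida hlam]; abel
  · beta_reduce
    rw [hclip t ht]
    have h1 := hJ₂ (J (u t))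
    have h2 : J (u t) - lam • yosida lam J₂ (J (u t)) = J₂ (J (u t)) := by
      rw [smul_yosida hlam]; abel
    rw [h2]
    exact h1
  · obtain ⟨k1, k2, -⟩ := hcore t ht
    have hV : ‖J (u t)‖ ≤ ‖u t‖ + lam * ‖A (u t)‖ := by
      have e : J (u t) = u t - lam • A (u t) := by rw [hA, smul_yosida hlam]; abel
      rw [e]
      refine (norm_sub_le _ _).trans_eq ?_
      rw [norm_smul, Real.norm_of_nonneg hlam.le]
    obtain ⟨b1, b2, b3⟩ := bounds_of_energy (Q := Q) hα hδ hlam hlam1 (hX t ht) hc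
      k1 k2 (hUN t) rfl (hmin _ (hJ.mem_effDomain (u t))) hV
    have b4 : volterraConv ℓ (fun s => ‖A (u s)‖ ^ 2) t ≤ Xmax := by
      rw [hXmax, div_mul_eq_mul_div, le_div_iff₀ hδ]
      linarith
    have hQa := le_abs_self Q
    have b5 : (φ₁ (J (u t))).toReal ≤ |Q| := by
      have h1 : 0 ≤ lam / 2 * ‖A (u t)‖ ^ 2 := by positivity
      have h2 : 0 ≤ δ / 2 * volterraConv ℓ (fun s => ‖A (u s)‖ ^ 2) t :=
        mul_nonneg (by positivity) (hX t ht)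
      rw [moreau] at k2
      linarith
    have b6 : lam * ‖A (u t)‖ ^ 2 ≤ K₁ := b3.trans (by rw [hK₁]; gcongr)
    have b7 := hrhs t ht
    have b8 : ν * ‖A (u t)‖ ≤ ‖A (u t)‖ := mul_le_of_le_one_left (norm_nonneg _) hν1.le
    have hQ0 := abs_nonneg Q
    refine ⟨hvr t ht, ?_, ?_, ?_, ?_, ?_, ?_⟩
    · linarith
    · linarith
    · linarith
    · linarith
    · linarith
    · linarith [hηm t]

end Approximation

/-! ### Limits along ultrafilters -/

section Limits

open ENNReal NNReal

theorem exists_tendsto_of_mem_compact {ι X : Type*} [TopologicalSpace X] {C : Set X}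
    (hC : IsCompact C) (F : Ultrafilter ι) {x : ι → X} (hx : ∀ i, x i ∈ C) :
    ∃ y ∈ C, Tendsto x F (𝓝 y) := by
  obtain ⟨y, hy, hle⟩ := hC.ultrafilter_le_nhds' (F.map x)
    (Filter.mem_map.2 (Eventually.of_forall hx))
  exact ⟨y, hy, hle⟩

variable {H : Type*} [NormedAddCommGroup H] [InnerProductSpace ℝ H]

/-- Banach-Alaoglu in the dual, transported by the Riesz isomorphism. Ultrafilters remove the need
for separability and subsequences. -/
theorem exists_weak_limit [CompleteSpace H] {ι : Type*} (F : Ultrafilter ι) {x : ι → H} {B : ℝ}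
    (hx : ∀ i, ‖x i‖ ≤ B) :
    ∃ y : H, ∀ z, Tendsto (fun i => inner ℝ (x i) z) F (𝓝 (inner ℝ y z)) := by
  have hC := WeakDual.isCompact_closedBall (𝕜 := ℝ) (E := H) 0 B
  obtain ⟨L, -, hL⟩ := exists_tendsto_of_mem_compact hC F
    (x := fun i => StrongDual.toWeakDual (innerSL ℝ (x i))) fun i => by
      simpa using hx i
  refine ⟨(InnerProductSpace.toDual ℝ H).symm (WeakDual.toStrongDual L), fun z => ?_⟩
  have h1 := ((WeakDual.eval_continuous z).tendsto L).comp hL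
  rw [InnerProductSpace.toDual_symm_apply]
  exact h1

theorem tendsto_inner_of_weak_of_strong {ι : Type*} {F : Filter ι} {x y : ι → H} {ξ v : H}
    {B : ℝ} (hx : ∀ z, Tendsto (fun i => inner ℝ (x i) z) F (𝓝 (inner ℝ ξ z)))
    (hB : ∀ i, ‖x i‖ ≤ B) (hy : Tendsto y F (𝓝 v)) :
    Tendsto (fun i => inner ℝ (x i) (y i)) F (𝓝 (inner ℝ ξ v)) := by
  have h1 : Tendsto (fun i => inner ℝ (x i) (y i - v)) F (𝓝 0) := by
    have h2 : Tendsto (fun i => B * ‖y i - v‖) F (𝓝 0) := by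
      simpa using (tendsto_iff_norm_sub_tendsto_zero.1 hy).const_mul B
    refine squeeze_zero_norm (fun i => ?_) h2
    exact (norm_inner_le_norm _ _).trans (mul_le_mul_of_nonneg_right (hB i) (norm_nonneg _))
  have h3 := h1.add (hx v)
  rw [zero_add] at h3
  refine h3.congr fun i => ?_
  rw [inner_sub_right, sub_add_cancel]

/-- The subdifferential, realized in `L²`, is closed under weak-strong limits. -/
theorem mem_subdiff_of_weak_limit [CompleteSpace H] {φ : H → EReal} (hφ : IsProperLscConvex φ)
    {α ι : Type*} [MeasurableSpace α] {μ : Measure α} [IsFiniteMeasure μ] {F : Filter ι} [F.NeBot]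
    {x y : ι → Lp H 2 μ} {ξ v : Lp H 2 μ} {B : ℝ}
    (hmem : ∀ i, ∀ᵐ t ∂μ, x i t ∈ subdiff φ (y i t))
    (hx : ∀ z, Tendsto (fun i => inner ℝ (x i) z) F (𝓝 (inner ℝ ξ z)))
    (hB : ∀ i, ‖x i‖ ≤ B) (hy : Tendsto y F (𝓝 v)) :
    ∀ᵐ t ∂μ, ξ t ∈ subdiff φ (v t) := by
  obtain ⟨J, hJ⟩ := exists_isResolvent hφ one_pos
  have hJc := hJ.continuous hφ.ne_bot one_pos
  -- Minty's argument: testing monotonicity against the resolvent point `z` of `v + ξ` gives `-‖v -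
  -- z‖² ≥ 0` in the limit, hence `v = z` and `ξ = w - z`.
  set w : Lp H 2 μ := v + ξ with hw
  have hzm : MemLp (fun t => J (w t)) 2 μ := by
    have hdom : MemLp (fun t => ‖J 0‖ + ‖w t‖) 2 μ :=
      (memLp_const (μ := μ) (p := 2) ‖J 0‖).add (Lp.memLp w).norm
    refine hdom.of_le (hJc.comp_aestronglyMeasurable (Lp.aestronglyMeasurable w)) (Eventually.of_forall fun t => ?_)
    rw [Real.norm_of_nonneg (by positivity)]
    have h1 := hJ.nonexpansive hφ.ne_bot one_pos (w t) 0
    have h2 := norm_add_le (J 0) (J (w t) - J 0)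
    rw [add_sub_cancel] at h2
    rw [sub_zero] at h1
    linarith
  set z := hzm.toLp with hz
  have hzt : ∀ᵐ t ∂μ, w t - z t ∈ subdiff φ (z t) := by
    filter_upwards [hzm.coeFn_toLp] with t ht
    rw [ht]
    simpa using hJ (w t)
  have hnonneg : ∀ i, 0 ≤ inner ℝ (x i - (w - z)) (y i - z) := by
    intro i
    rw [L2.inner_def]
    refine integral_nonneg_of_ae ?_
    filter_upwards [hmem i, hzt, Lp.coeFn_sub (x i) (w - z), Lp.coeFn_sub w z,
      Lp.coeFn_sub (y i) z] with t h1 h2 h3 h4 h5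
    rw [h3, h5, Pi.sub_apply, Pi.sub_apply, h4, Pi.sub_apply]
    exact subdiff_monotone hφ.ne_bot h1 h2
  have hlim : Tendsto (fun i => inner ℝ (x i - (w - z)) (y i - z)) F
      (𝓝 (inner ℝ (ξ - (w - z)) (v - z))) := by
    simp only [inner_sub_left (x _), inner_sub_left ξ]
    refine Tendsto.sub (tendsto_inner_of_weak_of_strong hx hB (hy.sub_const z)) ?_
    exact (tendsto_const_nhds).inner (hy.sub_const z)
  have h0 := ge_of_tendsto' hlim hnonneg
  have e : ξ - (w - z) = -(v - z) := by rw [hw]; abel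
  rw [e, inner_neg_left, real_inner_self_eq_norm_sq] at h0
  have hvz : v = z := by
    have : ‖v - z‖ = 0 := by nlinarith [norm_nonneg (v - z)]
    exact sub_eq_zero.1 (norm_eq_zero.1 this)
  filter_upwards [hzt, Lp.coeFn_add v ξ] with t h1 h2
  rw [hw, h2, ← hvz, Pi.add_apply, add_sub_cancel_left] at h1
  exact h1

/-- Arzelà-Ascoli along an ultrafilter, for a perturbation of an equicontinuous sequence. -/
theorem exists_uniform_limit {X ι : Type*} [NormedAddCommGroup X] (F : Ultrafilter ι) {C : Set X}
    (hC : IsCompact C) {S : ℝ} (hS : 0 ≤ S) {u v : ι → ℝ → X} {md : ℝ → ℝ} {e : ι → ℝ}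
    (hmd : Tendsto md (𝓝 0) (𝓝 0)) (he : Tendsto e F (𝓝 0)) (huc : ∀ i, Continuous (u i))
    (hu : ∀ i, ∀ s ∈ Icc 0 S, ∀ t ∈ Icc 0 S, ‖u i s - u i t‖ ≤ md |s - t|)
    (huv : ∀ i, ∀ t ∈ Icc 0 S, ‖u i t - v i t‖ ≤ e i)
    (hv : ∀ i, ∀ t ∈ Icc 0 S, v i t ∈ C) :
    ∃ w : ℝ → X, Continuous w ∧
      (∀ r > 0, ∀ᶠ i in F, ∀ t ∈ Icc 0 S, ‖u i t - w t‖ ≤ r) ∧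
      ∀ r > 0, ∀ᶠ i in F, ∀ t ∈ Icc 0 S, ‖v i t - w t‖ ≤ r := by
  have hex : ∀ t : Icc 0 S, ∃ y, Tendsto (fun i => v i t) F (𝓝 y) := fun t =>
    (exists_tendsto_of_mem_compact hC F fun i => hv i t t.2).imp fun _ h => h.2
  choose w₀ hw₀ using hex
  -- Compactness is available for `v`, equicontinuity for `u`; their vanishing distance lets the two
  -- be combined.
  have hptw : ∀ t : Icc 0 S, Tendsto (fun i => u i t) F (𝓝 (w₀ t)) := fun t => by
    have h1 : Tendsto (fun i => u i t - v i t) F (𝓝 0) :=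
      squeeze_zero_norm (fun i => huv i t t.2) he
    simpa using h1.add (hw₀ t)
  have hequi : Equicontinuous fun i (t : Icc 0 S) => u i t :=
    Metric.equicontinuous_of_continuity_modulus md hmd _ fun s t i => by
      rw [dist_eq_norm, Subtype.dist_eq, Real.dist_eq]
      exact hu i s s.2 t t.2
  have hunif : TendstoUniformly (fun i (t : Icc 0 S) => u i t) w₀ F :=
    UniformFun.tendsto_iff_tendstoUniformly.1
      ((hequi.tendsto_uniformFun_iff_pi F w₀).2 (tendsto_pi_nhds.2 hptw))
  have hw₀c : Continuous w₀ := hunif.continuous (Frequently.of_forall fun i =>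
    (huc i).comp continuous_subtype_val)
  have key : ∀ r > 0, ∀ᶠ i in F, ∀ t ∈ Icc 0 S, ‖u i t - IccExtend hS w₀ t‖ ≤ r := by
    intro r hr
    filter_upwards [Metric.tendstoUniformly_iff.1 hunif r hr] with i hi t ht
    have := hi ⟨t, ht⟩
    rw [IccExtend_of_mem hS w₀ ht, norm_sub_rev, ← dist_eq_norm]
    exact this.le
  refine ⟨IccExtend hS w₀, hw₀c.Icc_extend', key, fun r hr => ?_⟩
  filter_upwards [key (r / 2) (half_pos hr), he.eventually (gt_mem_nhds (half_pos hr))]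
    with i h1 h2 t ht
  have e1 : v i t - IccExtend hS w₀ t = (u i t - IccExtend hS w₀ t) - (u i t - v i t) := by abel
  rw [e1]
  linarith [norm_sub_le (u i t - IccExtend hS w₀ t) (u i t - v i t), h1 t ht, huv i t ht]

end Limits

/-! ### Functions in `L²(0, S)` -/

section L2

open ENNReal NNReal

variable {X : Type*} [NormedAddCommGroup X]

theorem memLp_volOn {g : ℝ → X} {S : ℝ} (hg : Continuous g) (p : ℝ≥0∞) : MemLp g p (volOn S) := by
  obtain ⟨B, hB⟩ := isCompact_Icc.exists_bound_of_continuousOn (hg.continuousOn (s := Icc 0 S))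
  refine MemLp.of_bound hg.aestronglyMeasurable B ?_
  exact (ae_restrict_iff' measurableSet_Ioo).2 (Eventually.of_forall fun t ht =>
    hB t ⟨ht.1.le, ht.2.le⟩)

theorem tendsto_toLp_of_uniform {ι : Type*} {F : Filter ι} {S : ℝ} {v : ι → ℝ → X} {w : ℝ → X}
    (hv : ∀ i, Continuous (v i)) (hw : Continuous w)
    (h : ∀ r > 0, ∀ᶠ i in F, ∀ t ∈ Icc 0 S, ‖v i t - w t‖ ≤ r) :
    Tendsto (fun i => (memLp_volOn (S := S) (hv i) 2).toLp) F
      (𝓝 (memLp_volOn (S := S) hw 2).toLp) := by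
  set K : ℝ := (measureUnivNNReal (volOn S) : ℝ) ^ ((2 : ℝ≥0∞).toReal)⁻¹ with hK
  have hK0 : 0 ≤ K := by positivity
  refine Metric.tendsto_nhds.2 fun e he => ?_
  filter_upwards [h (e / (K + 1)) (by positivity)] with i hi
  rw [dist_eq_norm, ← MemLp.toLp_sub]
  have := Lp.norm_le_of_ae_bound (p := 2) (μ := volOn S)
    (f := ((memLp_volOn (S := S) (hv i) 2).sub (memLp_volOn (S := S) hw 2)).toLp)
    (C := e / (K + 1)) (by positivity) (by
      filter_upwards [MemLp.coeFn_toLp ((memLp_volOn (S := S) (hv i) 2).sub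
        (memLp_volOn (S := S) hw 2)), ae_restrict_mem measurableSet_Ioo] with t h1 h2
      rw [h1]
      exact hi t ⟨h2.1.le, h2.2.le⟩)
  refine this.trans_lt ?_
  rw [← hK, mul_div_assoc', div_lt_iff₀ (by positivity)]
  nlinarith

variable {H : Type*} [NormedAddCommGroup H] [InnerProductSpace ℝ H]

theorem norm_toLp_sq {μ : Measure ℝ} {g : ℝ → H} (hg : MemLp g 2 μ) :
    ‖hg.toLp‖ ^ 2 = ∫ t, ‖g t‖ ^ 2 ∂μ := by
  rw [← real_inner_self_eq_norm_sq, L2.inner_def]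
  refine integral_congr_ae ?_
  filter_upwards [hg.coeFn_toLp] with t ht
  rw [ht, real_inner_self_eq_norm_sq]

/-- As `ℓ` is nonincreasing, `ℓ(S - s) ≥ ℓ(S)` on `(0, S)`, so the convolution at time `S` controls
the plain integral. This is why `ℓ(S) > 0` is required. -/
theorem IsKernel.norm_toLp_sq_le {ℓ : ℝ → ℝ} (hℓ : IsKernel ℓ) {S K : ℝ} (hS : 0 < S)
    (hℓS : 0 < ℓ S) {g : ℝ → H} (hg : Continuous g)
    (hK : volterraConv ℓ (fun s => ‖g s‖ ^ 2) S ≤ K) :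
    ‖(memLp_volOn (S := S) hg 2).toLp‖ ^ 2 ≤ K / ℓ S := by
  have hgc : Continuous fun s => ‖g s‖ ^ 2 := by fun_prop
  rw [norm_toLp_sq, le_div_iff₀ hℓS, ← integral_Ioc_eq_integral_Ioo,
    ← intervalIntegral.integral_of_le hS.le, mul_comm, ← intervalIntegral.integral_const_mul]
  refine le_trans ?_ hK
  rw [volterraConv_eq_integral hS.le le_rfl]
  refine intervalIntegral.integral_mono_on_of_le_Ioo hS.le
    ((hgc.intervalIntegrable _ _).const_mul _)
    (hℓ.intervalIntegrable_smul hgc.continuousOn S) fun s hs => ?_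
  have h1 := hℓ.zeroExt_anti (sub_pos.2 hs.2) (show S - s ≤ S by linarith [hs.1])
  rw [zeroExt_of_pos hS] at h1
  exact mul_le_mul_of_nonneg_right h1 (by positivity)

theorem integral_volOn_Ioo {g : ℝ → X} [NormedSpace ℝ X] {S t : ℝ} (ht : t ∈ Icc 0 S) :
    ∫ s in Ioo 0 t, g s ∂volOn S = ∫ s in (0 : ℝ)..t, g s := by
  rw [Measure.restrict_restrict measurableSet_Ioo, inter_eq_left.2 (Ioo_subset_Ioo_right ht.2),
    intervalIntegral.integral_of_le ht.1, integral_Ioc_eq_integral_Ioo]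

theorem tendsto_inner_integral_of_weak [CompleteSpace H] {ι : Type*} {F : Filter ι} {S : ℝ}
    {ξ : ι → ℝ → H} (hξ : ∀ i, Continuous (ξ i)) {Ξ : Lp H 2 (volOn S)}
    (hlim : ∀ z, Tendsto (fun i => inner ℝ (memLp_volOn (S := S) (hξ i) 2).toLp z) F
      (𝓝 (inner ℝ Ξ z))) {t : ℝ} (ht : t ∈ Icc 0 S) (c : H) :
    Tendsto (fun i => inner ℝ c (∫ s in (0 : ℝ)..t, ξ i s)) F
      (𝓝 (inner ℝ c (∫ s in (0 : ℝ)..t, Ξ s))) := by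
  have h := hlim (indicatorConstLp 2 (s := Ioo 0 t) measurableSet_Ioo (measure_ne_top _ _) c)
  have e : ∀ y : Lp H 2 (volOn S),
      inner ℝ y (indicatorConstLp 2 (s := Ioo 0 t) measurableSet_Ioo (measure_ne_top _ _) c)
        = inner ℝ c (∫ s in (0 : ℝ)..t, y s) := fun y => by
    rw [real_inner_comm, L2.inner_indicatorConstLp_eq_inner_setIntegral ℝ, integral_volOn_Ioo ht]
  rw [e] at h
  refine h.congr fun i => ?_
  rw [e, ← integral_volOn_Ioo ht, ← integral_volOn_Ioo ht]
  congr 1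
  exact integral_congr_ae (ae_restrict_of_ae (MemLp.coeFn_toLp _))

theorem isWeakDeriv_of_eq_integral [NormedSpace ℝ X] [CompleteSpace X] {S : ℝ}
    {v g : ℝ → X} (hg : Integrable g (volOn S))
    (hv : ∀ t ∈ Ioo 0 S, v t = ∫ s in (0 : ℝ)..t, g s) : IsWeakDeriv S v g := by
  intro θ hθ hθc hθs
  have hθ' : Continuous (deriv θ) := hθ.continuous_deriv (by simp)
  have hθS : θ S = 0 := image_eq_zero_of_notMem_tsupport fun h => lt_irrefl S (hθs h).2
  obtain ⟨B, hB⟩ := hθ'.bounded_above_of_compact_support hθc.deriv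
  -- Fubini on `{s < t}`; integrating `deriv θ` from `s` to `S` leaves `-θ s`, since `θ` vanishes at
  -- `S`.
  set Ψ : ℝ → ℝ → X := fun t s => (Iio t).indicator (fun s => deriv θ t • g s) s with hΨ
  have hint : Integrable (Function.uncurry Ψ) ((volOn S).prod (volOn S)) := by
    have h1 : Integrable (fun p : ℝ × ℝ => g p.2) ((volOn S).prod (volOn S)) := hg.comp_snd _
    have hms : MeasurableSet {p : ℝ × ℝ | p.2 < p.1} := measurableSet_lt measurable_snd measurable_fst
    have h2 : AEStronglyMeasurable (fun p : ℝ × ℝ => deriv θ p.1 • g p.2)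
        ((volOn S).prod (volOn S)) :=
      (hθ'.comp continuous_fst).aestronglyMeasurable.smul h1.aestronglyMeasurable
    have h3 : Integrable (fun p : ℝ × ℝ => deriv θ p.1 • g p.2) ((volOn S).prod (volOn S)) := by
      refine (h1.norm.const_mul B).mono' h2 (Eventually.of_forall fun p => ?_)
      rw [norm_smul]
      exact mul_le_mul_of_nonneg_right (hB _) (norm_nonneg _)
    refine (h3.indicator hms).congr (Eventually.of_forall fun p => ?_)
    simp only [Function.uncurry, hΨ]
    by_cases hp : p.2 < p.1
    · rw [indicator_of_mem (show p ∈ {p : ℝ × ℝ | p.2 < p.1} from hp),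
        indicator_of_mem (show p.2 ∈ Iio p.1 from hp)]
    · rw [indicator_of_notMem (show p ∉ {p : ℝ × ℝ | p.2 < p.1} from hp),
        indicator_of_notMem (show p.2 ∉ Iio p.1 from hp)]
  have e1 : ∫ t in Ioo 0 S, deriv θ t • v t = ∫ t, ∫ s, Ψ t s ∂volOn S ∂volOn S := by
    refine setIntegral_congr_fun measurableSet_Ioo fun t ht => ?_
    simp only [hΨ]
    rw [integral_indicator measurableSet_Iio, integral_smul, hv t ht,
      Measure.restrict_restrict measurableSet_Iio, Iio_inter_Ioo, min_eq_left ht.2.le,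
      intervalIntegral.integral_of_le ht.1.le, integral_Ioc_eq_integral_Ioo]
  rw [e1, integral_integral_swap hint, ← integral_neg]
  refine setIntegral_congr_fun measurableSet_Ioo fun s hs => ?_
  have e2 : ∀ t, Ψ t s = (Ioi s).indicator (fun t => deriv θ t) t • g s := fun t => by
    simp only [hΨ]
    by_cases ht : s < t
    · rw [indicator_of_mem (mem_Iio.2 ht), indicator_of_mem (mem_Ioi.2 ht)]
    · rw [indicator_of_notMem (fun h => ht (mem_Iio.1 h)),
        indicator_of_notMem (fun h => ht (mem_Ioi.1 h)), zero_smul]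
  simp only [e2]
  rw [integral_smul_const, integral_indicator measurableSet_Ioi,
    Measure.restrict_restrict measurableSet_Ioi, inter_comm, Ioo_inter_Ioi, max_eq_right hs.1.le,
    ← integral_Ioc_eq_integral_Ioo, ← intervalIntegral.integral_of_le hs.2.le,
    intervalIntegral.integral_deriv_eq_sub (fun x _ => (hθ.differentiable (by simp)) x)
      (hθ'.intervalIntegrable _ _), hθS, zero_sub, neg_smul]

end L2

/-! ### Strong solutions -/

section Existence

open ENNReal NNReal

variable {H : Type*} [NormedAddCommGroup H] [InnerProductSpace ℝ H] {k ℓ : ℝ → ℝ}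
  {φ φ₁ φ₂ : H → EReal}

theorem IsProperLscConvex.energyBounded (hφ : IsProperLscConvex φ) {w : ℝ → H} (hw : Continuous w)
    {S K : ℝ} (hK : ∀ t ∈ Icc 0 S, φ (w t) ≤ (K : EReal)) : EnergyBounded φ S w := by
  have hD : ∀ t ∈ Icc 0 S, w t ∈ effDomain φ := fun t ht =>
    lt_of_le_of_lt (hK t ht) (EReal.coe_lt_top _)
  obtain ⟨α, β, hα, hβ, hmin⟩ := hφ.exists_affine_minorant
  obtain ⟨B, hB⟩ := isCompact_Icc.exists_bound_of_continuousOn (hw.continuousOn (s := Icc 0 S))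
  refine ⟨(ae_restrict_iff' measurableSet_Ioo).2 (Eventually.of_forall fun t ht =>
    hD t ⟨ht.1.le, ht.2.le⟩), ?_⟩
  have hmeas : Measurable fun t => (φ (w t)).toReal :=
    measurable_ereal_toReal.comp (hφ.lsc.comp hw).measurable
  refine memLp_top_of_bound hmeas.aestronglyMeasurable (|K| + (α * B + β))
    ((ae_restrict_iff' measurableSet_Ioo).2 (Eventually.of_forall fun t ht => ?_))
  have htI : t ∈ Icc 0 S := ⟨ht.1.le, ht.2.le⟩
  have h1 := hK t htI
  rw [← hφ.coe_toReal (hD t htI), EReal.coe_le_coe_iff] at h1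
  have h2 := hmin _ (hD t htI)
  have h3 := mul_le_mul_of_nonneg_left (hB t htI) hα
  have h4 : 0 ≤ α * B := (mul_nonneg hα (norm_nonneg _)).trans h3
  have h5 := le_abs_self K
  have h6 := abs_nonneg K
  rw [Real.norm_eq_abs, abs_le]
  constructor <;> linarith

theorem IsKernel.tendsto_volterraConv_of_uniform {X ι : Type*} [NormedAddCommGroup X]
    [NormedSpace ℝ X] (hk : IsKernel k) {F : Filter ι} {u : ι → ℝ → X} {w : ℝ → X} {S : ℝ}
    (hu : ∀ i, Continuous (u i)) (hw : Continuous w)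
    (h : ∀ r > 0, ∀ᶠ i in F, ∀ t ∈ Icc 0 S, ‖u i t - w t‖ ≤ r) (u₀ : X) {t : ℝ}
    (ht : t ∈ Icc 0 S) :
    Tendsto (fun i => volterraConv k (fun s => u i s - u₀) t) F
      (𝓝 (volterraConv k (fun s => w s - u₀) t)) := by
  have hL := hk.primitive_nonneg ht.1
  refine Metric.tendsto_nhds.2 fun e he => ?_
  filter_upwards [h (e / (primitive k t + 1)) (by positivity)] with i hi
  have hui := hu i
  have e1 : volterraConv k (fun s => u i s - u₀) t = volterraConv k (fun s => w s - u₀) t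
      + volterraConv k (fun s => u i s - w s) t := by
    rw [← hk.volterraConv_add ht.1 (by fun_prop) (by fun_prop)]
    congr 1
    ext s
    abel
  rw [dist_eq_norm, e1, add_sub_cancel_left]
  have h1 := hk.volterraConv_mono (g := fun s => ‖u i s - w s‖)
    (g' := fun _ => e / (primitive k t + 1)) ht.1 (by fun_prop) (by fun_prop)
    fun s hs => hi s ⟨hs.1, hs.2.trans ht.2⟩
  rw [hk.volterraConv_const ht.1] at h1
  refine ((hk.norm_volterraConv_le ht.1).trans h1).trans_lt ?_
  rw [mul_div_assoc', div_lt_iff₀ (by positivity)]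
  nlinarith

/-- The passage to the limit, on any interval short enough for the uniform bounds and on which `ℓ`
stays positive. -/
theorem IsConjugatePair.exists_strong_solution [CompleteSpace H] (hk : IsConjugatePair k ℓ)
    (hφ₁ : IsProperLscConvex φ₁) (hφ₂ : IsProperLscConvex φ₂) (hcpt : CompactSublevels φ₁)
    {ν : ℝ} (hν0 : 0 ≤ ν) (hν1 : ν < 1)
    {M : ℝ → ℝ} (hM0 : ∀ r, 0 ≤ M r) (hM : Monotone M) (hgrowth : GrowthCondition φ₁ φ₂ ν M)
    {u₀ : H} (hu₀ : u₀ ∈ effDomain φ₁) {f : ℝ → H} {S T c r : ℝ} (hf : MemLp f 2 (volOn T))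
    (hfc : ∀ᵐ y ∂volOn T, volterraConv ℓ (fun s => ‖f s‖ ^ 2) y ≤ c) (hc : 0 ≤ c)
    (hS : 0 < S) (hST : S ≤ T) (hℓS : 0 < ℓ S)
    (hr : r = ‖u₀‖ + (φ₁ u₀).toReal + c + (1 - ν)⁻¹ * c + 4)
    (hS1 : 24 * primitive ℓ S ≤ 1 - ν) (hS2 : M r ^ 2 * primitive ℓ S ≤ 1 - ν) :
    ∃ u : ℝ → H, IsStrongSolution k φ₁ φ₂ u₀ f S u ∧ Continuous u ∧ u 0 = u₀ ∧
      EnergyBounded φ₁ S u := by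
  have hℓ := hk.right
  obtain ⟨K, hK0, hK⟩ := exists_approximate_solutions hk hφ₁ hφ₂ hν0 hν1 hM0 hM hgrowth hu₀ hc
    hS.le hr hS1 hS2
  set fb : ℝ → H := (Ioo 0 T).indicator f with hfb
  have hfbi : Integrable fb :=
    (integrable_indicator_iff measurableSet_Ioo).2 (hf.integrable one_le_two)
  -- One parameter serves as Yosida parameter and as averaging window for `f`.
  set lam : ℕ → ℝ := fun n => 1 / ((n : ℝ) + 1) with hlam
  have hlam0 : ∀ n, 0 < lam n := fun n => by positivity
  have hlam1 : ∀ n, lam n ≤ 1 := fun n => by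
    rw [hlam, div_le_one (by positivity)]
    linarith [n.cast_nonneg (α := ℝ)]
  have hlamlim : Tendsto lam atTop (𝓝 0) := tendsto_one_div_add_atTop_nhds_zero_nat
  set fn : ℕ → ℝ → H := fun n => backwardAverage (lam n) fb with hfn
  have hfnc : ∀ n, Continuous (fn n) := fun n => continuous_backwardAverage hfbi _
  have hfnb : ∀ n, ∀ t ∈ Icc 0 S, volterraConv ℓ (fun s => ‖fn n s‖ ^ 2) t ≤ c := fun n t ht =>
    hℓ.volterraConv_backwardAverage_le hfbi hc (hlam0 n) ⟨ht.1, ht.2.trans hST⟩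
      (hℓ.lintegral_le_of_volterraConv_le hf hfc)
  choose u v ξ η huc hvc hξc hηc hsol hvu hξ hη hb using fun n =>
    hK (fn n) (lam n) (hfnc n) (hlam0 n) (hlam1 n) (hfnb n)
  -- All limits, uniform and weak, are taken along this one ultrafilter, so no subsequences have to
  -- be matched.
  set F : Ultrafilter ℕ := hyperfilter ℕ with hF
  have hFtop : (F : Filter ℕ) ≤ atTop := Nat.hyperfilter_le_atTop
  have hlamF : Tendsto lam F (𝓝 0) := hlamlim.mono_left hFtop
  have hgc : ∀ n, Continuous fun s => fn n s - ξ n s + η n s := fun n =>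
    ((hfnc n).sub (hξc n)).add (hηc n)
  have hsub : ∀ n, ∀ s ∈ Icc 0 S, ∀ t ∈ Icc 0 S, s ≤ t →
      ‖u n t - u n s‖ ≤ √(4 * K * primitive ℓ (t - s)) := by
    intro n s hs t ht hst
    refine Real.le_sqrt_of_sq_le ?_
    rw [hsol n t ht, hsol n s hs, add_sub_add_left_eq_sub]
    exact hℓ.norm_volterraConv_sub_sq_le hs.1 hst (hgc n).continuousOn
      (hb n s hs).2.2.2.2.2.1 (hb n t ht).2.2.2.2.2.1
  obtain ⟨w, hwc, huw, hvw⟩ := exists_uniform_limit F (hcpt r) hS.le (u := u) (v := v)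
    (md := fun d => √(4 * K * primitive ℓ d)) (e := fun n => √(K * lam n))
    (by
      have hcont := hℓ.continuous_primitive
      have : Continuous fun d => √(4 * K * primitive ℓ d) := by fun_prop
      simpa [primitive_of_nonpos] using this.tendsto 0)
    (by simpa using (hlamF.const_mul K).sqrt) huc
    (fun n s hs t ht => by
      rcases le_total s t with h | h
      · rw [abs_sub_comm, abs_of_nonneg (sub_nonneg.2 h), norm_sub_rev]
        exact hsub n s hs t ht h
      · rw [abs_of_nonneg (sub_nonneg.2 h)]
        exact hsub n t ht s hs h)
    (fun n t ht => by
      refine Real.le_sqrt_of_sq_le ?_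
      rw [hvu, _root_.sub_sub_cancel, norm_smul, Real.norm_of_nonneg (hlam0 n).le]
      have := mul_le_mul_of_nonneg_right (hb n t ht).2.2.2.1 (hlam0 n).le
      linarith)
    (fun n t ht => subset_closure (by
      change φ₁ (v n t) + ((‖v n t‖ : ℝ) : EReal) ≤ (r : EReal)
      rw [← hφ₁.coe_toReal (hξ n t).1, ← EReal.coe_add, EReal.coe_le_coe_iff]
      exact (hb n t ht).1))
  have h0S : (0 : ℝ) ∈ Icc 0 S := ⟨le_rfl, hS.le⟩
  have hw0 : w 0 = u₀ := by
    have h1 : ∀ r > 0, ‖u₀ - w 0‖ ≤ r := by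
      intro r hr
      obtain ⟨n, hn⟩ := (huw r hr).exists
      have := hn 0 h0S
      rwa [hsol n 0 h0S, volterraConv_zero, add_zero] at this
    have h2 : ‖u₀ - w 0‖ ≤ 0 := le_of_forall_pos_le_add fun r hr => by simpa using h1 r hr
    exact (sub_eq_zero.1 (norm_le_zero_iff.1 h2)).symm
  have hvptw : ∀ t ∈ Icc 0 S, Tendsto (fun n => v n t) F (𝓝 (w t)) := fun t ht => by
    refine Metric.tendsto_nhds.2 fun e he => ?_
    filter_upwards [hvw (e / 2) (half_pos he)] with n hn
    rw [dist_eq_norm]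
    exact (hn t ht).trans_lt (half_lt_self he)
  have henergy : ∀ t ∈ Icc 0 S, φ₁ (w t) ≤ (K : EReal) := fun t ht =>
    hφ₁.le_of_tendsto (hvptw t ht) tendsto_const_nhds (Eventually.of_forall fun n => by
      rw [← hφ₁.coe_toReal (hξ n t).1, EReal.coe_le_coe_iff]
      exact (hb n t ht).2.1)
  -- bounds in `L²` and weak limits
  have hSS : S ∈ Icc 0 S := ⟨hS.le, le_rfl⟩
  set xi : ℕ → Lp H 2 (volOn S) := fun n => (memLp_volOn (S := S) (hξc n) 2).toLp with hxi
  set et : ℕ → Lp H 2 (volOn S) := fun n => (memLp_volOn (S := S) (hηc n) 2).toLp with het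
  have hxiB : ∀ n, ‖xi n‖ ≤ √(K / ℓ S) := fun n =>
    Real.le_sqrt_of_sq_le (hℓ.norm_toLp_sq_le hS hℓS (hξc n) (hb n S hSS).2.2.2.2.1)
  have hηK : ∀ n, volterraConv ℓ (fun s => ‖η n s‖ ^ 2) S ≤ 2 * K + primitive ℓ S * (2 * K ^ 2) := by
    intro n
    have hξn := hξc n
    have hηn := hηc n
    have h1 := hℓ.volterraConv_mono (g := fun s => ‖η n s‖ ^ 2)
      (g' := fun s => 2 * ‖ξ n s‖ ^ 2 + 2 * K ^ 2) hS.le (by fun_prop) (by fun_prop)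
      fun s hs => by
        have h2 := (hb n s hs).2.2.2.2.2.2
        have h3 := pow_le_pow_left₀ (norm_nonneg _) h2 2
        nlinarith [sq_nonneg (‖ξ n s‖ - K)]
    rw [hℓ.volterraConv_add hS.le (by fun_prop) (by fun_prop), volterraConv_const_mul,
      hℓ.volterraConv_const hS.le] at h1
    linarith [(hb n S hSS).2.2.2.2.1]
  have hetB : ∀ n, ‖et n‖ ≤ √((2 * K + primitive ℓ S * (2 * K ^ 2)) / ℓ S) := fun n =>
    Real.le_sqrt_of_sq_le (hℓ.norm_toLp_sq_le hS hℓS (hηc n) (hηK n))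
  obtain ⟨Ξ, hΞ⟩ := exists_weak_limit F hxiB
  obtain ⟨Η, hΗ⟩ := exists_weak_limit F hetB
  set W : Lp H 2 (volOn S) := (memLp_volOn (S := S) hwc 2).toLp with hW
  have hWt : ∀ᵐ t ∂volOn S, W t = w t := MemLp.coeFn_toLp _
  set vL : ℕ → Lp H 2 (volOn S) := fun n => (memLp_volOn (S := S) (hvc n) 2).toLp with hvL
  have hvLim : Tendsto vL F (𝓝 W) := tendsto_toLp_of_uniform hvc hwc hvw
  have hmem₁ : ∀ᵐ t ∂volOn S, Ξ t ∈ subdiff φ₁ (w t) := by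
    have h := mem_subdiff_of_weak_limit hφ₁ (fun n => by
      filter_upwards [MemLp.coeFn_toLp (memLp_volOn (S := S) (hξc n) 2),
        MemLp.coeFn_toLp (memLp_volOn (S := S) (hvc n) 2)] with t h1 h2
      rw [h1, h2]
      exact hξ n t) hΞ hxiB hvLim
    filter_upwards [h, hWt] with t h1 h2
    rwa [h2] at h1
  have hmem₂ : ∀ᵐ t ∂volOn S, Η t ∈ subdiff φ₂ (w t) := by
    -- `η n` is a subgradient at the doubly resolved point `v n - lam n • η n`, which has the same
    -- `L²` limit because `et` is bounded and `lam` tends to `0`.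
    have hlim : Tendsto (fun n => vL n - lam n • et n) F (𝓝 W) := by
      have h1 : Tendsto (fun n => lam n • et n) F (𝓝 0) := by
        refine squeeze_zero_norm (fun n => ?_)
          (by simpa using hlamF.mul_const √((2 * K + primitive ℓ S * (2 * K ^ 2)) / ℓ S))
        rw [norm_smul, Real.norm_of_nonneg (hlam0 n).le]
        exact mul_le_mul_of_nonneg_left (hetB n) (hlam0 n).le
      simpa using hvLim.sub h1
    have h := mem_subdiff_of_weak_limit hφ₂ (fun n => by
      filter_upwards [MemLp.coeFn_toLp (memLp_volOn (S := S) (hηc n) 2),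
        MemLp.coeFn_toLp (memLp_volOn (S := S) (hvc n) 2), Lp.coeFn_sub (vL n) (lam n • et n),
        Lp.coeFn_smul (lam n) (et n), ae_restrict_mem measurableSet_Ioo] with t h1 h2 h3 h4 h5
      rw [h3, Pi.sub_apply, h4, Pi.smul_apply, h1, h2]
      exact hη n t ⟨h5.1.le, h5.2.le⟩) hΗ hetB hlim
    filter_upwards [h, hWt] with t h1 h2
    rwa [h2] at h1
  -- the limit equation
  have hfS : MemLp f 2 (volOn S) :=
    hf.mono_measure (Measure.restrict_mono (Ioo_subset_Ioo_right hST) le_rfl)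
  have hgm : MemLp (fun t => f t - Ξ t + Η t) 2 (volOn S) :=
    (hfS.sub (Lp.memLp Ξ)).add (Lp.memLp Η)
  have hII : ∀ {g : ℝ → H}, MemLp g 2 (volOn S) → ∀ t ∈ Icc 0 S, IntervalIntegrable g volume 0 t := by
    intro g hg t ht
    rw [intervalIntegrable_iff_integrableOn_Ioo_of_le ht.1]
    exact IntegrableOn.mono_set (hg.integrable one_le_two) (Ioo_subset_Ioo_right ht.2)
  have hlimeq : ∀ t ∈ Icc 0 S,
      volterraConv k (fun s => w s - u₀) t = ∫ s in (0 : ℝ)..t, (f s - Ξ s + Η s) := by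
    intro t ht
    -- The integrals of `ξ n` and `η n` converge only weakly in `H`, so the identity is tested
    -- against a fixed vector.
    refine ext_inner_left ℝ fun x => ?_
    have l1 := (tendsto_const_nhds (x := x)).inner (𝕜 := ℝ)
      (hk.left.tendsto_volterraConv_of_uniform (u := u) huc hwc huw u₀ ht)
    refine tendsto_nhds_unique l1 ?_
    have e1 : ∀ n, volterraConv k (fun s => u n s - u₀) t
        = (∫ s in (0 : ℝ)..t, fn n s) - (∫ s in (0 : ℝ)..t, ξ n s) + ∫ s in (0 : ℝ)..t, η n s := by
      intro n
      have j : IntervalIntegrable (fun s => fn n s - ξ n s) volume 0 t :=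
        ((hfnc n).sub (hξc n)).intervalIntegrable _ _
      rw [volterraConv_congr (g' := volterraConv ℓ fun s => fn n s - ξ n s + η n s) ht.1
        fun s hs => by rw [hsol n s ⟨hs.1, hs.2.trans ht.2⟩, add_sub_cancel_left],
        hk.volterraConv_volterraConv ht.1 (hgc n), intervalIntegral.integral_add
          j ((hηc n).intervalIntegrable _ _),
        intervalIntegral.integral_sub ((hfnc n).intervalIntegrable _ _)
          ((hξc n).intervalIntegrable _ _)]
    have e2 : ∫ s in (0 : ℝ)..t, fb s = ∫ s in (0 : ℝ)..t, f s := by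
      rw [intervalIntegral.integral_of_le ht.1, intervalIntegral.integral_of_le ht.1,
        integral_Ioc_eq_integral_Ioo, integral_Ioc_eq_integral_Ioo]
      refine setIntegral_congr_fun measurableSet_Ioo fun s hs => ?_
      exact indicator_of_mem (show s ∈ Ioo 0 T from ⟨hs.1, hs.2.trans_le (ht.2.trans hST)⟩) f
    have hpos : Tendsto lam F (𝓝[>] 0) :=
      tendsto_nhdsWithin_iff.2 ⟨hlamF, Eventually.of_forall hlam0⟩
    have l2 := (tendsto_const_nhds (x := x)).inner (𝕜 := ℝ)
      ((tendsto_integral_backwardAverage hfbi (fun s hs =>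
        indicator_of_notMem (fun h => not_lt.2 hs h.1) f) t).comp hpos)
    rw [e2] at l2
    have l3 := tendsto_inner_integral_of_weak hξc hΞ ht x
    have l4 := tendsto_inner_integral_of_weak hηc hΗ ht x
    have l5 := (l2.sub l3).add l4
    have j : IntervalIntegrable (fun s => f s - Ξ s) volume 0 t :=
      (hII hfS t ht).sub (hII (Lp.memLp Ξ) t ht)
    rw [intervalIntegral.integral_add j (hII (Lp.memLp Η) t ht), intervalIntegral.integral_sub (hII hfS t ht)
      (hII (Lp.memLp Ξ) t ht), inner_add_right, inner_sub_right]
    refine l5.congr fun n => ?_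
    rw [e1, inner_add_right, inner_sub_right]
    rfl
  have hVc : ContinuousOn (volterraConv k fun t => w t - u₀) (Icc 0 S) :=
    hk.left.continuousOn_volterraConv (by fun_prop)
  refine ⟨w, ⟨memLp_volOn hwc 2, ⟨_, hVc, EventuallyEq.rfl, volterraConv_zero _⟩, ?_,
    fun t => f t - Ξ t + Η t, Ξ, Η, ⟨?_, hgm, ?_⟩, Lp.memLp Ξ, Lp.memLp Η, ?_⟩, hwc, hw0,
    hφ₁.energyBounded hwc henergy⟩
  · filter_upwards [hmem₁, hmem₂] with t h1 h2 using ⟨⟨_, h1⟩, ⟨_, h2⟩⟩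
  · obtain ⟨B, hB⟩ := isCompact_Icc.exists_bound_of_continuousOn hVc
    refine MemLp.of_bound ((hVc.mono Ioo_subset_Icc_self).aestronglyMeasurable measurableSet_Ioo) B
      ((ae_restrict_iff' measurableSet_Ioo).2 (Eventually.of_forall fun t ht =>
        hB t ⟨ht.1.le, ht.2.le⟩))
  · exact isWeakDeriv_of_eq_integral (hgm.integrable one_le_two) fun t ht =>
      hlimeq t ⟨ht.1.le, ht.2.le⟩
  · filter_upwards [hmem₁, hmem₂] with t h1 h2
    refine ⟨h1, h2, ?_⟩
    abel

theorem IsConjugatePair.exists_pos (hk : IsConjugatePair k ℓ) : ∃ t > 0, 0 < ℓ t := by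
  by_contra! h
  have h0 : ∀ t, 0 < t → ℓ t = 0 := fun t ht => le_antisymm (h t ht) (hk.right.nonneg t ht)
  have h1 := hk.conv_eq_one 1 one_pos
  rw [volterraConv_eq_integral zero_le_one le_rfl, intervalIntegral.integral_of_le zero_le_one,
    setIntegral_congr_fun (g := fun _ => (0 : ℝ)) measurableSet_Ioc fun s hs => by
      simp only [h0 s hs.1, smul_zero]] at h1
  simp at h1

/-- The primitive tends to `0` at the origin, and positivity of `ℓ` at one point passes to all
earlier ones. The choice involves only `ℓ`, `δ` and `m`. -/
theorem IsKernel.exists_small_time (hℓ : IsKernel ℓ) (hpos : ∃ t > 0, 0 < ℓ t) {δ m : ℝ}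
    (hδ : 0 < δ) : ∃ R > 0, ∀ S, 0 < S → S ≤ R →
      0 < ℓ S ∧ 24 * primitive ℓ S ≤ δ ∧ m ^ 2 * primitive ℓ S ≤ δ := by
  obtain ⟨t, ht, hℓt⟩ := hpos
  have hlim : Tendsto (fun S => (24 + m ^ 2) * primitive ℓ S) (𝓝[>] 0) (𝓝 0) := by
    have hc := hℓ.continuous_primitive
    have : Continuous fun S => (24 + m ^ 2) * primitive ℓ S := by fun_prop
    simpa [primitive_of_nonpos] using (this.tendsto 0).mono_left (nhdsWithin_le_nhds (s := Ioi 0))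
  obtain ⟨R, hR, hR0⟩ := ((hlim.eventually (gt_mem_nhds hδ)).and
    (Ioc_mem_nhdsGT ht)).exists
  refine ⟨R, hR0.1, fun S hS hSR => ?_⟩
  have h1 := hℓ.primitive_nonneg hS.le
  have h2 := hℓ.primitive_mono hSR
  have h3 : (24 + m ^ 2) * primitive ℓ S ≤ (24 + m ^ 2) * primitive ℓ R := by gcongr
  have h4 : 0 ≤ m ^ 2 * primitive ℓ S := by positivity
  exact ⟨hℓt.trans_le (hℓ.antitone hS ht (hSR.trans hR0.2)), by linarith, by linarith⟩

end Existence

end TimeFractional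

/-! ### The local existence theorem, with `R` chosen before the space and the functionals. -/

theorem theorem2p2 (ℓ : ℝ → ℝ) (ν : ℝ) (hν₀ : 0 ≤ ν) (hν₁ : ν < 1)
    (M : ℝ → ℝ) (hM₀ : ∀ r, 0 ≤ M r) (hM : Monotone M) (a b c : ℝ) :
    ∃ R : ℝ, 0 < R ∧
      ∀ (H : Type*) [NormedAddCommGroup H] [InnerProductSpace ℝ H] [CompleteSpace H]
        (k : ℝ → ℝ) (φ₁ φ₂ : H → EReal) (T : ℝ) (u₀ : H) (f : ℝ → H),
        IsConjugatePair k ℓ →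
        IsProperLscConvex φ₁ →
        IsProperLscConvex φ₂ →
        CompactSublevels φ₁ →
        GrowthCondition φ₁ φ₂ ν M →
        0 < T →
        u₀ ∈ effDomain φ₁ →
        MemLp f 2 (volOn T) →
        MemLp (volterraConv ℓ fun t => ‖f t‖ ^ 2) ⊤ (volOn T) →
        ‖u₀‖ = a →
        φ₁ u₀ = (b : EReal) →
        (eLpNorm (volterraConv ℓ fun t => ‖f t‖ ^ 2) ⊤ (volOn T)).toReal = c →
        ∃ u : ℝ → H,
          IsStrongSolution k φ₁ φ₂ u₀ f (min R T) u ∧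
          ContinuousOn u (Icc 0 (min R T)) ∧
          u 0 = u₀ ∧
          EnergyBounded φ₁ (min R T) u := by
  -- `R` must be chosen before any `k` is given, so the consequences of conjugacy for `ℓ` alone are
  -- decided here. If they fail, no conjugate `k` exists and any positive `R` works.
  by_cases hℓ : IsKernel ℓ ∧ ∃ t > 0, 0 < ℓ t
  · obtain ⟨R, hR, hsmall⟩ := hℓ.1.exists_small_time hℓ.2
      (m := M (a + b + c + (1 - ν)⁻¹ * c + 4)) (sub_pos.2 hν₁)
    refine ⟨R, hR, ?_⟩
    intro H _ _ _ k φ₁ φ₂ T u₀ f hk hφ₁ hφ₂ hcpt hgrowth hT hu₀ hf hℓf ha hb hc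
    have hS : 0 < min R T := lt_min hR hT
    obtain ⟨h1, h2, h3⟩ := hsmall (min R T) hS (min_le_left _ _)
    have hfc : ∀ᵐ y ∂volOn T, volterraConv ℓ (fun s => ‖f s‖ ^ 2) y ≤ c := by
      rw [eLpNorm_exponent_top] at hc
      filter_upwards [ae_le_eLpNormEssSup (f := volterraConv ℓ fun t => ‖f t‖ ^ 2)
        (μ := volOn T)] with y hy
      have hfin := hℓf.eLpNorm_lt_top
      rw [eLpNorm_exponent_top] at hfin
      have h4 := ENNReal.toReal_mono hfin.ne hy
      rw [hc, toReal_enorm] at h4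
      exact (Real.le_norm_self _).trans h4
    obtain ⟨u, hu1, hu2, hu3, hu4⟩ := hk.exists_strong_solution hφ₁ hφ₂ hcpt hν₀ hν₁ hM₀ hM
      hgrowth hu₀ hf hfc (hc ▸ ENNReal.toReal_nonneg) hS (min_le_right _ _) h1 rfl h2
      (by rw [ha, hb, EReal.toReal_coe]; exact h3)
    exact ⟨u, hu1, hu2.continuousOn, hu3, hu4⟩
  · refine ⟨1, one_pos, ?_⟩
    intro H _ _ _ k φ₁ φ₂ T u₀ f hk
    exact absurd ⟨hk.right, hk.exists_pos⟩ hℓ
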